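/- Let $(N,g)$ be a compact oriented smooth Riemannian 3-manifold without boundary (for instance $\partial\overline M_R$ with the induced metric). On the trivial $\mathrm{SU}(2)$ bundle over $N$ take two connections $\nabla_A=d+A$ and $\nabla_B=d+B$, given in some gauge by $\mathfrak{su}(2)$-valued 1-forms $A,B$, with curvatures $F_A=dA+A\wedge A$ and $F_B=dB+B\wedge B$, and let $$\tau(A)=-\frac1{8\pi^2}\int_N\mathrm{tr}\Big(dA\wedge A+\frac23A\wedge A\wedge A\Big)$$ be the Chern–Simons functional (derivatives are weak derivatives). Pointwise norms are those induced by $g$ and the inner product $\langle X,Y\rangle=-\mathrm{tr}(XY)$ on $\mathfrak{su}(2)$ (for a 2-form $|F|^2=\sum_{i<j}|F_{ij}|^2$ in an orthonormal frame). Write $L^p_1$ for the space of $\mathfrak{su}(2)$-valued 1-forms $a$ such that $a$ and its weak covariant derivative $\nabla a$ (with respect to the Levi-Civita connection and $d$) lie in $L^p$, and take the norm of $L^p_1$ with respect to $g$ and the connection $\nabla_B$: $$\|a\|_{L^p_1}=\Big(\int_N|a|^p+\int_N|\nabla_Ba|^p\Big)^{1/p}.$$ (i) Let $A,B\in L^2_1$.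 Then $\tau(A)$ and $\tau(B)$ are given by absolutely convergent integrals, $F_A,F_B\in L^2$, $\|A-B\|_{L^2_1}<\infty$, and there is a constant $0<c_1<\infty$, depending only on $(N,g)$ and $B$, with $\|a\|_{L^3}\le c_1\|a\|_{L^2_1}$ for all $a\in L^2_1$. For every such constant $c_1$, $$|\tau(A)-\tau(B)|\le\big(\|F_A\|_{L^2}+\|F_B\|_{L^2}\big)\|A-B\|_{L^2_1}+c_1^3\|A-B\|_{L^2_1}^3 .$$ (ii) Let $A,B\in L^{3/2}_1$. Then $\tau(A)$ and $\tau(B)$ are given by absolutely convergent integrals, $\|B\|_{L^{3/2}_1}$ and $\|A-B\|_{L^{3/2}_1}$ are finite, and there is a constant $0<c_4<\infty$, depending only on $(N,g)$ and $B$, with $\|a\|_{L^3}\le c_4\|a\|_{L^{3/2}_1}$ for all $a\in L^{3/2}_1$. For every such constant $c_4$, $$|\tau(A)-\tau(B)|\le c_2\|A-B\|_{L^{3/2}_1}+c_3\|A-B\|_{L^{3/2}_1}^3,$$ where $$c_2=c_4+(c_4+c_4^3)\|B\|_{L^{3/2}_1}+c_4^3\|B\|_{L^{3/2}_1}^2,\qquad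 c_3=c_4+c_4^3+c_4^3\|B\|_{L^{3/2}_1}.$$ -/

import Mathlib

open MeasureTheory Set Bundle Matrix
open scoped Manifold ContDiff ENNReal NNReal Topology

noncomputable section

namespace CSBound

attribute [local instance] LieRing.ofAssociativeRing

/-- The model space of a three-manifold. -/
abbrev E3 : Type := EuclideanSpace ℝ (Fin 3)

/-- The Lie algebra `𝔰𝔲(2)` of trace-free anti-Hermitian complex `2 × 2` matrices. -/
def su2 : LieSubalgebra ℝ (Matrix (Fin 2) (Fin 2) ℂ) where
  carrier := {X | Xᴴ = -X ∧ X.trace = 0}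
  add_mem' := by
    rintro X Y ⟨hX, hX'⟩ ⟨hY, hY'⟩
    exact ⟨by rw [conjTranspose_add, hX, hY, neg_add], by rw [trace_add, hX', hY', add_zero]⟩
  zero_mem' := ⟨by simp, by simp⟩
  smul_mem' := by
    rintro c X ⟨hX, hX'⟩
    exact ⟨by rw [conjTranspose_smul, hX, smul_neg]; rfl, by rw [trace_smul, hX', smul_zero]⟩
  lie_mem' := by
    rintro X Y ⟨hX, hX'⟩ ⟨hY, hY'⟩
    refine ⟨?_, ?_⟩
    · rw [Ring.lie_def, conjTranspose_sub, conjTranspose_mul, conjTranspose_mul, hX, hY]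
      simp
    · rw [Ring.lie_def, trace_sub, trace_mul_comm, sub_self]

/-- The invariant inner product `⟨X, Y⟩ = -tr (X Y) = tr (X* Y)` on `𝔰𝔲(2)`. -/
def suInner (X Y : su2) : ℝ := (trace ((X : Matrix (Fin 2) (Fin 2) ℂ)ᴴ * (Y : Matrix (Fin 2) (Fin 2) ℂ))).re

section Manifold

variable {M : Type*} [TopologicalSpace M] [ChartedSpace E3 M]

variable (M) in
/-- `𝔰𝔲(2)`-valued one-forms (no regularity). In a gauge on the trivial bundle they are the
connection forms `A` of the `SU(2)` connections `d + A`. -/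
abbrev OneForm : Type _ := (x : M) → TangentSpace 𝓘(ℝ, E3) x →ₗ[ℝ] su2

variable (M) in
/-- `𝔰𝔲(2)`-valued covariant two-tensors (no regularity), among them the two-forms. -/
abbrev TwoTensor : Type _ :=
  (x : M) → TangentSpace 𝓘(ℝ, E3) x →ₗ[ℝ] TangentSpace 𝓘(ℝ, E3) x →ₗ[ℝ] su2

/-- The coordinate vector field `∂ᵢ` of the chart `e`, at a point `x` of its source. -/
def coordVec (e : OpenPartialHomeomorph M E3) (x : M) (i : Fin 3) : TangentSpace 𝓘(ℝ, E3) x :=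
  (mfderiv 𝓘(ℝ, E3) 𝓘(ℝ, E3) e x).inverse
    ((NormedSpace.fromTangentSpace (𝕜 := ℝ) (e x)).symm (EuclideanSpace.single i (1 : ℝ)))

/-- The coordinate basis of `T_x M` in the preferred chart at `x`. It is only used to evaluate
expressions that do not depend on the choice of a basis of `T_x M`. -/
def frame (x : M) (i : Fin 3) : TangentSpace 𝓘(ℝ, E3) x := coordVec (chartAt E3 x) x i

/-- The component `aᵢ` of a one-form in the chart `e`, as a function of the coordinates. -/
def oneComp (e : OpenPartialHomeomorph M E3) (a : OneForm M) (i : Fin 3) (y : E3) :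
    Matrix (Fin 2) (Fin 2) ℂ :=
  (a (e.symm y) (coordVec e (e.symm y) i) : su2)

/-- The component `Ψᵢⱼ` of a two-tensor in the chart `e`, as a function of the coordinates. -/
def twoComp (e : OpenPartialHomeomorph M E3) (Ψ : TwoTensor M) (i j : Fin 3) (y : E3) :
    Matrix (Fin 2) (Fin 2) ℂ :=
  (Ψ (e.symm y) (coordVec e (e.symm y) i) (coordVec e (e.symm y) j) : su2)

/-! ### Weak derivatives -/

/-- On the open set `Ω ⊆ ℝ³` the matrix-valued function `f` is locally integrable, and the locally
integrable function `h` is its weak partial derivative `∂ᵢ f`, entry by entry. -/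
def IsWeakPartial (Ω : Set E3) (i : Fin 3) (f h : E3 → Matrix (Fin 2) (Fin 2) ℂ) : Prop :=
  ∀ r s : Fin 2,
    LocallyIntegrableOn (fun y => f y r s) Ω ∧ LocallyIntegrableOn (fun y => h y r s) Ω ∧
    ∀ φ : E3 → ℝ, ContDiff ℝ ∞ φ → HasCompactSupport φ → tsupport φ ⊆ Ω →
      ∫ y, ((fderiv ℝ φ y (EuclideanSpace.single i (1 : ℝ)) : ℝ) : ℂ) * f y r s =
        - ∫ y, ((φ y : ℝ) : ℂ) * h y r s

/-- `η` is the weak exterior derivative `da`: in all charts `ηᵢⱼ = ∂ᵢ aⱼ - ∂ⱼ aᵢ` almost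
everywhere, with weak partial derivatives. -/
def IsWeakExtDeriv (a : OneForm M) (η : TwoTensor M) : Prop :=
  ∀ e ∈ atlas E3 M, ∃ h : Fin 3 → Fin 3 → E3 → Matrix (Fin 2) (Fin 2) ℂ,
    (∀ i j, IsWeakPartial e.target i (oneComp e a j) (h i j)) ∧
    ∀ᵐ y ∂(volume.restrict e.target), ∀ i j, twoComp e η i j y = h i j y - h j i y

open Classical in
/-- The weak exterior derivative `da` (unique up to a null set). The value `0` is assigned when
there is none. -/
def weakExtDeriv (a : OneForm M) : TwoTensor M :=
  if h : ∃ η : TwoTensor M, IsWeakExtDeriv a η then h.choose else 0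

/-- The two-form `a ∧ a`, that is `(u, v) ↦ a u * a v - a v * a u`. -/
def wedgeSelf (a : OneForm M) : TwoTensor M := fun x =>
  LinearMap.mk₂ ℝ (fun u v => ⁅a x u, a x v⁆) (by simp) (by simp) (by simp) (by simp)

/-- The curvature `F_A = dA + A ∧ A` of the connection `d + A`. -/
def curvature (A : OneForm M) : TwoTensor M := weakExtDeriv A + wedgeSelf A

/-! ### Riemannian geometry -/

variable [IsManifold 𝓘(ℝ, E3) ∞ M]

variable (M) in
/-- Smooth Riemannian metrics on `M`. -/
abbrev RMetric : Type _ :=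
  ContMDiffRiemannianMetric 𝓘(ℝ, E3) ∞ E3 (fun x : M => TangentSpace 𝓘(ℝ, E3) x)

/-- The Gram matrix of three tangent vectors at `x`. -/
def gramMat (g : RMetric M) (x : M) (b : Fin 3 → TangentSpace 𝓘(ℝ, E3) x) :
    Matrix (Fin 3) (Fin 3) ℝ :=
  Matrix.of fun i j => g.inner x (b i) (b j)

/-- The matrix `gᵢⱼ` of the metric in the chart `e`, as a function of the coordinates. -/
def gMat (g : RMetric M) (e : OpenPartialHomeomorph M E3) (y : E3) : Matrix (Fin 3) (Fin 3) ℝ :=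
  gramMat g (e.symm y) (coordVec e (e.symm y))

/-- `∂ₗ gᵢⱼ` in the chart `e`. -/
def dgMat (g : RMetric M) (e : OpenPartialHomeomorph M E3) (l i j : Fin 3) (y : E3) : ℝ :=
  fderiv ℝ (fun z => gMat g e z i j) y (EuclideanSpace.single l (1 : ℝ))

/-- The Christoffel symbols `Γᵏᵢⱼ` of the Levi-Civita connection in the chart `e`. -/
def christoffel (g : RMetric M) (e : OpenPartialHomeomorph M E3) (k i j : Fin 3) (y : E3) : ℝ :=
  (1 / 2) * ∑ l, (gMat g e y)⁻¹ k l *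
    (dgMat g e i j l y + dgMat g e j i l y - dgMat g e l i j y)

/-- `Ψ` is the weak covariant derivative `∇_B a` of the one-form `a`, with respect to the
Levi-Civita connection and the connection `d + B` acting on `𝔰𝔲(2)` by the adjoint representation:
in all charts `Ψᵢⱼ = ∂ᵢ aⱼ - ∑ₖ Γᵏᵢⱼ aₖ + [Bᵢ, aⱼ]` almost everywhere, with weak partial
derivatives. -/
def IsWeakCovDeriv (g : RMetric M) (B a : OneForm M) (Ψ : TwoTensor M) : Prop :=
  ∀ e ∈ atlas E3 M, ∃ h : Fin 3 → Fin 3 → E3 → Matrix (Fin 2) (Fin 2) ℂ,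
    (∀ i j, IsWeakPartial e.target i (oneComp e a j) (h i j)) ∧
    ∀ᵐ y ∂(volume.restrict e.target), ∀ i j,
      twoComp e Ψ i j y =
        h i j y - ∑ k, christoffel g e k i j y • oneComp e a k y + ⁅oneComp e B i y, oneComp e a j y⁆

/-- The pointwise norm `|a|` of a one-form: `|a|² = ∑ gⁱʲ ⟨aᵢ, aⱼ⟩`. -/
def norm₁ (g : RMetric M) (a : OneForm M) (x : M) : ℝ :=
  √(∑ i, ∑ j, (gramMat g x (frame x))⁻¹ i j * suInner (a x (frame x i)) (a x (frame x j)))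

/-- The squared norm `|Ψ|² = ∑ gⁱᵏ gʲˡ ⟨Ψᵢⱼ, Ψₖₗ⟩` of a two-tensor at `x`. -/
def normSq₂ (g : RMetric M) (Ψ : TwoTensor M) (x : M) : ℝ :=
  ∑ i, ∑ j, ∑ k, ∑ l, (gramMat g x (frame x))⁻¹ i k * (gramMat g x (frame x))⁻¹ j l *
    suInner (Ψ x (frame x i) (frame x j)) (Ψ x (frame x k) (frame x l))

/-- The pointwise norm of a two-tensor. -/
def norm₂ (g : RMetric M) (Ψ : TwoTensor M) (x : M) : ℝ := √(normSq₂ g Ψ x)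

/-- The pointwise norm of a two-form: in an orthonormal frame `|η|² = ∑_{i < j} |ηᵢⱼ|²`, which is
half of the sum over all `i, j`. -/
def normForm₂ (g : RMetric M) (η : TwoTensor M) (x : M) : ℝ := √(normSq₂ g η x / 2)

section Measure

variable [MeasurableSpace M]

/-- The measure `√(det g) dy` of the chart `e`, carried to `M`. -/
def chartVolume (g : RMetric M) (e : OpenPartialHomeomorph M E3) : Measure M :=
  Measure.map e.symm
    ((volume.restrict e.target).withDensity fun y => ENNReal.ofReal √(gMat g e y).det)

/-- The Riemannian measure: the least measure that dominates `√(det g) dy` in every chart. Because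
the measures `√(det g) dy` agree on overlaps of charts, its restriction to the source of a chart
is the measure of the chart. -/
def riemVolume (g : RMetric M) : Measure M := ⨆ e ∈ atlas E3 M, chartVolume g e

/-- The space `L^p_1` of `𝔰𝔲(2)`-valued one-forms: `a` has a weak covariant derivative `∇a` (with
respect to the Levi-Civita connection and `d`), and both `a` and `∇a` are in `L^p`. -/
def MemSobolev (g : RMetric M) (p : ℝ≥0∞) (a : OneForm M) : Prop :=
  ∃ Ψ : TwoTensor M, IsWeakCovDeriv g 0 a Ψ ∧
    MemLp (norm₁ g a) p (riemVolume g) ∧ MemLp (norm₂ g Ψ) p (riemVolume g)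

/-- The norm `‖a‖ = (∫ |a|^p + ∫ |∇_B a|^p)^(1/p)` of `L^p_1`, with respect to the metric and the
connection `d + B`. The infimum is over the weak covariant derivatives `∇_B a`; these are unique up
to null sets, so the infimum serves only to give the value `∞` when there is none. -/
def sobolevNorm (g : RMetric M) (B : OneForm M) (p : ℝ≥0∞) (a : OneForm M) : ℝ≥0∞ :=
  ⨅ (Ψ : TwoTensor M) (_ : IsWeakCovDeriv g B a Ψ),
    (eLpNorm (norm₁ g a) p (riemVolume g) ^ p.toReal +
      eLpNorm (norm₂ g Ψ) p (riemVolume g) ^ p.toReal) ^ (1 / p.toReal)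

/-- `c` is a constant of the embedding `L^p_1 ⊂ L^3`: `‖a‖_{L^3} ≤ c ‖a‖_{L^p_{1,B}}` for all
`𝔰𝔲(2)`-valued one-forms `a` in `L^p_1`. -/
def IsSobolevConst (g : RMetric M) (B : OneForm M) (p : ℝ≥0∞) (c : ℝ≥0) : Prop :=
  ∀ a : OneForm M, MemSobolev g p a →
    eLpNorm (norm₁ g a) 3 (riemVolume g) ≤ c * sobolevNorm g B p a

end Measure

/-! ### Orientation and the Chern-Simons functional -/

/-- Three tangent vectors are a basis with the orientation `o`. -/
def IsPositive {x : M} (o : Orientation ℝ (TangentSpace 𝓘(ℝ, E3) x) (Fin 3))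
    (b : Fin 3 → TangentSpace 𝓘(ℝ, E3) x) : Prop :=
  ∃ c : Module.Basis (Fin 3) ℝ (TangentSpace 𝓘(ℝ, E3) x), ⇑c = b ∧ c.orientation = o

variable (M) in
/-- An orientation of `M`: an orientation of every tangent space, such that the coordinate frame
of any chart is locally either everywhere positive or everywhere not. -/
structure MfdOrientation where
  /-- the orientation of the tangent space at `x` -/
  at' (x : M) : Orientation ℝ (TangentSpace 𝓘(ℝ, E3) x) (Fin 3)
  locConst : ∀ e ∈ atlas E3 M, ∀ x ∈ e.source,
    ∀ᶠ z in 𝓝 x, (IsPositive (at' z) (coordVec e z) ↔ IsPositive (at' x) (coordVec e x))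

open Classical in
/-- The density of a three-form with respect to the Riemannian measure: its value on a positively
oriented orthonormal basis of `T_x M`, expressed through an arbitrary basis. -/
def formDensity (g : RMetric M) (o : MfdOrientation M)
    (η : (x : M) → (Fin 3 → TangentSpace 𝓘(ℝ, E3) x) → ℝ) (x : M) : ℝ :=
  (if IsPositive (o.at' x) (frame x) then 1 else -1) * η x (frame x) / √(gramMat g x (frame x)).det

/-- The three-form `tr (η ∧ a)`, where
`(η ∧ a)(u, v, w) = η(u, v) a(w) + η(v, w) a(u) + η(w, u) a(v)`. The trace of a product of two
elements of `𝔰𝔲(2)` is real. -/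
def trWedge (η : TwoTensor M) (a : OneForm M) (x : M) (b : Fin 3 → TangentSpace 𝓘(ℝ, E3) x) : ℝ :=
  (trace ((η x (b 0) (b 1) : Matrix (Fin 2) (Fin 2) ℂ) * (a x (b 2) : Matrix (Fin 2) (Fin 2) ℂ)
    + (η x (b 1) (b 2) : Matrix (Fin 2) (Fin 2) ℂ) * (a x (b 0) : Matrix (Fin 2) (Fin 2) ℂ)
    + (η x (b 2) (b 0) : Matrix (Fin 2) (Fin 2) ℂ) * (a x (b 1) : Matrix (Fin 2) (Fin 2) ℂ))).re

/-- The Chern-Simons form `tr (dA ∧ A + (2/3) A ∧ A ∧ A)`, as a density. -/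
def csDensity (g : RMetric M) (o : MfdOrientation M) (A : OneForm M) : M → ℝ :=
  formDensity g o fun x b =>
    trWedge (weakExtDeriv A) A x b + (2 / 3) * trWedge (wedgeSelf A) A x b

/-- The Chern-Simons functional `τ(A) = -(1/8π²) ∫ tr (dA ∧ A + (2/3) A ∧ A ∧ A)`. -/
def chernSimons [MeasurableSpace M] (g : RMetric M) (o : MfdOrientation M) (A : OneForm M) : ℝ :=
  -(1 / (8 * Real.pi ^ 2)) * ∫ x, csDensity g o A x ∂(riemVolume g)

end Manifold

end CSBound

end

/-!
Write `a = A - B`. Expanding the Chern-Simons form with the cyclicity of the trace gives the pointwise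
identity
`CS(A) - CS(B) = tr ((F_A + F_B) ∧ a) - (1/3) tr (a ∧ a ∧ a) + (tr (dA ∧ B) - tr (dB ∧ A))`
(`csDensity_sub_csDensity`). The last bracket is `d tr (A ∧ B)` and integrates to zero.
The other terms are bounded pointwise by `|tr (Ψ ∧ a)| ≤ |Ψ| |a|` (`abs_formDensity_trWedge_le`) and
then by Hölder's inequality.

For `A`, `B` in `L^2_1` the first term is paired as `L² × L²` and the cubic term as `L³ × L³ × L³`.
For `A`, `B` in `L^{3/2}_1` one uses instead
`F_A + F_B = 2 Alt (∇_B B) - 2 B ∧ B + Alt (∇_B a) + a ∧ a`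
(`formDensity_curvature_add`), where the covariant derivatives are paired with `a` as `L^{3/2} × L³`.
The powers of `‖B‖` and `‖a‖` that result are those of the claim, except for a term `‖a‖²`, which is at
most `(‖a‖ + ‖a‖³) / 2`. The numerical constants of the non-sharp pointwise estimates are absorbed by the
factor `1 / (8 π²) ≤ 1 / 72`.

Two analytic facts carry the argument.

* Stokes' theorem `∫ tr (dA ∧ B) = ∫ tr (dB ∧ A)` for forms of class `L^{3/2}_1`
  (`integral_trWedge_comm`). With a partition of unity `χₖ` subordinate to charts it becomes a weak
  Leibniz rule for products on open subsets of `ℝ³` (`WeakPartial.integral_mul`, proved by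
  mollification; `L³` functions with derivatives in `L^{3/2}` are just integrable enough), tested with
  `χₖ` times the locally constant sign of the chart. The remaining terms `dχₖ ∧ tr (A ∧ B)` add up to
  zero because `∑ dχₖ = 0`.
* The Sobolev inequalities. The Gagliardo-Nirenberg-Sobolev inequality on `ℝ³` passes from smooth to
  weakly differentiable functions by mollification (`exists_sobolev_const`) and to the manifold by
  the partition of unity (`exists_manifold_sobolev`): `L^{3/2}_1 ⊂ L³` and `L^2_1 ⊂ L⁶`. The second
  embedding puts `A ∧ A` into `L²`, the first makes the Chern-Simons integrand integrable. For the
  norm defined by `∇_B` with `B` only in `L^{3/2}_1`, the term `[B, a]` is absorbed into the left-hand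
  side after `B` has been split into a part small in `L³` and a bounded part
  (`exists_sobolev_three_connection`).

The transfer between the manifold and its charts rests on the independence of the pointwise norms and
densities of the frame in which they are computed (`norm₁_eq_basis`, `normSq₂_eq_basis`,
`formDensity_eq_basis`), and on the fact that the Riemannian measure is `√(det g) dy` in every chart
(`riemVolume_restrict_source`).
-/

noncomputable section

namespace CSBound
open Filter

set_option linter.unusedSectionVars false
attribute [local instance] LieRing.ofAssociativeRing

section

open scoped Convolution Pointwise

/-! ### Mollification on `ℝ³` -/

/-- The mollification of `v` by the normalised bump function `ρ`. -/
def mollify (ρ : ContDiffBump (0 : E3)) (v : E3 → ℂ) : E3 → ℂ :=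
  (ρ.normed volume) ⋆[ContinuousLinearMap.lsmul ℝ ℝ, volume] v

lemma mollify_apply (ρ : ContDiffBump (0 : E3)) (v : E3 → ℂ) (x : E3) :
    mollify ρ v x = ∫ t, ρ.normed volume t • v (x - t) := rfl

lemma mollify_apply' (ρ : ContDiffBump (0 : E3)) (v : E3 → ℂ) (x : E3) :
    mollify ρ v x = ∫ t, ρ.normed volume (x - t) • v t := by
  rw [mollify, convolution_eq_swap]; rfl

lemma mollify_congr_ae (ρ : ContDiffBump (0 : E3)) {v w : E3 → ℂ} (h : v =ᵐ[volume] w) :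
    mollify ρ v = mollify ρ w := by
  ext x
  rw [mollify_apply', mollify_apply']
  refine integral_congr_ae ?_
  filter_upwards [h] with t ht
  rw [ht]

/-- Young's inequality for a mollification: by Jensen's inequality `|ρ * v|^p ≤ ρ * |v|^p`. -/
lemma eLpNorm_mollify_le (ρ : ContDiffBump (0 : E3)) {p : ℝ≥0∞} (hp : 1 ≤ p) (hp' : p ≠ ⊤)
    {v : E3 → ℂ} (hv : AEStronglyMeasurable v volume) :
    eLpNorm (mollify ρ v) p volume ≤ eLpNorm v p volume := by
  rw [mollify_congr_ae ρ hv.ae_eq_mk, eLpNorm_congr_ae hv.ae_eq_mk]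
  -- Jensen's inequality is applied to the probability measure `ρ dt`.
  set w := hv.mk v
  have hw : StronglyMeasurable w := hv.stronglyMeasurable_mk
  have hρm : Measurable fun t => ENNReal.ofReal (ρ.normed volume t) :=
    ρ.continuous_normed.measurable.ennreal_ofReal
  let m : Measure E3 := volume.withDensity fun t => ENNReal.ofReal (ρ.normed volume t)
  have hm : IsProbabilityMeasure m := by
    constructor
    rw [withDensity_apply _ MeasurableSet.univ, Measure.restrict_univ,
      ← ofReal_integral_eq_lintegral_ofReal ρ.integrable_normed
        (ae_of_all _ fun t => ρ.nonneg_normed t), ρ.integral_normed, ENNReal.ofReal_one]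
  have hp0 : p ≠ 0 := (zero_lt_one.trans_le hp).ne'
  have hpt : 0 < p.toReal := ENNReal.toReal_pos hp0 hp'
  have hpt1 : 1 ≤ p.toReal := by
    rw [← ENNReal.toReal_one]; exact ENNReal.toReal_mono hp' hp
  have hpt : ∀ x, ‖mollify ρ w x‖ₑ ^ p.toReal ≤ ∫⁻ t, ‖w (x - t)‖ₑ ^ p.toReal ∂m := by
    intro x
    have hwx : Measurable fun t => w (x - t) :=
      hw.measurable.comp (measurable_const.sub measurable_id)
    have h1 : ‖mollify ρ w x‖ₑ ≤ ∫⁻ t, ‖w (x - t)‖ₑ ∂m := by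
      rw [mollify_apply]
      refine (enorm_integral_le_lintegral_enorm _).trans ?_
      rw [lintegral_withDensity_eq_lintegral_mul _ hρm hwx.enorm]
      refine le_of_eq (lintegral_congr fun t => ?_)
      rw [enorm_smul, Real.enorm_of_nonneg (ρ.nonneg_normed t)]; rfl
    have h2 := eLpNorm_le_eLpNorm_of_exponent_le (μ := m) hp hwx.aestronglyMeasurable
    rw [eLpNorm_one_eq_lintegral_enorm, eLpNorm_eq_lintegral_rpow_enorm_toReal hp0 hp'] at h2
    calc ‖mollify ρ w x‖ₑ ^ p.toReal ≤ ((∫⁻ t, ‖w (x - t)‖ₑ ^ p.toReal ∂m) ^ (1 / p.toReal)) ^ p.toReal := by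
          gcongr; exact h1.trans h2
      _ = _ := by rw [← ENNReal.rpow_mul, one_div_mul_cancel hpt.ne', ENNReal.rpow_one]
  rw [eLpNorm_eq_lintegral_rpow_enorm_toReal hp0 hp', eLpNorm_eq_lintegral_rpow_enorm_toReal hp0 hp']
  refine ENNReal.rpow_le_rpow ?_ (by positivity)
  calc ∫⁻ x, ‖mollify ρ w x‖ₑ ^ p.toReal ≤ ∫⁻ x, ∫⁻ t, ‖w (x - t)‖ₑ ^ p.toReal ∂m := lintegral_mono hpt
    _ = ∫⁻ t, (∫⁻ x, ‖w (x - t)‖ₑ ^ p.toReal) ∂m := by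
        refine lintegral_lintegral_swap ?_
        exact ((hw.measurable.comp (measurable_fst.sub measurable_snd)).enorm.pow_const _).aemeasurable
    _ = ∫⁻ t, (∫⁻ x, ‖w x‖ₑ ^ p.toReal) ∂m := by
        refine lintegral_congr fun t => ?_
        exact lintegral_sub_right_eq_self (fun x => ‖w x‖ₑ ^ p.toReal) t
    _ = ∫⁻ x, ‖w x‖ₑ ^ p.toReal := by simp

/-- A sequence of bump functions that shrink to the origin. -/
def bumpSeq (n : ℕ) : ContDiffBump (0 : E3) where
  rIn := 1 / (2 * (n + 1))
  rOut := 1 / (n + 1)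
  rIn_pos := by positivity
  rIn_lt_rOut := by
    apply one_div_lt_one_div_of_lt <;> [positivity; nlinarith [(Nat.cast_nonneg n : (0:ℝ) ≤ n)]]

lemma bumpSeq_tendsto : Tendsto (fun n => (bumpSeq n).rOut) atTop (𝓝 0) :=
  tendsto_one_div_add_atTop_nhds_zero_nat

lemma bumpSeq_ratio (n : ℕ) : (bumpSeq n).rOut ≤ 2 * (bumpSeq n).rIn := by
  have : (0:ℝ) < n + 1 := by positivity
  show 1 / ((n:ℝ) + 1) ≤ 2 * (1 / (2 * (n + 1)))
  apply le_of_eq; field_simp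

lemma bumpSeq_rOut_le (n : ℕ) : (bumpSeq n).rOut ≤ 1 := by
  show 1 / ((n:ℝ) + 1) ≤ 1
  rw [div_le_one (by positivity)]; linarith [(Nat.cast_nonneg n : (0:ℝ) ≤ n)]

lemma ae_tendsto_mollify {v : E3 → ℂ} (hv : LocallyIntegrable v) :
    ∀ᵐ x, Tendsto (fun n => mollify (bumpSeq n) v x) atTop (𝓝 (v x)) :=
  ContDiffBump.ae_convolution_tendsto_right_of_locallyIntegrable bumpSeq_tendsto
    (Eventually.of_forall bumpSeq_ratio) hv

lemma contDiff_mollify (ρ : ContDiffBump (0 : E3)) {v : E3 → ℂ} (hv : LocallyIntegrable v) :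
    ContDiff ℝ ∞ (mollify ρ v) :=
  ρ.hasCompactSupport_normed.contDiff_convolution_left _ ρ.contDiff_normed hv

lemma hasCompactSupport_mollify (ρ : ContDiffBump (0 : E3)) {v : E3 → ℂ}
    (hv : HasCompactSupport v) : HasCompactSupport (mollify ρ v) :=
  ρ.hasCompactSupport_normed.convolution _ hv

lemma support_mollify_subset (n : ℕ) {v : E3 → ℂ} :
    Function.support (mollify (bumpSeq n) v) ⊆ Metric.closedBall (0 : E3) 1 + tsupport v := by
  refine (support_convolution_subset _).trans ?_
  refine Set.add_subset_add ?_ (subset_tsupport v)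
  rw [ContDiffBump.support_normed_eq]
  exact (Metric.ball_subset_closedBall).trans (Metric.closedBall_subset_closedBall (bumpSeq_rOut_le n))

lemma mollify_sub (ρ : ContDiffBump (0 : E3)) {v w : E3 → ℂ} (hv : LocallyIntegrable v)
    (hw : LocallyIntegrable w) : mollify ρ (v - w) = mollify ρ v - mollify ρ w := by
  have key : ∀ {f : E3 → ℂ}, LocallyIntegrable f → ConvolutionExists (ρ.normed volume) f (ContinuousLinearMap.lsmul ℝ ℝ) volume :=
    fun hf => ρ.hasCompactSupport_normed.convolutionExists_left _ ρ.continuous_normed hf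
  ext x
  have h1 := key hv x
  have h2 := key hw x
  simp only [Pi.sub_apply, mollify_apply, smul_sub]
  exact integral_sub h1 h2

/-- Mollifications of a continuous function of compact support converge in `L^p`. -/
lemma tendsto_mollify_continuous {p : ℝ≥0∞} {k : E3 → ℂ}
    (hk : Continuous k) (hks : HasCompactSupport k) :
    Tendsto (fun n => eLpNorm (mollify (bumpSeq n) k - k) p volume) atTop (𝓝 0) := by
  set K : Set E3 := Metric.closedBall (0 : E3) 1 + tsupport k
  have hK : IsCompact K := (isCompact_closedBall 0 1).add hks
  have hKm : volume K ≠ ⊤ := hK.measure_lt_top.ne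
  have hsupp : ∀ n x, x ∉ K → (mollify (bumpSeq n) k - k) x = 0 := by
    intro n x hx
    have h1 : mollify (bumpSeq n) k x = 0 := by
      by_contra h; exact hx (support_mollify_subset n h)
    have h2 : k x = 0 := by
      by_contra h
      exact hx ⟨0, by simp, x, subset_tsupport k h, by simp⟩
    simp [h1, h2]
  have huc := hks.uniformContinuous_of_continuous hk
  rw [ENNReal.tendsto_nhds_zero]
  intro ε hε
  obtain ⟨δ, hδ, hδ'⟩ : ∃ δ : ℝ≥0, 0 < δ ∧ (δ : ℝ≥0∞) * (volume K) ^ (1 / p.toReal) ≤ ε := by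
    set T := (volume K) ^ (1 / p.toReal)
    have hT : T ≠ ⊤ := ENNReal.rpow_ne_top_of_nonneg (by positivity) hKm
    obtain ⟨δ, hδ, h⟩ := ENNReal.exists_nnreal_pos_mul_lt hT hε.ne'
    exact ⟨δ, hδ, h.le⟩
  obtain ⟨r, hr, hr'⟩ := Metric.uniformContinuous_iff.1 huc δ (by exact_mod_cast hδ)
  filter_upwards [bumpSeq_tendsto.eventually (gt_mem_nhds hr)] with n hn
  have hb : ∀ x, ‖(mollify (bumpSeq n) k - k) x‖ ≤ δ := by
    intro x
    rw [Pi.sub_apply, ← dist_eq_norm]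
    refine ContDiffBump.dist_normed_convolution_le hk.aestronglyMeasurable fun y hy => ?_
    exact (hr' ((Metric.mem_ball.1 hy).trans hn)).le
  have : mollify (bumpSeq n) k - k = K.indicator (mollify (bumpSeq n) k - k) := by
    symm; apply indicator_eq_self.2; intro x hx; by_contra h; exact hx (hsupp n x h)
  rw [this, eLpNorm_indicator_eq_eLpNorm_restrict hK.measurableSet]
  refine (eLpNorm_le_of_ae_bound (C := δ) (ae_of_all _ hb)).trans ?_
  rw [Measure.restrict_apply_univ, ENNReal.ofReal_coe_nnreal, mul_comm]
  simpa using hδ'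

/-- Mollifications converge in `L^p`. -/
lemma tendsto_mollify {p : ℝ≥0∞} (hp : 1 ≤ p) (hp' : p ≠ ⊤) {v : E3 → ℂ} (hv : MemLp v p) :
    Tendsto (fun n => eLpNorm (mollify (bumpSeq n) v - v) p volume) atTop (𝓝 0) := by
  rw [ENNReal.tendsto_nhds_zero]
  intro ε hε
  have h3 : ε / 3 ≠ 0 := (ENNReal.div_pos hε.ne' (by norm_num)).ne'
  obtain ⟨k, hks, hvk, hk, hkp⟩ := hv.exists_hasCompactSupport_eLpNorm_sub_le hp' h3
  filter_upwards [(ENNReal.tendsto_nhds_zero.1 (tendsto_mollify_continuous (p := p) hk hks)) (ε/3) (pos_iff_ne_zero.2 h3)]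
    with n hn
  have hvl := hv.locallyIntegrable hp
  have hkl := hkp.locallyIntegrable hp
  have e : mollify (bumpSeq n) v - v
      = mollify (bumpSeq n) (v - k) + ((mollify (bumpSeq n) k - k) - (v - k)) := by
    rw [mollify_sub _ hvl hkl]; abel
  have m1 : AEStronglyMeasurable (mollify (bumpSeq n) (v - k)) volume :=
    (contDiff_mollify _ (hvl.sub hkl)).continuous.aestronglyMeasurable
  have m2 : AEStronglyMeasurable (mollify (bumpSeq n) k - k) volume :=
    ((contDiff_mollify _ hkl).continuous.sub hk).aestronglyMeasurable
  have m3 := (hv.1.sub hkp.1)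
  rw [e]
  calc _ ≤ eLpNorm (mollify (bumpSeq n) (v - k)) p volume + (eLpNorm (mollify (bumpSeq n) k - k) p volume + eLpNorm (v - k) p volume) :=
        (eLpNorm_add_le m1 (m2.sub m3) hp).trans (by gcongr; exact eLpNorm_sub_le m2 m3 hp)
    _ ≤ ε / 3 + (ε / 3 + ε / 3) := by
        gcongr
        exact (eLpNorm_mollify_le _ hp hp' m3).trans hvk
    _ = ε := by rw [← add_assoc, ENNReal.add_thirds]

end

section

open scoped Convolution Pointwise

/-! ### Weak partial derivatives -/

/-- The scalar form of `IsWeakPartial`: on `Ω` the function `h` is the weak partial derivative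
`∂ᵢ f`. -/
def WeakPartial (Ω : Set E3) (i : Fin 3) (f h : E3 → ℂ) : Prop :=
  LocallyIntegrableOn f Ω ∧ LocallyIntegrableOn h Ω ∧
    ∀ φ : E3 → ℝ, ContDiff ℝ ∞ φ → HasCompactSupport φ → tsupport φ ⊆ Ω →
      ∫ y, ((fderiv ℝ φ y (EuclideanSpace.single i (1 : ℝ)) : ℝ) : ℂ) * f y =
        - ∫ y, ((φ y : ℝ) : ℂ) * h y

lemma tsupport_subset_of_zero {X α β : Type*} [TopologicalSpace X] [Zero α] [Zero β] {f : X → α}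
    {g : X → β} (h : ∀ x, g x = 0 → f x = 0) : tsupport f ⊆ tsupport g :=
  closure_mono fun x hx hg => hx (h x hg)

/-- The product of a locally integrable function and a continuous one of compact support. -/
lemma integrable_mul_of_tsupport_subset {Ω : Set E3} {f φ : E3 → ℂ} (hf : LocallyIntegrableOn f Ω)
    (hφ : Continuous φ) (hc : HasCompactSupport φ) (hs : tsupport φ ⊆ Ω) :
    Integrable (fun y => φ y * f y) := by
  have h1 : IntegrableOn f (tsupport φ) := hf.integrableOn_compact_subset hs hc
  have h2 : IntegrableOn (fun y => φ y * f y) (tsupport φ) := h1.continuousOn_mul hφ.continuousOn hc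
  refine (integrableOn_iff_integrable_of_support_subset ?_).1 h2
  intro x hx
  exact subset_tsupport φ (left_ne_zero_of_mul hx)

lemma continuous_partial {φ : E3 → ℝ} (hφ : ContDiff ℝ ∞ φ) (i : Fin 3) :
    Continuous fun y => (fderiv ℝ φ y (EuclideanSpace.single i (1 : ℝ)) : ℝ) :=
  (hφ.continuous_fderiv (by simp)).clm_apply continuous_const

lemma tsupport_partial_subset (φ : E3 → ℝ) (i : Fin 3) :
    tsupport (fun y => (fderiv ℝ φ y (EuclideanSpace.single i (1 : ℝ)) : ℝ)) ⊆ tsupport φ :=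
  tsupport_fderiv_apply_subset ℝ _

lemma tsupport_ofReal_subset (φ : E3 → ℝ) : tsupport (fun y => ((φ y : ℝ) : ℂ)) ⊆ tsupport φ :=
  tsupport_subset_of_zero fun x h => by simp [h]

/-- The product of a locally integrable function and a real continuous one of compact support. -/
lemma integrable_ofReal_mul {Ω : Set E3} {f : E3 → ℂ} {φ : E3 → ℝ} (hf : LocallyIntegrableOn f Ω)
    (hφ : Continuous φ) (hc : HasCompactSupport φ) (hs : tsupport φ ⊆ Ω) :
    Integrable (fun y => (φ y : ℂ) * f y) :=
  integrable_mul_of_tsupport_subset hf (Complex.continuous_ofReal.comp hφ)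
    (hc.mono' ((subset_tsupport _).trans (tsupport_ofReal_subset φ)))
    ((tsupport_ofReal_subset φ).trans hs)

lemma integrable_partial_mul {Ω : Set E3} {f : E3 → ℂ} {φ : E3 → ℝ} (hf : LocallyIntegrableOn f Ω)
    (hφ : ContDiff ℝ ∞ φ) (hc : HasCompactSupport φ) (hs : tsupport φ ⊆ Ω) (i : Fin 3) :
    Integrable (fun y => ((fderiv ℝ φ y (EuclideanSpace.single i (1 : ℝ)) : ℝ) : ℂ) * f y) :=
  integrable_ofReal_mul hf (continuous_partial hφ i)
    (hc.mono' ((subset_tsupport _).trans (tsupport_partial_subset φ i)))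
    ((tsupport_partial_subset φ i).trans hs)

namespace WeakPartial

variable {Ω : Set E3} {i : Fin 3} {f h f' h' : E3 → ℂ}

lemma sub (H : WeakPartial Ω i f h) (H' : WeakPartial Ω i f' h') :
    WeakPartial Ω i (fun y => f y - f' y) (fun y => h y - h' y) := by
  refine ⟨H.1.sub H'.1, H.2.1.sub H'.2.1, fun φ hφ hc hs => ?_⟩
  simp only [mul_sub]
  rw [integral_sub (integrable_partial_mul H.1 hφ hc hs i) (integrable_partial_mul H'.1 hφ hc hs i),
    integral_sub (integrable_ofReal_mul H.2.1 hφ.continuous hc hs)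
      (integrable_ofReal_mul H'.2.1 hφ.continuous hc hs), H.2.2 φ hφ hc hs, H'.2.2 φ hφ hc hs]
  ring

/-- Weak derivatives are unique up to null sets. -/
lemma ae_unique (hΩ : IsOpen Ω) (H : WeakPartial Ω i f h) (H' : WeakPartial Ω i f h') :
    ∀ᵐ y ∂(volume.restrict Ω), h y = h' y := by
  rw [ae_restrict_iff' hΩ.measurableSet]
  have := hΩ.ae_eq_zero_of_integral_contDiff_smul_eq_zero (μ := volume) (H.2.1.sub H'.2.1) ?_
  · filter_upwards [this] with y hy hyΩ
    exact sub_eq_zero.1 (hy hyΩ)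
  · intro φ hφ hc hs
    have h1 := H.2.2 φ hφ hc hs
    rw [H'.2.2 φ hφ hc hs, neg_inj] at h1
    simp only [Pi.sub_apply, Complex.real_smul, mul_sub]
    rw [integral_sub (integrable_ofReal_mul H.2.1 hφ.continuous hc hs)
      (integrable_ofReal_mul H'.2.1 hφ.continuous hc hs), h1, sub_self]

/-- The weak Leibniz rule for the product with a smooth cutoff function, which also extends the
function to all of `ℝ³`. -/
lemma cutoff (H : WeakPartial Ω i f h) {φ : E3 → ℝ} (hφ : ContDiff ℝ ∞ φ)
    (hc : HasCompactSupport φ) (hs : tsupport φ ⊆ Ω) :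
    WeakPartial univ i (fun y => (φ y : ℂ) * f y)
      (fun y => ((fderiv ℝ φ y (EuclideanSpace.single i (1 : ℝ)) : ℝ) : ℂ) * f y
        + (φ y : ℂ) * h y) := by
  have I1 := integrable_ofReal_mul H.1 hφ.continuous hc hs
  have I2 := integrable_partial_mul H.1 hφ hc hs i
  have I3 := integrable_ofReal_mul H.2.1 hφ.continuous hc hs
  refine ⟨I1.locallyIntegrable.locallyIntegrableOn _,
    (I2.add I3).locallyIntegrable.locallyIntegrableOn _, fun ψ hψ _ _ => ?_⟩
  have hψφs : tsupport (fun y => ψ y * φ y) ⊆ tsupport φ :=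
    tsupport_subset_of_zero fun x h => by simp [h]
  have key := H.2.2 (fun y => ψ y * φ y) (hψ.mul hφ) (hc.mul_left) (hψφs.trans hs)
  have hd : ∀ y, fderiv ℝ (fun y => ψ y * φ y) y (EuclideanSpace.single i (1 : ℝ)) =
      ψ y * fderiv ℝ φ y (EuclideanSpace.single i (1 : ℝ)) +
        fderiv ℝ ψ y (EuclideanSpace.single i (1 : ℝ)) * φ y := by
    intro y
    have := fderiv_fun_mul (𝕜 := ℝ) (hψ.differentiable (by simp) y) (hφ.differentiable (by simp) y)
    rw [this]; simp; ring
  simp only [hd] at key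
  have J1 : Integrable (fun y => (ψ y : ℂ) * (((fderiv ℝ φ y (EuclideanSpace.single i (1 : ℝ)) : ℝ) : ℂ) * f y)) := by
    have := integrable_ofReal_mul (φ := fun y => ψ y * fderiv ℝ φ y (EuclideanSpace.single i (1 : ℝ))) H.1
      (hψ.continuous.mul (continuous_partial hφ i)) 
      (HasCompactSupport.mul_left (hc.mono' ((subset_tsupport _).trans (tsupport_partial_subset φ i))))
      ((tsupport_subset_of_zero fun x h => by simp [h]).trans ((tsupport_partial_subset φ i).trans hs))
    refine this.congr (ae_of_all _ fun y => ?_)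
    push_cast; ring
  have J2 : Integrable (fun y => ((fderiv ℝ ψ y (EuclideanSpace.single i (1 : ℝ)) : ℝ) : ℂ) * ((φ y : ℂ) * f y)) := by
    have := integrable_ofReal_mul (φ := fun y => fderiv ℝ ψ y (EuclideanSpace.single i (1 : ℝ)) * φ y) H.1
      ((continuous_partial hψ i).mul hφ.continuous) hc.mul_left
      ((tsupport_subset_of_zero fun x h => by simp [h]).trans hs)
    refine this.congr (ae_of_all _ fun y => ?_)
    push_cast; ring
  have J3 : Integrable (fun y => (ψ y : ℂ) * ((φ y : ℂ) * h y)) := by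
    have := integrable_ofReal_mul (φ := fun y => ψ y * φ y) H.2.1
      (hψ.continuous.mul hφ.continuous) hc.mul_left
      ((tsupport_subset_of_zero fun x h => by simp [h]).trans hs)
    refine this.congr (ae_of_all _ fun y => ?_)
    push_cast; ring
  have e1 : ∫ y, ((ψ y * fderiv ℝ φ y (EuclideanSpace.single i (1 : ℝ)) +
        fderiv ℝ ψ y (EuclideanSpace.single i (1 : ℝ)) * φ y : ℝ) : ℂ) * f y =
      (∫ y, (ψ y : ℂ) * (((fderiv ℝ φ y (EuclideanSpace.single i (1 : ℝ)) : ℝ) : ℂ) * f y)) +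
      ∫ y, ((fderiv ℝ ψ y (EuclideanSpace.single i (1 : ℝ)) : ℝ) : ℂ) * ((φ y : ℂ) * f y) := by
    rw [← integral_add J1 J2]
    refine integral_congr_ae (ae_of_all _ fun y => ?_)
    push_cast; ring
  have e2 : ∫ y, ((ψ y * φ y : ℝ) : ℂ) * h y = ∫ y, (ψ y : ℂ) * ((φ y : ℂ) * h y) := by
    refine integral_congr_ae (ae_of_all _ fun y => ?_)
    push_cast; ring
  have e3 : ∫ y, (ψ y : ℂ) * (((fderiv ℝ φ y (EuclideanSpace.single i (1 : ℝ)) : ℝ) : ℂ) * f y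
        + (φ y : ℂ) * h y) = (∫ y, (ψ y : ℂ) * (((fderiv ℝ φ y (EuclideanSpace.single i (1 : ℝ)) : ℝ) : ℂ) * f y)) + ∫ y, (ψ y : ℂ) * ((φ y : ℂ) * h y) := by
    rw [← integral_add J1 J3]
    refine integral_congr_ae (ae_of_all _ fun y => ?_)
    ring
  rw [e1, e2] at key
  rw [e3]
  linear_combination key

/-- A weak derivative can be tested with complex functions. -/
lemma integral_complex (H : WeakPartial Ω i f h) {φ : E3 → ℂ} (hφ : ContDiff ℝ ∞ φ)
    (hc : HasCompactSupport φ) (hs : tsupport φ ⊆ Ω) :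
    ∫ y, fderiv ℝ φ y (EuclideanSpace.single i (1 : ℝ)) * f y = - ∫ y, φ y * h y := by
  have hre : ContDiff ℝ ∞ fun y => (φ y).re := Complex.reCLM.contDiff.comp hφ
  have him : ContDiff ℝ ∞ fun y => (φ y).im := Complex.imCLM.contDiff.comp hφ
  have sre : tsupport (fun y => (φ y).re) ⊆ tsupport φ := tsupport_subset_of_zero fun x h => by simp [h]
  have sim : tsupport (fun y => (φ y).im) ⊆ tsupport φ := tsupport_subset_of_zero fun x h => by simp [h]
  have cre : HasCompactSupport fun y => (φ y).re := hc.mono' ((subset_tsupport _).trans sre)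
  have cim : HasCompactSupport fun y => (φ y).im := hc.mono' ((subset_tsupport _).trans sim)
  have k1 := H.2.2 _ hre cre (sre.trans hs)
  have k2 := H.2.2 _ him cim (sim.trans hs)
  have dre : ∀ y, fderiv ℝ (fun y => (φ y).re) y (EuclideanSpace.single i (1 : ℝ)) =
      (fderiv ℝ φ y (EuclideanSpace.single i (1 : ℝ))).re := fun y => by
    have := (Complex.reCLM.hasFDerivAt.comp y (hφ.differentiable (by simp) y).hasFDerivAt).fderiv
    exact congrArg (fun L => L (EuclideanSpace.single i (1 : ℝ))) this
  have dim : ∀ y, fderiv ℝ (fun y => (φ y).im) y (EuclideanSpace.single i (1 : ℝ)) =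
      (fderiv ℝ φ y (EuclideanSpace.single i (1 : ℝ))).im := fun y => by
    have := (Complex.imCLM.hasFDerivAt.comp y (hφ.differentiable (by simp) y).hasFDerivAt).fderiv
    exact congrArg (fun L => L (EuclideanSpace.single i (1 : ℝ))) this
  have e1 : ∫ y, fderiv ℝ φ y (EuclideanSpace.single i (1 : ℝ)) * f y =
      (∫ y, ((fderiv ℝ (fun y => (φ y).re) y (EuclideanSpace.single i (1 : ℝ)) : ℝ) : ℂ) * f y) +
      Complex.I * ∫ y, ((fderiv ℝ (fun y => (φ y).im) y (EuclideanSpace.single i (1 : ℝ)) : ℝ) : ℂ) * f y := by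
    rw [← integral_const_mul, ← integral_add (integrable_partial_mul H.1 hre cre (sre.trans hs) i)
      ((integrable_partial_mul H.1 him cim (sim.trans hs) i).const_mul _)]
    refine integral_congr_ae (ae_of_all _ fun y => ?_)
    simp only [dre, dim]
    conv_lhs => rw [← Complex.re_add_im (fderiv ℝ φ y (EuclideanSpace.single i (1 : ℝ)))]
    ring
  have e2 : ∫ y, φ y * h y = (∫ y, (((φ y).re : ℝ) : ℂ) * h y) +
      Complex.I * ∫ y, (((φ y).im : ℝ) : ℂ) * h y := by
    rw [← integral_const_mul, ← integral_add (integrable_ofReal_mul H.2.1 hre.continuous cre (sre.trans hs))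
      ((integrable_ofReal_mul H.2.1 him.continuous cim (sim.trans hs)).const_mul _)]
    refine integral_congr_ae (ae_of_all _ fun y => ?_)
    simp only
    conv_lhs => rw [← Complex.re_add_im (φ y)]
    ring
  rw [e1, e2, k1, k2]
  ring

/-- Differentiation commutes with mollification. -/
lemma fderiv_mollify (H : WeakPartial univ i f h) (ρ : ContDiffBump (0 : E3)) (x : E3) :
    fderiv ℝ (mollify ρ f) x (EuclideanSpace.single i (1 : ℝ)) = mollify ρ h x := by
  have hf : LocallyIntegrable f := locallyIntegrableOn_univ.1 H.1
  have hρ : ContDiff ℝ ∞ (ρ.normed volume) := ρ.contDiff_normed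
  have hρ1 : ContDiff ℝ 1 (ρ.normed volume) := ρ.contDiff_normed
  have hd := (ρ.hasCompactSupport_normed.hasFDerivAt_convolution_left
    (ContinuousLinearMap.lsmul ℝ ℝ : ℝ →L[ℝ] ℂ →L[ℝ] ℂ) hρ1 hf x).fderiv
  have h1 : fderiv ℝ (mollify ρ f) x (EuclideanSpace.single i (1 : ℝ)) =
      ∫ t, (fderiv ℝ (ρ.normed volume) (x - t) (EuclideanSpace.single i (1 : ℝ))) • f t := by
    rw [mollify, hd, convolution_eq_swap]
    have hint : Integrable (fun t => (((ContinuousLinearMap.lsmul ℝ ℝ : ℝ →L[ℝ] ℂ →L[ℝ] ℂ).precompL E3)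
        (fderiv ℝ (ρ.normed volume) (x - t))) (f t)) := by
      have := (ρ.hasCompactSupport_normed.fderiv (𝕜 := ℝ)).convolutionExists_left
        ((ContinuousLinearMap.lsmul ℝ ℝ : ℝ →L[ℝ] ℂ →L[ℝ] ℂ).precompL E3)
        (hρ.continuous_fderiv (by simp)) hf x
      exact this.integrable_swap
    rw [ContinuousLinearMap.integral_apply hint]
    rfl
  let ψ : E3 → ℝ := fun t => ρ.normed volume (x - t)
  have hψ : ContDiff ℝ ∞ ψ := hρ.comp (contDiff_const.sub contDiff_id)
  have hψc : HasCompactSupport ψ := by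
    have : ψ = (ρ.normed volume) ∘ (Homeomorph.subLeft x) := rfl
    rw [this]; exact ρ.hasCompactSupport_normed.comp_homeomorph _
  have hdψ : ∀ t, fderiv ℝ ψ t (EuclideanSpace.single i (1 : ℝ)) =
      - fderiv ℝ (ρ.normed volume) (x - t) (EuclideanSpace.single i (1 : ℝ)) := fun t => by
    have h2 : HasFDerivAt (fun t : E3 => x - t) (-ContinuousLinearMap.id ℝ E3) t := by
      simpa using (hasFDerivAt_id t).const_sub x
    have := ((hρ.differentiable (by simp) (x - t)).hasFDerivAt.comp t h2).fderiv
    rw [show ψ = (ρ.normed volume) ∘ (fun t => x - t) from rfl, this]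
    simp
  have key := H.2.2 ψ hψ hψc (subset_univ _)
  simp only [hdψ, Complex.ofReal_neg, neg_mul, integral_neg, neg_inj] at key
  rw [h1, mollify_apply']
  simpa only [Complex.real_smul] using key

end WeakPartial

end

section

open scoped Convolution Pointwise

/-! ### Sobolev inequality and weak Leibniz rule on `ℝ³` -/

lemma norm_le_sum_partials (L : E3 →L[ℝ] ℂ) :
    ‖L‖ ≤ ∑ i, ‖L (EuclideanSpace.single i (1 : ℝ))‖ := by
  refine L.opNorm_le_bound (by positivity) fun y => ?_
  have hy : y = ∑ i, y i • EuclideanSpace.single i (1 : ℝ) := by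
    ext j; simp [Finset.sum_apply, Pi.single_apply]
  conv_lhs => rw [hy]
  rw [map_sum, Finset.sum_mul]
  refine (norm_sum_le _ _).trans (Finset.sum_le_sum fun i _ => ?_)
  rw [map_smul, norm_smul, mul_comm]
  gcongr
  exact PiLp.norm_apply_le y i

/-- The Sobolev inequality `‖v‖_q ≤ C ∑ᵢ ‖∂ᵢ v‖_p`, with `1/q = 1/p - 1/3`, for a function of compact
support with weak derivatives. It is passed from the mollifications of `v` to `v` by Fatou's
lemma. -/
lemma exists_sobolev_const {p q : ℝ≥0} (hp : 1 ≤ p) (hq : (q : ℝ)⁻¹ = (p : ℝ)⁻¹ - 3⁻¹) :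
    ∃ C : ℝ≥0, ∀ (v : E3 → ℂ) (w : Fin 3 → E3 → ℂ), HasCompactSupport v →
      (∀ i, WeakPartial univ i v (w i)) →
      eLpNorm v q volume ≤ C * ∑ i, eLpNorm (w i) p volume := by
  refine ⟨SNormLESNormFDerivOfEqConst ℂ (volume : Measure E3) p, fun v w hv H => ?_⟩
  have hvl : LocallyIntegrable v := locallyIntegrableOn_univ.1 (H 0).1
  have hwl : ∀ i, LocallyIntegrable (w i) := fun i => locallyIntegrableOn_univ.1 (H i).2.1
  have hn : Module.finrank ℝ E3 = 3 := by simp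
  have hp1 : (1 : ℝ≥0∞) ≤ p := by exact_mod_cast hp
  have step : ∀ n, eLpNorm (mollify (bumpSeq n) v) q volume ≤
      SNormLESNormFDerivOfEqConst ℂ (volume : Measure E3) p * ∑ i, eLpNorm (w i) p volume := by
    intro n
    refine (eLpNorm_le_eLpNorm_fderiv_of_eq volume ((contDiff_mollify _ hvl).of_le (by simp))
      (hasCompactSupport_mollify _ hv) hp (by simp) (by rw [hn, hq]; simp)).trans ?_
    gcongr
    have hms : ∀ i, AEStronglyMeasurable (mollify (bumpSeq n) (w i)) volume := fun i =>
      (contDiff_mollify _ (hwl i)).continuous.aestronglyMeasurable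
    calc eLpNorm (fderiv ℝ (mollify (bumpSeq n) v)) p volume
        ≤ eLpNorm (∑ i, fun x => ‖mollify (bumpSeq n) (w i) x‖) p volume := by
          refine eLpNorm_mono_real fun x => (norm_le_sum_partials _).trans (le_of_eq ?_)
          rw [Finset.sum_apply]
          exact Finset.sum_congr rfl fun i _ => by rw [(H i).fderiv_mollify]
      _ ≤ ∑ i, eLpNorm (fun x => ‖mollify (bumpSeq n) (w i) x‖) p volume :=
          eLpNorm_sum_le (fun i _ => (hms i).norm) hp1
      _ ≤ ∑ i, eLpNorm (w i) p volume := by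
          refine Finset.sum_le_sum fun i _ => ?_
          rw [eLpNorm_norm]
          exact eLpNorm_mollify_le _ hp1 ENNReal.coe_ne_top (hwl i).aestronglyMeasurable
  refine (Lp.eLpNorm_lim_le_liminf_eLpNorm
    (fun n => (contDiff_mollify (bumpSeq n) hvl).continuous.aestronglyMeasurable) v
    (ae_tendsto_mollify hvl)).trans ?_
  exact liminf_le_of_le (by isBoundedDefault) fun b hb => by
    obtain ⟨n, hn⟩ := hb.exists
    exact hn.trans (step n)

instance holderTriple_three : ENNReal.HolderTriple (3 / 2) 3 1 where
  inv_add_inv_eq_inv := by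
    rw [ENNReal.inv_div (by simp) (by simp), inv_one, ← one_div, ENNReal.div_add_div_same]
    norm_num
    exact ENNReal.div_self (by simp) (by simp)

instance holderTriple_three' : ENNReal.HolderTriple 3 (3 / 2) 1 := ENNReal.HolderTriple.symm

/-- Integration by parts for two weakly differentiable functions on `ℝ³`, of class `L³` with
derivatives in `L^{3/2}`, one of which has compact support. -/
lemma WeakPartial.integral_by_parts {i : Fin 3} {f h v w : E3 → ℂ} (H : WeakPartial univ i f h)
    (H' : WeakPartial univ i v w) (hf : MemLp f 3) (hh : MemLp h (3 / 2)) (hv : MemLp v 3)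
    (hw : MemLp w (3 / 2)) (hc : HasCompactSupport v) :
    ∫ y, (w y * f y + v y * h y) = 0 := by
  have h32 : (1 : ℝ≥0∞) ≤ 3 / 2 := by
    rw [ENNReal.le_div_iff_mul_le (by simp) (by simp)]; norm_num
  have h32' : (3 / 2 : ℝ≥0∞) ≠ ⊤ := by simp [ENNReal.div_eq_top]
  have hvl : LocallyIntegrable v := locallyIntegrableOn_univ.1 H'.1
  have hwl : LocallyIntegrable w := locallyIntegrableOn_univ.1 H'.2.1
  have mv : ∀ n, MemLp (mollify (bumpSeq n) v) 3 := fun n =>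
    ⟨(contDiff_mollify _ hvl).continuous.aestronglyMeasurable,
      (eLpNorm_mollify_le _ (by norm_num) (by simp) hv.1).trans_lt hv.2⟩
  have mw : ∀ n, MemLp (mollify (bumpSeq n) w) (3 / 2) := fun n =>
    ⟨(contDiff_mollify _ hwl).continuous.aestronglyMeasurable,
      (eLpNorm_mollify_le _ h32 h32' hw.1).trans_lt hw.2⟩
  -- The mollifications of `v` are test functions for the weak derivative of `f`.
  have zero : ∀ n, ∫ y, (mollify (bumpSeq n) w y * f y + mollify (bumpSeq n) v y * h y) = 0 := by
    intro n
    have := H.integral_complex (contDiff_mollify (bumpSeq n) hvl) (hasCompactSupport_mollify _ hc)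
      (subset_univ _)
    simp only [H'.fderiv_mollify] at this
    have e := integral_add ((mw n).integrable_mul hf) ((mv n).integrable_mul hh)
    simp only [Pi.mul_apply] at e
    rw [e, this]
    simp
  have hint : Integrable (fun y => w y * f y + v y * h y) :=
    (hw.integrable_mul hf).add (hv.integrable_mul hh)
  have hintn : ∀ n, Integrable (fun y => mollify (bumpSeq n) w y * f y + mollify (bumpSeq n) v y * h y) :=
    fun n => ((mw n).integrable_mul hf).add ((mv n).integrable_mul hh)
  have bound : ∀ n, ‖∫ y, (w y * f y + v y * h y)‖ₑ ≤
      eLpNorm (mollify (bumpSeq n) w - w) (3 / 2) volume * eLpNorm f 3 volume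
      + eLpNorm (mollify (bumpSeq n) v - v) 3 volume * eLpNorm h (3 / 2) volume := by
    intro n
    have e : ∫ y, (w y * f y + v y * h y) =
        - ∫ y, ((mollify (bumpSeq n) w - w) • f + (mollify (bumpSeq n) v - v) • h) y := by
      rw [← sub_zero (∫ y, (w y * f y + v y * h y)), ← zero n, ← integral_sub hint (hintn n),
        ← integral_neg]
      refine integral_congr_ae (ae_of_all _ fun y => ?_)
      simp; ring
    rw [e, enorm_neg]
    refine (enorm_integral_le_lintegral_enorm _).trans ?_
    rw [← eLpNorm_one_eq_lintegral_enorm]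
    refine (eLpNorm_add_le ?_ ?_ le_rfl).trans (add_le_add ?_ ?_)
    · exact (((mw n).sub hw).1.smul hf.1)
    · exact (((mv n).sub hv).1.smul hh.1)
    · exact eLpNorm_smul_le_mul_eLpNorm hf.1 ((mw n).sub hw).1
    · exact eLpNorm_smul_le_mul_eLpNorm hh.1 ((mv n).sub hv).1
  have lim : Tendsto (fun n => eLpNorm (mollify (bumpSeq n) w - w) (3 / 2) volume * eLpNorm f 3 volume
      + eLpNorm (mollify (bumpSeq n) v - v) 3 volume * eLpNorm h (3 / 2) volume) atTop
      (𝓝 (0 * eLpNorm f 3 volume + 0 * eLpNorm h (3 / 2) volume)) :=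
    (ENNReal.Tendsto.mul_const (tendsto_mollify h32 h32' hw) (Or.inr hf.2.ne)).add
      (ENNReal.Tendsto.mul_const (tendsto_mollify (by norm_num) (by simp) hv) (Or.inr hh.2.ne))
  have := ge_of_tendsto' lim bound
  simpa using this

/-- `f` is in `L^p` of every compact subset of `Ω`. -/
def MemLpLoc (Ω : Set E3) (p : ℝ≥0∞) (f : E3 → ℂ) : Prop :=
  ∀ K ⊆ Ω, IsCompact K → MemLp f p (volume.restrict K)

lemma MemLpLoc.mul_cutoff {Ω : Set E3} {p : ℝ≥0∞} {f φ : E3 → ℂ} (hf : MemLpLoc Ω p f)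
    (hφ : Continuous φ) (hc : HasCompactSupport φ) (hs : tsupport φ ⊆ Ω) :
    MemLp (fun y => φ y * f y) p := by
  have h1 := hf _ hs hc
  have h2 : MemLp (fun y => φ y * f y) p (volume.restrict (tsupport φ)) :=
    h1.mul (hφ.memLp_top_of_hasCompactSupport hc _)
  rw [← memLp_indicator_iff_restrict (isClosed_tsupport φ).measurableSet] at h2
  rwa [indicator_eq_self.2] at h2
  intro x hx
  exact subset_tsupport φ (left_ne_zero_of_mul hx)

/-- The weak Leibniz rule for the product of two weakly differentiable functions that are locally in
`L³` with derivatives locally in `L^{3/2}`. -/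
lemma WeakPartial.integral_mul {Ω : Set E3} (hΩ : IsOpen Ω) {i : Fin 3} {f h f' h' : E3 → ℂ}
    (H : WeakPartial Ω i f h) (H' : WeakPartial Ω i f' h') (hf : MemLpLoc Ω 3 f)
    (hh : MemLpLoc Ω (3 / 2) h) (hf' : MemLpLoc Ω 3 f') (hh' : MemLpLoc Ω (3 / 2) h')
    {φ : E3 → ℝ} (hφ : ContDiff ℝ ∞ φ) (hc : HasCompactSupport φ) (hs : tsupport φ ⊆ Ω) :
    Integrable (fun y => (φ y : ℂ) * (h y * f' y + f y * h' y)) ∧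
    Integrable (fun y => ((fderiv ℝ φ y (EuclideanSpace.single i (1 : ℝ)) : ℝ) : ℂ) * (f y * f' y)) ∧
    ∫ y, (φ y : ℂ) * (h y * f' y + f y * h' y) =
      - ∫ y, ((fderiv ℝ φ y (EuclideanSpace.single i (1 : ℝ)) : ℝ) : ℂ) * (f y * f' y) := by
  have h32 : (3 / 2 : ℝ≥0∞) ≤ 3 := by
    rw [ENNReal.div_le_iff (by simp) (by simp)]; norm_num
  -- Both factors have to be extended to `ℝ³`: one is cut off by `φ`, the other by a function `ζ` that
  -- is `1` on the support of `φ`.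
  obtain ⟨U, hU, hKU, hUΩ, hUc⟩ := exists_open_between_and_isCompact_closure hc hΩ hs
  obtain ⟨ζ, hζ, -, hζU, hζ1⟩ := exists_contMDiff_support_eq_eq_one_iff (n := (⊤ : ℕ∞)) 𝓘(ℝ, E3) hU
    (isClosed_tsupport φ) hKU
  have hζ := hζ.contDiff
  have hζs : tsupport ζ ⊆ Ω := by rw [tsupport, hζU]; exact hUΩ
  have hζc : HasCompactSupport ζ := by rw [HasCompactSupport, tsupport, hζU]; exact hUc
  have real_cutoff : ∀ {p : ℝ≥0∞} {f : E3 → ℂ} {θ : E3 → ℝ}, MemLpLoc Ω p f → Continuous θ →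
      HasCompactSupport θ → tsupport θ ⊆ Ω → MemLp (fun y => (θ y : ℂ) * f y) p := by
    intro p f θ hf hθ hθc hθs
    exact hf.mul_cutoff (Complex.continuous_ofReal.comp hθ)
      (hθc.mono' ((subset_tsupport _).trans (tsupport_ofReal_subset θ)))
      ((tsupport_ofReal_subset θ).trans hθs)
  have part_cutoff : ∀ {p : ℝ≥0∞} {f : E3 → ℂ} {θ : E3 → ℝ}, MemLpLoc Ω p f → ContDiff ℝ ∞ θ →
      HasCompactSupport θ → tsupport θ ⊆ Ω →
      MemLp (fun y => ((fderiv ℝ θ y (EuclideanSpace.single i (1 : ℝ)) : ℝ) : ℂ) * f y) p := by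
    intro p f θ hf hθ hθc hθs
    exact real_cutoff hf (continuous_partial hθ i)
      (hθc.mono' ((subset_tsupport _).trans (tsupport_partial_subset θ i)))
      ((tsupport_partial_subset θ i).trans hθs)
  have low : ∀ {f : E3 → ℂ}, MemLpLoc Ω 3 f → MemLpLoc Ω (3 / 2) f := by
    intro f hf K hK hKc
    have : IsFiniteMeasure (volume.restrict K) := ⟨by simpa using hKc.measure_lt_top⟩
    exact (hf K hK hKc).mono_exponent h32
  have F := H.cutoff hζ hζc hζs
  have V := H'.cutoff hφ hc hs
  have hvc : HasCompactSupport (fun y => (φ y : ℂ) * f' y) :=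
    hc.mono' ((subset_tsupport _).trans (tsupport_subset_of_zero fun x h => by simp [h]))
  have mF := real_cutoff hf hζ.continuous hζc hζs
  have mdF := (part_cutoff (low hf) hζ hζc hζs).add (real_cutoff hh hζ.continuous hζc hζs)
  have mV := real_cutoff hf' hφ.continuous hc hs
  have mdV1 := part_cutoff (low hf') hφ hc hs
  have mdV2 := real_cutoff hh' hφ.continuous hc hs
  have key := F.integral_by_parts V mF mdF mV (mdV1.add mdV2) hvc
  -- On the support of `φ` the cutoff `ζ` is `1`.
  have z1 : ∀ y, y ∈ tsupport φ → ζ y = 1 := fun y hy => (hζ1 y).1 hy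
  have z2 : ∀ y, φ y ≠ 0 → fderiv ℝ ζ y (EuclideanSpace.single i (1 : ℝ)) = 0 := by
    intro y hy
    have : ζ =ᶠ[𝓝 y] fun _ => 1 := by
      filter_upwards [(hφ.continuous.isOpen_preimage _ isOpen_ne).mem_nhds hy] with z hz
      exact z1 z (subset_tsupport φ hz)
    rw [this.fderiv_eq]; simp
  have z3 : ∀ y, fderiv ℝ φ y (EuclideanSpace.single i (1 : ℝ)) ≠ 0 → ζ y = 1 := by
    intro y hy
    exact z1 y (tsupport_partial_subset φ i (subset_tsupport _ hy))
  have I1 : Integrable (fun y => ((fderiv ℝ φ y (EuclideanSpace.single i (1 : ℝ)) : ℝ) : ℂ) * (f y * f' y)) := by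
    refine (mdV1.integrable_mul mF).congr (ae_of_all _ fun y => ?_)
    by_cases hy : fderiv ℝ φ y (EuclideanSpace.single i (1 : ℝ)) = 0
    · simp [hy]
    · simp [z3 y hy]; ring
  have I2 : Integrable (fun y => (φ y : ℂ) * (h y * f' y + f y * h' y)) := by
    refine ((mV.integrable_mul (real_cutoff hh hζ.continuous hζc hζs)).add
      (mdV2.integrable_mul mF)).congr (ae_of_all _ fun y => ?_)
    by_cases hy : φ y = 0
    · simp [hy]
    · simp [z1 y (subset_tsupport φ hy)]; ring
  refine ⟨I2, I1, ?_⟩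
  rw [eq_neg_iff_add_eq_zero, ← integral_add I2 I1, ← key]
  refine integral_congr_ae (ae_of_all _ fun y => ?_)
  by_cases hy : φ y = 0
  · by_cases hy' : fderiv ℝ φ y (EuclideanSpace.single i (1 : ℝ)) = 0
    · simp [hy, hy']
    · simp [hy, z3 y hy']; ring
  · simp [z1 y (subset_tsupport φ hy), z2 y hy]; ring

end

/-! ### Linear algebra of `𝔰𝔲(2)` and change of basis -/

/-- `suInner` as a bilinear form. -/
def suForm : LinearMap.BilinForm ℝ su2 :=
  LinearMap.mk₂ ℝ suInner
    (fun X Y Z => by simp [suInner, conjTranspose_add, add_mul])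
    (fun c X Y => by simp [suInner, conjTranspose_smul])
    (fun X Y Z => by simp [suInner, mul_add])
    (fun c X Y => by simp [suInner])

lemma suForm_apply (X Y : su2) : suForm X Y = suInner X Y := rfl

lemma suInner_eq_sum (X Y : su2) : suInner X Y = ∑ r, ∑ s,
    (starRingEnd ℂ ((X : Matrix (Fin 2) (Fin 2) ℂ) r s) * (Y : Matrix (Fin 2) (Fin 2) ℂ) r s).re := by
  simp only [suInner, trace, Matrix.diag, Matrix.mul_apply, conjTranspose_apply, Fin.sum_univ_two,
    Complex.add_re, Complex.star_def]
  ring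

lemma suInner_self (X : su2) :
    suInner X X = ∑ r, ∑ s, ‖(X : Matrix (Fin 2) (Fin 2) ℂ) r s‖ ^ 2 := by
  rw [suInner_eq_sum]
  refine Finset.sum_congr rfl fun r _ => Finset.sum_congr rfl fun s _ => ?_
  rw [← Complex.normSq_eq_conj_mul_self, Complex.ofReal_re, Complex.normSq_eq_norm_sq]

lemma suInner_self_nonneg (X : su2) : 0 ≤ suInner X X := by
  rw [suInner_self]; positivity

lemma suInner_comm (X Y : su2) : suInner X Y = suInner Y X := by
  simp only [suInner_eq_sum, Complex.mul_re, Complex.conj_re, Complex.conj_im]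
  refine Finset.sum_congr rfl fun r _ => Finset.sum_congr rfl fun s _ => ?_
  ring

lemma suForm_isSymm : LinearMap.IsSymm suForm := ⟨fun X Y => suInner_comm X Y⟩

lemma suInner_sq_le (X Y : su2) : suInner X Y ^ 2 ≤ suInner X X * suInner Y Y :=
  suForm.apply_sq_le_of_symm suInner_self_nonneg suForm_isSymm X Y

lemma suInner_add_self_le (X Y : su2) :
    suInner (X + Y) (X + Y) ≤ 2 * suInner X X + 2 * suInner Y Y := by
  have h := suInner_self_nonneg (X - Y)
  simp only [← suForm_apply, map_add, map_sub, LinearMap.add_apply, LinearMap.sub_apply] at h ⊢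
  linarith

lemma suInner_neg_self (X : su2) : suInner (-X) (-X) = suInner X X := by
  simp [← suForm_apply]

lemma suInner_smul_self (c : ℝ) (X : su2) : suInner (c • X) (c • X) = c ^ 2 * suInner X X := by
  simp [← suForm_apply]; ring

lemma re_trace_mul (X Y : su2) :
    (trace ((X : Matrix (Fin 2) (Fin 2) ℂ) * (Y : Matrix (Fin 2) (Fin 2) ℂ))).re =
      - suInner X Y := by
  have hX : (X : Matrix (Fin 2) (Fin 2) ℂ)ᴴ = -X := X.2.1
  rw [suInner, hX]; simp

lemma suInner_lie_self_le (X Y : su2) :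
    suInner ⁅X, Y⁆ ⁅X, Y⁆ ≤ 4 * (suInner X X * suInner Y Y) := by
  let _ : SeminormedAddCommGroup (Matrix (Fin 2) (Fin 2) ℂ) := Matrix.frobeniusSeminormedAddCommGroup
  have hn : ∀ Z : su2, suInner Z Z = ‖(Z : Matrix (Fin 2) (Fin 2) ℂ)‖ ^ 2 := by
    intro Z
    rw [suInner_self, Matrix.frobenius_norm_def, ← Real.sqrt_eq_rpow, Real.sq_sqrt (by positivity)]
    simp
  rw [hn, hn, hn]
  have hl : ((⁅X, Y⁆ : su2) : Matrix (Fin 2) (Fin 2) ℂ) =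
      (X : Matrix (Fin 2) (Fin 2) ℂ) * Y - (Y : Matrix (Fin 2) (Fin 2) ℂ) * X := rfl
  rw [hl]
  have h1 := norm_sub_le ((X : Matrix (Fin 2) (Fin 2) ℂ) * Y) ((Y : Matrix (Fin 2) (Fin 2) ℂ) * X)
  have h2 := Matrix.frobenius_norm_mul (X : Matrix (Fin 2) (Fin 2) ℂ) (Y : Matrix (Fin 2) (Fin 2) ℂ)
  have h3 := Matrix.frobenius_norm_mul (Y : Matrix (Fin 2) (Fin 2) ℂ) (X : Matrix (Fin 2) (Fin 2) ℂ)
  calc _ ≤ (2 * (‖(X : Matrix (Fin 2) (Fin 2) ℂ)‖ * ‖(Y : Matrix (Fin 2) (Fin 2) ℂ)‖)) ^ 2 := by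
        gcongr; linarith
    _ = _ := by ring

/-- The contraction `∑ gⁱʲ Sᵢⱼ` does not depend on the basis. -/
lemma contract_congr {ι : Type*} [Fintype ι] [DecidableEq ι] {Q : Matrix ι ι ℝ} (hQ : IsUnit Q.det)
    (G S : Matrix ι ι ℝ) :
    ∑ i, ∑ j, (Qᵀ * G * Q)⁻¹ i j * (Qᵀ * S * Q) i j = ∑ i, ∑ j, G⁻¹ i j * S i j := by
  have key : ∀ A B : Matrix ι ι ℝ, ∑ i, ∑ j, A i j * B i j = trace (A * Bᵀ) := by
    intro A B; simp [trace, Matrix.mul_apply]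
  rw [key, key, Matrix.mul_inv_rev, Matrix.mul_inv_rev, transpose_mul, transpose_mul,
    transpose_transpose]
  have h1 : (Qᵀ)⁻¹ * Qᵀ = 1 := Matrix.nonsing_inv_mul _ (by rwa [det_transpose])
  have h2 : Q * Q⁻¹ = 1 := Matrix.mul_nonsing_inv _ hQ
  calc trace (Q⁻¹ * (G⁻¹ * (Qᵀ)⁻¹) * (Qᵀ * (Sᵀ * Q)))
      = trace (Q⁻¹ * (G⁻¹ * ((Qᵀ)⁻¹ * Qᵀ) * Sᵀ * Q)) := by simp only [Matrix.mul_assoc]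
    _ = trace ((Q * Q⁻¹) * (G⁻¹ * Sᵀ)) := by
        rw [h1, Matrix.mul_one, ← Matrix.mul_assoc Q⁻¹, trace_mul_comm]
        simp only [Matrix.mul_assoc]
    _ = _ := by rw [h2, Matrix.one_mul]

/-- The change of basis for the matrix of a bilinear map. -/
lemma of_bilin_basis {V : Type*} [AddCommGroup V] [Module ℝ V] (β : V →ₗ[ℝ] V →ₗ[ℝ] ℝ)
    {ι : Type*} [Fintype ι] [DecidableEq ι] (c : Module.Basis ι ℝ V) (b : ι → V) :
    (Matrix.of fun i j => β (b i) (b j)) =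
      (c.toMatrix b)ᵀ * (Matrix.of fun i j => β (c i) (c j)) * c.toMatrix b := by
  ext i j
  simp only [Matrix.mul_apply, transpose_apply, of_apply, Module.Basis.toMatrix_apply]
  conv_lhs => rw [← c.sum_repr (b i), ← c.sum_repr (b j)]
  simp only [map_sum, map_smul, LinearMap.sum_apply, LinearMap.smul_apply, smul_eq_mul,
    Finset.mul_sum, Finset.sum_mul]
  refine Finset.sum_congr rfl fun k _ => Finset.sum_congr rfl fun l _ => ?_
  ring

section Pointwise

variable {M : Type*} [TopologicalSpace M] [ChartedSpace E3 M] [IsManifold 𝓘(ℝ, E3) ∞ M]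
  (g : RMetric M) {x : M}

/-- The metric at `x` as a bilinear map. -/
def gForm (x : M) : TangentSpace 𝓘(ℝ, E3) x →ₗ[ℝ] TangentSpace 𝓘(ℝ, E3) x →ₗ[ℝ] ℝ :=
  LinearMap.mk₂ ℝ (fun u v => g.inner x u v) (by simp) (by simp) (by simp) (by simp)

lemma gramMat_basis (c : Module.Basis (Fin 3) ℝ (TangentSpace 𝓘(ℝ, E3) x))
    (b : Fin 3 → TangentSpace 𝓘(ℝ, E3) x) :
    gramMat g x b = (c.toMatrix b)ᵀ * gramMat g x c * c.toMatrix b :=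
  of_bilin_basis (gForm g x) c b

omit [IsManifold 𝓘(ℝ, E3) ∞ M] in
lemma isUnit_det_toMatrix (c c' : Module.Basis (Fin 3) ℝ (TangentSpace 𝓘(ℝ, E3) x)) :
    IsUnit (c.toMatrix c').det := by
  rw [← Module.Basis.det_apply]; exact c.isUnit_det c'

lemma oneNormSq_basis (a : TangentSpace 𝓘(ℝ, E3) x →ₗ[ℝ] su2)
    (c c' : Module.Basis (Fin 3) ℝ (TangentSpace 𝓘(ℝ, E3) x)) :
    ∑ i, ∑ j, (gramMat g x c')⁻¹ i j * suInner (a (c' i)) (a (c' j)) =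
      ∑ i, ∑ j, (gramMat g x c)⁻¹ i j * suInner (a (c i)) (a (c j)) := by
  have h := of_bilin_basis (suForm.compl₁₂ a a) c c'
  have := contract_congr (isUnit_det_toMatrix c c') (gramMat g x c)
    (Matrix.of fun i j => (suForm.compl₁₂ a a) (c i) (c j))
  rw [← h, ← gramMat_basis] at this
  exact this

lemma twoNormSq_basis (Ψ : TangentSpace 𝓘(ℝ, E3) x →ₗ[ℝ] TangentSpace 𝓘(ℝ, E3) x →ₗ[ℝ] su2)
    (c c' : Module.Basis (Fin 3) ℝ (TangentSpace 𝓘(ℝ, E3) x)) :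
    ∑ i, ∑ j, ∑ k, ∑ l, (gramMat g x c')⁻¹ i k * (gramMat g x c')⁻¹ j l *
        suInner (Ψ (c' i) (c' j)) (Ψ (c' k) (c' l)) =
      ∑ i, ∑ j, ∑ k, ∑ l, (gramMat g x c)⁻¹ i k * (gramMat g x c)⁻¹ j l *
        suInner (Ψ (c i) (c j)) (Ψ (c k) (c l)) := by
  set Q := c.toMatrix c' with hQ
  have hQu : IsUnit Q.det := isUnit_det_toMatrix c c'
  have key : ∀ b : Fin 3 → TangentSpace 𝓘(ℝ, E3) x,
      ∑ i, ∑ j, ∑ k, ∑ l, (gramMat g x b)⁻¹ i k * (gramMat g x b)⁻¹ j l *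
        suInner (Ψ (b i) (b j)) (Ψ (b k) (b l)) =
      ∑ p, ∑ q, (kroneckerMap (· * ·) (gramMat g x b) (gramMat g x b))⁻¹ p q *
        (Matrix.of fun p q : Fin 3 × Fin 3 => suInner (Ψ (b p.1) (b p.2)) (Ψ (b q.1) (b q.2))) p q := by
    intro b
    rw [Matrix.inv_kronecker]
    simp only [Fintype.sum_prod_type, kroneckerMap_apply, of_apply]
  rw [key, key]
  have hS : (Matrix.of fun p q : Fin 3 × Fin 3 => suInner (Ψ (c' p.1) (c' p.2)) (Ψ (c' q.1) (c' q.2)))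
      = (kroneckerMap (· * ·) Q Q)ᵀ *
        (Matrix.of fun p q : Fin 3 × Fin 3 => suInner (Ψ (c p.1) (c p.2)) (Ψ (c q.1) (c q.2))) *
        kroneckerMap (· * ·) Q Q := by
    ext ⟨i, j⟩ ⟨k, l⟩
    simp only [Matrix.mul_apply, transpose_apply, of_apply, kroneckerMap_apply, hQ,
      Module.Basis.toMatrix_apply, ← suForm_apply]
    conv_lhs => rw [← c.sum_repr (c' i), ← c.sum_repr (c' j), ← c.sum_repr (c' k), ← c.sum_repr (c' l)]
    simp only [map_sum, map_smul, LinearMap.sum_apply, LinearMap.smul_apply, smul_eq_mul,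
      Finset.mul_sum, Finset.sum_mul, Fintype.sum_prod_type]
    rw [Finset.sum_comm]
    refine Finset.sum_congr rfl fun m _ => Finset.sum_congr rfl fun n _ => ?_
    rw [Finset.sum_comm]
    refine Finset.sum_congr rfl fun m' _ => Finset.sum_congr rfl fun n' _ => ?_
    ring
  have hG : kroneckerMap (· * ·) (gramMat g x c') (gramMat g x c') =
      (kroneckerMap (· * ·) Q Q)ᵀ * kroneckerMap (· * ·) (gramMat g x c) (gramMat g x c) *
        kroneckerMap (· * ·) Q Q := by
    rw [gramMat_basis g c c', ← hQ, mul_kronecker_mul, mul_kronecker_mul]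
    rfl
  rw [hS, hG]
  refine contract_congr ?_ _ _
  rw [det_kronecker]
  exact (hQu.pow _).mul (hQu.pow _)

lemma gramMat_symm (b : Fin 3 → TangentSpace 𝓘(ℝ, E3) x) (i j : Fin 3) :
    gramMat g x b i j = gramMat g x b j i := g.symm x _ _

lemma gramMat_posDef (c : Module.Basis (Fin 3) ℝ (TangentSpace 𝓘(ℝ, E3) x)) :
    (gramMat g x c).PosDef := by
  refine Matrix.PosDef.of_dotProduct_mulVec_pos ?_ fun v hv => ?_
  · ext i j; simp only [conjTranspose_apply, star_trivial]; exact gramMat_symm g _ _ _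
  · have hne : (∑ i, v i • c i) ≠ 0 := by
      intro h
      exact hv (funext fun i => Fintype.linearIndependent_iff.1 c.linearIndependent v h i)
    have := g.pos x _ hne
    have e : star v ⬝ᵥ (gramMat g x c) *ᵥ v = gForm g x (∑ i, v i • c i) (∑ i, v i • c i) := by
      simp only [map_sum, map_smul, LinearMap.sum_apply, LinearMap.smul_apply, smul_eq_mul,
        dotProduct, mulVec, star_trivial, Finset.mul_sum]
      refine Finset.sum_congr rfl fun i _ => Finset.sum_congr rfl fun j _ => ?_
      rw [gramMat_symm]
      simp only [gramMat, of_apply, gForm, LinearMap.mk₂_apply]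
      rw [g.symm]; ring
    rw [e]; exact this

variable (x) in
/-- Every tangent space has an orthonormal basis. -/
lemma exists_orthonormal :
    ∃ u : Module.Basis (Fin 3) ℝ (TangentSpace 𝓘(ℝ, E3) x), gramMat g x u = 1 := by
  have : FiniteDimensional ℝ (TangentSpace 𝓘(ℝ, E3) x) := inferInstanceAs (FiniteDimensional ℝ E3)
  have hfr : Module.finrank ℝ (TangentSpace 𝓘(ℝ, E3) x) = 3 := by
    show Module.finrank ℝ E3 = 3
    simp
  obtain ⟨v, hv⟩ := LinearMap.BilinForm.exists_orthogonal_basis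
    (B := gForm g x) ⟨fun u w => g.symm x u w⟩
  let v' := v.reindex (finCongr hfr)
  have hpos : ∀ i, 0 < g.inner x (v' i) (v' i) := fun i => g.pos x _ (v'.ne_zero i)
  let r : Fin 3 → ℝˣ := fun i => Units.mk0 (√(g.inner x (v' i) (v' i)))⁻¹
    (inv_ne_zero (Real.sqrt_pos.2 (hpos i)).ne')
  refine ⟨v'.unitsSMul r, ?_⟩
  ext i j
  have h1 : g.inner x (r i • v' i) (r j • v' j) =
      (√(g.inner x (v' i) (v' i)))⁻¹ * ((√(g.inner x (v' j) (v' j)))⁻¹ * g.inner x (v' i) (v' j)) := by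
    simp [r, Units.smul_def]
    ring
  simp only [gramMat, of_apply, Module.Basis.unitsSMul_apply]
  rw [h1]
  by_cases h : i = j
  · subst h
    rw [one_apply_eq, ← mul_assoc, ← mul_inv, Real.mul_self_sqrt (hpos i).le,
      inv_mul_cancel₀ (hpos i).ne']
  · have h0 : g.inner x (v' i) (v' j) = 0 := by
      have hne : (finCongr hfr).symm i ≠ (finCongr hfr).symm j := fun e => h ((finCongr hfr).symm.injective e)
      have := hv hne
      simpa [v', gForm] using this
    rw [h0, one_apply_ne h]; ring

end Pointwise

/-! ### Pointwise norms in an arbitrary basis -/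

section Pointwise

variable {M : Type*} [TopologicalSpace M] [ChartedSpace E3 M] [IsManifold 𝓘(ℝ, E3) ∞ M]
  {x : M}

lemma mdifferentiable_chart {e : OpenPartialHomeomorph M E3} (he : e ∈ atlas E3 M) :
    e.MDifferentiable 𝓘(ℝ, E3) 𝓘(ℝ, E3) := by
  have : IsManifold 𝓘(ℝ, E3) 1 M := IsManifold.of_le (n := ∞) (by simp)
  exact mdifferentiable_of_mem_atlas he

/-- The coordinate vector fields of a chart at a point of its source, as a basis. -/
def coordBasis {e : OpenPartialHomeomorph M E3} (he : e ∈ atlas E3 M) (hx : x ∈ e.source) :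
    Module.Basis (Fin 3) ℝ (TangentSpace 𝓘(ℝ, E3) x) :=
  (EuclideanSpace.basisFun (Fin 3) ℝ).toBasis.map
    (((mdifferentiable_chart he).mfderiv hx).toLinearEquiv.trans
      (NormedSpace.fromTangentSpace (𝕜 := ℝ) (e x)).toLinearEquiv).symm

lemma coe_coordBasis {e : OpenPartialHomeomorph M E3} (he : e ∈ atlas E3 M) (hx : x ∈ e.source) :
    ⇑(coordBasis he hx) = coordVec e x := by
  ext1 i
  have h := ContinuousLinearMap.inverse_equiv ((mdifferentiable_chart he).mfderiv hx)
  have h2 : (((mdifferentiable_chart he).mfderiv hx : TangentSpace 𝓘(ℝ, E3) x ≃L[ℝ] TangentSpace 𝓘(ℝ, E3) (e x)) :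
    TangentSpace 𝓘(ℝ, E3) x →L[ℝ] TangentSpace 𝓘(ℝ, E3) (e x)) = mfderiv 𝓘(ℝ, E3) 𝓘(ℝ, E3) e x := rfl
  rw [h2] at h
  rw [coordVec, h, coordBasis, Module.Basis.map_apply, OrthonormalBasis.coe_toBasis,
    EuclideanSpace.basisFun_apply]
  rfl

variable (x) in
/-- The preferred frame at `x`, as a basis. -/
def frameBasis : Module.Basis (Fin 3) ℝ (TangentSpace 𝓘(ℝ, E3) x) :=
  coordBasis (chart_mem_atlas E3 x) (mem_chart_source E3 x)

variable (x) in
lemma coe_frameBasis : ⇑(frameBasis x) = frame x := coe_coordBasis _ _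

variable (g : RMetric M)

lemma norm₁_eq_basis (a : OneForm M) (c : Module.Basis (Fin 3) ℝ (TangentSpace 𝓘(ℝ, E3) x)) :
    norm₁ g a x = √(∑ i, ∑ j, (gramMat g x c)⁻¹ i j * suInner (a x (c i)) (a x (c j))) := by
  rw [norm₁, ← coe_frameBasis, oneNormSq_basis g (a x) c (frameBasis x)]

lemma normSq₂_eq_basis (Ψ : TwoTensor M) (c : Module.Basis (Fin 3) ℝ (TangentSpace 𝓘(ℝ, E3) x)) :
    normSq₂ g Ψ x = ∑ i, ∑ j, ∑ k, ∑ l, (gramMat g x c)⁻¹ i k * (gramMat g x c)⁻¹ j l *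
      suInner (Ψ x (c i) (c j)) (Ψ x (c k) (c l)) := by
  rw [normSq₂, ← coe_frameBasis, twoNormSq_basis g (Ψ x) c (frameBasis x)]

lemma norm₁_eq_orthonormal (a : OneForm M) {u : Module.Basis (Fin 3) ℝ (TangentSpace 𝓘(ℝ, E3) x)}
    (hu : gramMat g x u = 1) : norm₁ g a x = √(∑ i, suInner (a x (u i)) (a x (u i))) := by
  rw [norm₁_eq_basis g a u, hu]
  simp [Matrix.one_apply]

lemma normSq₂_eq_orthonormal (Ψ : TwoTensor M)
    {u : Module.Basis (Fin 3) ℝ (TangentSpace 𝓘(ℝ, E3) x)} (hu : gramMat g x u = 1) :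
    normSq₂ g Ψ x = ∑ i, ∑ j, suInner (Ψ x (u i) (u j)) (Ψ x (u i) (u j)) := by
  rw [normSq₂_eq_basis g Ψ u, hu]
  simp [Matrix.one_apply]

lemma norm₁_nonneg (a : OneForm M) : 0 ≤ norm₁ g a x := Real.sqrt_nonneg _

lemma norm₂_nonneg (Ψ : TwoTensor M) : 0 ≤ norm₂ g Ψ x := Real.sqrt_nonneg _

lemma normForm₂_nonneg (Ψ : TwoTensor M) : 0 ≤ normForm₂ g Ψ x := Real.sqrt_nonneg _

lemma norm₁_sq (a : OneForm M) {u : Module.Basis (Fin 3) ℝ (TangentSpace 𝓘(ℝ, E3) x)}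
    (hu : gramMat g x u = 1) : norm₁ g a x ^ 2 = ∑ i, suInner (a x (u i)) (a x (u i)) := by
  rw [norm₁_eq_orthonormal g a hu, Real.sq_sqrt]
  exact Finset.sum_nonneg fun i _ => suInner_self_nonneg _

variable (x) in
lemma normSq₂_nonneg (Ψ : TwoTensor M) : 0 ≤ normSq₂ g Ψ x := by
  obtain ⟨u, hu⟩ := exists_orthonormal g x
  rw [normSq₂_eq_orthonormal g Ψ hu]
  exact Finset.sum_nonneg fun i _ => Finset.sum_nonneg fun j _ => suInner_self_nonneg _

lemma norm₂_sq (Ψ : TwoTensor M) : norm₂ g Ψ x ^ 2 = normSq₂ g Ψ x :=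
  Real.sq_sqrt (normSq₂_nonneg x g Ψ)

lemma normForm₂_sq (Ψ : TwoTensor M) : normForm₂ g Ψ x ^ 2 = normSq₂ g Ψ x / 2 :=
  Real.sq_sqrt (by linarith [normSq₂_nonneg x g Ψ])

/-! ### Pointwise inequalities -/

/-- The two-tensor `Ψᵢⱼ - Ψⱼᵢ`. -/
def altTensor (Ψ : TwoTensor M) : TwoTensor M := fun x => Ψ x - (Ψ x).flip

/-- The two-tensor `[Bᵢ, aⱼ]`. -/
def lieTensor (B a : OneForm M) : TwoTensor M := fun x =>
  LinearMap.mk₂ ℝ (fun u v => ⁅B x u, a x v⁆) (by simp) (by simp) (by simp) (by simp)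

/-- The value of the two-tensor at `x` is alternating. -/
def IsAltAt (Ψ : TwoTensor M) (x : M) : Prop := ∀ u v, Ψ x u v = - Ψ x v u

lemma isAltAt_altTensor (Ψ : TwoTensor M) : IsAltAt (altTensor Ψ) x := fun u v => by
  simp [altTensor]

lemma isAltAt_wedgeSelf (a : OneForm M) : IsAltAt (wedgeSelf a) x := fun u v => by
  simp only [wedgeSelf, LinearMap.mk₂_apply]; exact (lie_skew _ _).symm

lemma IsAltAt.add {Ψ Φ : TwoTensor M} (h : IsAltAt Ψ x) (h' : IsAltAt Φ x) :
    IsAltAt (Ψ + Φ) x := fun u v => by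
  simp only [Pi.add_apply, LinearMap.add_apply]; rw [h u v, h' u v]; abel

lemma le_of_sq_bound {s t : ℝ} (ht : 0 ≤ t) (h : s ^ 2 ≤ t ^ 2) : s ≤ t :=
  (le_abs_self s).trans (abs_le_of_sq_le_sq h ht)

lemma le_of_sq_le_two_mul_add {n a b : ℝ} (ha : 0 ≤ a) (hb : 0 ≤ b)
    (h : n ^ 2 ≤ 2 * a ^ 2 + 2 * b ^ 2) : n ≤ 2 * a + 2 * b :=
  le_of_sq_bound (by positivity) (by nlinarith [mul_nonneg ha hb])

/-- A triangle inequality with the constant `2`, from `|X + Y|² ≤ 2 |X|² + 2 |Y|²` on components. -/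
lemma norm₁_add_le (a b : OneForm M) :
    norm₁ g (a + b) x ≤ 2 * norm₁ g a x + 2 * norm₁ g b x := by
  obtain ⟨u, hu⟩ := exists_orthonormal g x
  refine le_of_sq_le_two_mul_add (norm₁_nonneg g a) (norm₁_nonneg g b) ?_
  rw [norm₁_sq g _ hu, norm₁_sq g _ hu, norm₁_sq g _ hu, Finset.mul_sum, Finset.mul_sum,
    ← Finset.sum_add_distrib]
  exact Finset.sum_le_sum fun i _ => suInner_add_self_le _ _

lemma norm₁_neg (a : OneForm M) : norm₁ g (-a) x = norm₁ g a x := by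
  obtain ⟨u, hu⟩ := exists_orthonormal g x
  rw [norm₁_eq_orthonormal g _ hu, norm₁_eq_orthonormal g _ hu]
  simp only [Pi.neg_apply, LinearMap.neg_apply, suInner_neg_self]

lemma norm₁_sub_le (a b : OneForm M) :
    norm₁ g (a - b) x ≤ 2 * norm₁ g a x + 2 * norm₁ g b x := by
  rw [sub_eq_add_neg, ← norm₁_neg g b]
  exact norm₁_add_le g a (-b)

lemma normSq₂_add_le (Ψ Φ : TwoTensor M) :
    normSq₂ g (Ψ + Φ) x ≤ 2 * normSq₂ g Ψ x + 2 * normSq₂ g Φ x := by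
  obtain ⟨u, hu⟩ := exists_orthonormal g x
  rw [normSq₂_eq_orthonormal g _ hu, normSq₂_eq_orthonormal g _ hu, normSq₂_eq_orthonormal g _ hu,
    Finset.mul_sum, Finset.mul_sum, ← Finset.sum_add_distrib]
  refine Finset.sum_le_sum fun i _ => ?_
  rw [Finset.mul_sum, Finset.mul_sum, ← Finset.sum_add_distrib]
  exact Finset.sum_le_sum fun j _ => suInner_add_self_le _ _

lemma normSq₂_neg (Ψ : TwoTensor M) : normSq₂ g (-Ψ) x = normSq₂ g Ψ x := by
  obtain ⟨u, hu⟩ := exists_orthonormal g x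
  rw [normSq₂_eq_orthonormal g _ hu, normSq₂_eq_orthonormal g _ hu]
  simp only [Pi.neg_apply, LinearMap.neg_apply, suInner_neg_self]

lemma norm₂_add_le (Ψ Φ : TwoTensor M) :
    norm₂ g (Ψ + Φ) x ≤ 2 * norm₂ g Ψ x + 2 * norm₂ g Φ x := by
  refine le_of_sq_le_two_mul_add (norm₂_nonneg g Ψ) (norm₂_nonneg g Φ) ?_
  rw [norm₂_sq, norm₂_sq, norm₂_sq]
  exact normSq₂_add_le g Ψ Φ

lemma norm₂_sub_le (Ψ Φ : TwoTensor M) :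
    norm₂ g (Ψ - Φ) x ≤ 2 * norm₂ g Ψ x + 2 * norm₂ g Φ x := by
  have := norm₂_add_le (x := x) g Ψ (-Φ)
  rwa [← sub_eq_add_neg, show norm₂ g (-Φ) x = norm₂ g Φ x by rw [norm₂, norm₂, normSq₂_neg]] at this

lemma normForm₂_add_le (Ψ Φ : TwoTensor M) :
    normForm₂ g (Ψ + Φ) x ≤ 2 * normForm₂ g Ψ x + 2 * normForm₂ g Φ x := by
  refine le_of_sq_le_two_mul_add (normForm₂_nonneg g Ψ) (normForm₂_nonneg g Φ) ?_
  rw [normForm₂_sq, normForm₂_sq, normForm₂_sq]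
  linarith [normSq₂_add_le (x := x) g Ψ Φ]

lemma norm₂_lieTensor_le (B a : OneForm M) :
    norm₂ g (lieTensor B a) x ≤ 2 * norm₁ g B x * norm₁ g a x := by
  obtain ⟨u, hu⟩ := exists_orthonormal g x
  have ha := norm₁_nonneg (x := x) g a
  have hb := norm₁_nonneg (x := x) g B
  refine le_of_sq_bound (by positivity) ?_
  rw [norm₂_sq, mul_pow, mul_pow, norm₁_sq g _ hu, norm₁_sq g _ hu, normSq₂_eq_orthonormal g _ hu,
    mul_assoc, Finset.sum_mul_sum, Finset.mul_sum]
  refine Finset.sum_le_sum fun i _ => ?_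
  rw [Finset.mul_sum]
  refine Finset.sum_le_sum fun j _ => (suInner_lie_self_le _ _).trans (le_of_eq (by norm_num))

lemma normForm₂_le_norm₂ (Ψ : TwoTensor M) : normForm₂ g Ψ x ≤ norm₂ g Ψ x := by
  rw [normForm₂, norm₂]
  exact Real.sqrt_le_sqrt (by linarith [normSq₂_nonneg x g Ψ])

lemma normForm₂_wedgeSelf_le (a : OneForm M) :
    normForm₂ g (wedgeSelf a) x ≤ 2 * norm₁ g a x ^ 2 := by
  refine (normForm₂_le_norm₂ g _).trans ((norm₂_lieTensor_le g a a).trans (le_of_eq (by ring)))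

lemma normForm₂_altTensor_le (Ψ : TwoTensor M) :
    normForm₂ g (altTensor Ψ) x ≤ 2 * norm₂ g Ψ x := by
  obtain ⟨u, hu⟩ := exists_orthonormal g x
  have ha := norm₂_nonneg (x := x) g Ψ
  refine le_of_sq_bound (by positivity) ?_
  rw [normForm₂_sq, mul_pow, norm₂_sq]
  have h1 : normSq₂ g (fun x => (Ψ x).flip) x = normSq₂ g Ψ x := by
    rw [normSq₂_eq_orthonormal g _ hu, normSq₂_eq_orthonormal g _ hu, Finset.sum_comm]
    rfl
  have h2 := normSq₂_add_le (x := x) g Ψ (-(fun x => (Ψ x).flip))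
  rw [normSq₂_neg, h1, ← sub_eq_add_neg] at h2
  have h3 := normSq₂_nonneg x g Ψ
  show normSq₂ g (Ψ - fun x => (Ψ x).flip) x / 2 ≤ _
  linarith

/-! ### Densities of three-forms -/

/-- The value at `x` of a three-form, given by its values on triples of vectors. -/
def IsThreeForm (η : (Fin 3 → TangentSpace 𝓘(ℝ, E3) x) → ℝ) : Prop :=
  ∃ θ : TangentSpace 𝓘(ℝ, E3) x [⋀^Fin 3]→ₗ[ℝ] ℝ, ∀ b, η b = θ b

lemma IsThreeForm.basis {η : (Fin 3 → TangentSpace 𝓘(ℝ, E3) x) → ℝ} (h : IsThreeForm η)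
    (c : Module.Basis (Fin 3) ℝ (TangentSpace 𝓘(ℝ, E3) x)) (b : Fin 3 → TangentSpace 𝓘(ℝ, E3) x) :
    η b = η c * (c.toMatrix b).det := by
  obtain ⟨θ, hθ⟩ := h
  rw [hθ, hθ, ← Module.Basis.det_apply]
  conv_lhs => rw [θ.eq_smul_basis_det c]
  rfl

lemma fin3_cases (i : Fin 3) : i = 0 ∨ i = 1 ∨ i = 2 := by
  revert i; decide

/-- Cyclic sums of trilinear maps that are antisymmetric in two arguments are alternating. -/
lemma isThreeForm_cyclic
    (τ : TangentSpace 𝓘(ℝ, E3) x →ₗ[ℝ] TangentSpace 𝓘(ℝ, E3) x →ₗ[ℝ] TangentSpace 𝓘(ℝ, E3) x →ₗ[ℝ] ℝ)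
    (hτ : ∀ u v w, τ u v w = - τ v u w) :
    IsThreeForm fun b => τ (b 0) (b 1) (b 2) + τ (b 1) (b 2) (b 0) + τ (b 2) (b 0) (b 1) := by
  have h01 : ¬ (0 : Fin 3) = 1 := by decide
  have h02 : ¬ (0 : Fin 3) = 2 := by decide
  have h12 : ¬ (1 : Fin 3) = 2 := by decide
  have h10 : ¬ (1 : Fin 3) = 0 := by decide
  have h20 : ¬ (2 : Fin 3) = 0 := by decide
  have h21 : ¬ (2 : Fin 3) = 1 := by decide
  have h0 : ∀ u w, τ u u w = 0 := fun u w => by linarith [hτ u u w]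
  refine ⟨{ toFun := fun b => τ (b 0) (b 1) (b 2) + τ (b 1) (b 2) (b 0) + τ (b 2) (b 0) (b 1)
            map_update_add' := ?_, map_update_smul' := ?_, map_eq_zero_of_eq' := ?_ }, fun b => rfl⟩
  · intro inst m i u v
    rw [Subsingleton.elim inst (instDecidableEqFin 3)]
    rcases fin3_cases i with rfl | rfl | rfl <;>
      simp only [Function.update_self, Function.update_of_ne, ne_eq, not_false_eq_true, h01, h02, h12,
        h10, h20, h21, map_add, LinearMap.add_apply] <;> ring
  · intro inst m i c u
    rw [Subsingleton.elim inst (instDecidableEqFin 3)]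
    rcases fin3_cases i with rfl | rfl | rfl <;>
      simp only [Function.update_self, Function.update_of_ne, ne_eq, not_false_eq_true, h01, h02, h12,
        h10, h20, h21, map_smul, LinearMap.smul_apply, smul_eq_mul] <;> ring
  · intro b i j hb hij
    rcases fin3_cases i with rfl | rfl | rfl <;> rcases fin3_cases j with rfl | rfl | rfl <;>
      first
      | exact absurd rfl hij
      | (simp only [hb, h0]
         linarith [hτ (b 0) (b 1) (b 0), hτ (b 0) (b 1) (b 1), hτ (b 0) (b 2) (b 0),
          hτ (b 0) (b 2) (b 2), hτ (b 1) (b 2) (b 1), hτ (b 1) (b 2) (b 2)])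

lemma trWedge_eq (Ψ : TwoTensor M) (a : OneForm M) (b : Fin 3 → TangentSpace 𝓘(ℝ, E3) x) :
    trWedge Ψ a x b = -(suInner (Ψ x (b 0) (b 1)) (a x (b 2)) +
      suInner (Ψ x (b 1) (b 2)) (a x (b 0)) + suInner (Ψ x (b 2) (b 0)) (a x (b 1))) := by
  rw [trWedge, trace_add, trace_add, Complex.add_re, Complex.add_re, re_trace_mul, re_trace_mul,
    re_trace_mul]
  ring

lemma isThreeForm_trWedge {Ψ : TwoTensor M} (h : IsAltAt Ψ x) (a : OneForm M) :
    IsThreeForm (trWedge Ψ a x) := by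
  let τ : TangentSpace 𝓘(ℝ, E3) x →ₗ[ℝ] TangentSpace 𝓘(ℝ, E3) x →ₗ[ℝ]
      TangentSpace 𝓘(ℝ, E3) x →ₗ[ℝ] ℝ :=
    LinearMap.mk₂ ℝ (fun u v => -((suForm (Ψ x u v)).comp (a x)))
      (fun u u' v => by ext; simp; ring) (fun c u v => by ext; simp)
      (fun u v v' => by ext; simp; ring) (fun c u v => by ext; simp)
  have e : trWedge Ψ a x = fun b => τ (b 0) (b 1) (b 2) + τ (b 1) (b 2) (b 0) + τ (b 2) (b 0) (b 1) := by
    ext b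
    rw [trWedge_eq]
    simp only [τ, LinearMap.mk₂_apply, LinearMap.neg_apply, LinearMap.comp_apply, suForm_apply]
    ring
  rw [e]
  refine isThreeForm_cyclic τ fun u v w => ?_
  simp only [τ, LinearMap.mk₂_apply, LinearMap.neg_apply, LinearMap.comp_apply]
  rw [h u v]; simp

open Classical in
/-- The sign of a frame at `x` with respect to the orientation. It is meant for frames that are bases;
other triples of vectors have the sign `-1`. -/
def frameSign (o : MfdOrientation M) (b : Fin 3 → TangentSpace 𝓘(ℝ, E3) x) : ℝ :=
  if IsPositive (o.at' x) b then 1 else -1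

/-- Two bases have the same sign if and only if the determinant of the change of basis is positive. -/
lemma frameSign_basis (o : MfdOrientation M)
    (c c' : Module.Basis (Fin 3) ℝ (TangentSpace 𝓘(ℝ, E3) x)) :
    frameSign o c' * |(c.toMatrix c').det| = frameSign o c * (c.toMatrix c').det := by
  have hpos : ∀ d : Module.Basis (Fin 3) ℝ (TangentSpace 𝓘(ℝ, E3) x),
      IsPositive (o.at' x) d ↔ d.orientation = o.at' x := by
    intro d
    refine ⟨fun ⟨d', hd', h⟩ => ?_, fun h => ⟨d, rfl, h⟩⟩
    rwa [Module.Basis.eq_of_apply_eq (fun i => congrFun hd' i)] at h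
  have hne := (isUnit_det_toMatrix c c').ne_zero
  have hd := Module.Basis.orientation_eq_iff_det_pos c c'
  rw [Module.Basis.det_apply] at hd
  rw [frameSign, frameSign, hpos, hpos]
  rcases lt_or_gt_of_ne hne with h | h
  · have h1 : c.orientation ≠ c'.orientation := fun e => (hd.1 e).not_gt h
    rw [abs_of_neg h]
    rcases Module.Basis.orientation_eq_or_eq_neg c (o.at' x) with h2 | h2
    · rw [if_pos h2.symm, if_neg (fun e => h1 (h2.symm.trans e.symm))]; ring
    · have h3 : c'.orientation = o.at' x := by
        rw [h2]; exact (c.orientation_ne_iff_eq_neg c'.orientation).1 h1.symm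
      rw [if_pos h3, if_neg (fun e => h1 (e.trans h3.symm))]; ring
  · rw [abs_of_pos h, hd.2 h]

/-- The density of a three-form may be computed in any basis: the change of basis multiplies the
value of the form by a determinant `d`, the root of the Gram determinant by `|d|`, and the sign of the
frame by the sign of `d`. -/
lemma formDensity_eq_basis (o : MfdOrientation M)
    {η : (x : M) → (Fin 3 → TangentSpace 𝓘(ℝ, E3) x) → ℝ} (h : IsThreeForm (η x))
    (c : Module.Basis (Fin 3) ℝ (TangentSpace 𝓘(ℝ, E3) x)) :
    formDensity g o η x = frameSign o c * η x c / √(gramMat g x c).det := by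
  have e0 : formDensity g o η x = frameSign o (frame x) * η x (frame x) / √(gramMat g x (frame x)).det := rfl
  rw [e0, ← coe_frameBasis]
  set c' := frameBasis x
  rw [h.basis c c', gramMat_basis g c c', det_mul, det_mul, det_transpose]
  have hd := (gramMat_posDef g c).det_pos
  have hne := (isUnit_det_toMatrix c c').ne_zero
  have : √((c.toMatrix c').det * (gramMat g x c).det * (c.toMatrix c').det) =
      |(c.toMatrix c').det| * √(gramMat g x c).det := by
    rw [← Real.sqrt_sq_eq_abs, ← Real.sqrt_mul (sq_nonneg _)]; congr 1; ring
  rw [this]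
  have h3 := frameSign_basis o c c'
  have habs : |(c.toMatrix c').det| ≠ 0 := abs_ne_zero.2 hne
  have hs : √(gramMat g x c).det ≠ 0 := (Real.sqrt_pos.2 hd).ne'
  rw [div_eq_div_iff (mul_ne_zero habs hs) hs]
  have h4 : (c.toMatrix c').det ^ 2 = |(c.toMatrix c').det| ^ 2 := (sq_abs _).symm
  have h5 : frameSign o c' * (c.toMatrix c').det = frameSign o c * |(c.toMatrix c').det| := by
    have : |(c.toMatrix c').det| * (frameSign o c' * (c.toMatrix c').det)
      = |(c.toMatrix c').det| * (frameSign o c * |(c.toMatrix c').det|) := by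
      linear_combination (c.toMatrix c').det * h3 + frameSign o c * h4
    exact mul_left_cancel₀ habs this
  linear_combination η x c * √(gramMat g x c).det * h5

lemma abs_frameSign (o : MfdOrientation M) (b : Fin 3 → TangentSpace 𝓘(ℝ, E3) x) :
    |frameSign o b| = 1 := by
  rw [frameSign]; split_ifs <;> simp

/-- The inequality `|tr (Ψ ∧ a)| ≤ |Ψ| |a|`: in an orthonormal frame the density is, up to sign, the
scalar product of the components `(Ψ₁₂, Ψ₂₀, Ψ₀₁)` and `(a₀, a₁, a₂)`. -/
lemma abs_formDensity_trWedge_le (o : MfdOrientation M) {Ψ : TwoTensor M} (h : IsAltAt Ψ x)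
    (a : OneForm M) :
    |formDensity g o (trWedge Ψ a) x| ≤ normForm₂ g Ψ x * norm₁ g a x := by
  obtain ⟨u, hu⟩ := exists_orthonormal g x
  rw [formDensity_eq_basis g o (isThreeForm_trWedge h a) u, hu, det_one, Real.sqrt_one, div_one,
    abs_mul, abs_frameSign, one_mul]
  refine le_of_sq_bound (mul_nonneg (normForm₂_nonneg g Ψ) (norm₁_nonneg g a)) ?_
  rw [sq_abs, mul_pow, normForm₂_sq, norm₁_sq g a hu, normSq₂_eq_orthonormal g Ψ hu, trWedge_eq]
  let β : LinearMap.BilinForm ℝ (Fin 3 → su2) :=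
    ∑ k, suForm.compl₁₂ (LinearMap.proj k) (LinearMap.proj k)
  have hβ : ∀ X Y, β X Y = ∑ k, suInner (X k) (Y k) := fun X Y => by
    simp [β, suForm_apply]
  have hβ0 : ∀ X, 0 ≤ β X X := fun X => by
    rw [hβ]; exact Finset.sum_nonneg fun k _ => suInner_self_nonneg _
  have hβs : LinearMap.IsSymm β := ⟨fun X Y => by
    simp only [hβ, RingHom.id_apply]; exact Finset.sum_congr rfl fun k _ => suInner_comm _ _⟩
  have key := β.apply_sq_le_of_symm hβ0 hβs
    ![Ψ x (u 1) (u 2), Ψ x (u 2) (u 0), Ψ x (u 0) (u 1)] (fun k => a x (u k))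
  have hz : ∀ v, Ψ x v v = 0 := fun v => by
    have h2 : (2 : ℝ) • Ψ x v v = 0 := by rw [two_smul]; nth_rewrite 1 [h v v]; simp
    exact (smul_eq_zero.1 h2).resolve_left two_ne_zero
  simp only [hβ, Fin.sum_univ_three] at key
  simp only [Fin.sum_univ_three, hz, h (u 1) (u 0), h (u 2) (u 1), h (u 0) (u 2), suInner_neg_self]
  have h00 : suInner (0 : su2) 0 = 0 := by simp [suInner]
  simp only [h00]
  simp only [Matrix.cons_val_zero, Matrix.cons_val_one, Matrix.cons_val_two, Matrix.head_cons, Matrix.tail_cons] at key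
  nlinarith [key]

end Pointwise

/-! ### Charts and the metric in coordinates -/

section Charts

variable {M : Type*} [TopologicalSpace M] [ChartedSpace E3 M] [IsManifold 𝓘(ℝ, E3) ∞ M]
  {e e' : OpenPartialHomeomorph M E3}

lemma mfderiv_coordVec (he : e ∈ atlas E3 M) {x : M} (hx : x ∈ e.source) (i : Fin 3) :
    mfderiv 𝓘(ℝ, E3) 𝓘(ℝ, E3) e x (coordVec e x i) =
      (NormedSpace.fromTangentSpace (𝕜 := ℝ) (e x)).symm (EuclideanSpace.single i (1 : ℝ)) := by
  have h := ContinuousLinearMap.inverse_equiv ((mdifferentiable_chart he).mfderiv hx)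
  have h2 : (((mdifferentiable_chart he).mfderiv hx : TangentSpace 𝓘(ℝ, E3) x ≃L[ℝ] TangentSpace 𝓘(ℝ, E3) (e x)) :
    TangentSpace 𝓘(ℝ, E3) x →L[ℝ] TangentSpace 𝓘(ℝ, E3) (e x)) = mfderiv 𝓘(ℝ, E3) 𝓘(ℝ, E3) e x := rfl
  rw [h2] at h
  rw [coordVec, h]
  exact ((mdifferentiable_chart he).mfderiv hx).apply_symm_apply _

lemma coordVec_eq_mfderiv_symm (he : e ∈ atlas E3 M) {y : E3} (hy : y ∈ e.target) (i : Fin 3) :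
    coordVec e (e.symm y) i =
      mfderiv 𝓘(ℝ, E3) 𝓘(ℝ, E3) e.symm y (EuclideanSpace.single i (1 : ℝ) : E3) := by
  have hx : e.symm y ∈ e.source := e.map_target hy
  apply (mdifferentiable_chart he).mfderiv_injective hx
  rw [mfderiv_coordVec he hx i]
  have h := (mdifferentiable_chart he).comp_symm_deriv hy
  exact (DFunLike.congr_fun h (EuclideanSpace.single i (1 : ℝ) : E3)).symm

lemma contMDiffOn_chart_symm (he : e ∈ atlas E3 M) :
    ContMDiffOn 𝓘(ℝ, E3) 𝓘(ℝ, E3) ∞ e.symm e.target :=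
  contMDiffOn_symm_of_mem_maximalAtlas (IsManifold.subset_maximalAtlas he)

/-- The coordinate vector fields are smooth. -/
lemma contMDiffOn_coordVec (he : e ∈ atlas E3 M) (i : Fin 3) :
    ContMDiffOn 𝓘(ℝ, E3) (𝓘(ℝ, E3).prod 𝓘(ℝ, E3)) ∞
      (fun y => (⟨e.symm y, coordVec e (e.symm y) i⟩ : TangentBundle 𝓘(ℝ, E3) M)) e.target := by
  have h1 := (contMDiffOn_chart_symm he).contMDiffOn_tangentMapWithin (m := ∞) (by simp)
    e.open_target.uniqueMDiffOn
  have h2 : ContMDiffOn 𝓘(ℝ, E3) (𝓘(ℝ, E3).prod 𝓘(ℝ, E3)) ∞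
      (fun y : E3 => (⟨y, (EuclideanSpace.single i (1 : ℝ) : E3)⟩ : TangentBundle 𝓘(ℝ, E3) E3)) e.target :=
    contMDiffOn_vectorSpace_iff_contDiffOn.2 contDiffOn_const
  refine (h1.comp h2 fun y hy => hy).congr fun y hy => ?_
  simp only [Function.comp, tangentMapWithin]
  rw [coordVec_eq_mfderiv_symm he hy, mfderivWithin_eq_mfderiv (e.open_target.uniqueMDiffOn y hy)
    ((mdifferentiable_chart he).mdifferentiableAt_symm hy)]

variable (g : RMetric M)

lemma contDiffOn_gMat (he : e ∈ atlas E3 M) (i j : Fin 3) :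
    ContDiffOn ℝ ∞ (fun y => gMat g e y i j) e.target := by
  rw [← contMDiffOn_iff_contDiffOn]
  intro y hy
  have this : ContMDiffWithinAt 𝓘(ℝ, E3) (𝓘(ℝ, E3).prod 𝓘(ℝ)) ∞
      (fun y ↦ TotalSpace.mk' ℝ (E := Bundle.Trivial M ℝ) (e.symm y)
        (g.inner (e.symm y) (coordVec e (e.symm y) i) (coordVec e (e.symm y) j))) e.target y := by
    apply ContMDiffWithinAt.clm_bundle_apply₂ (F₁ := E3) (F₂ := E3)
    · exact ContMDiffAt.comp_contMDiffWithinAt y g.contMDiff.contMDiffAt (contMDiffOn_chart_symm he y hy)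
    · exact contMDiffOn_coordVec he i y hy
    · exact contMDiffOn_coordVec he j y hy
  simp only [contMDiffWithinAt_totalSpace] at this
  exact this.2

lemma gMat_posDef (he : e ∈ atlas E3 M) {y : E3} (hy : y ∈ e.target) : (gMat g e y).PosDef := by
  have := gramMat_posDef g (coordBasis he (e.map_target hy))
  rwa [coe_coordBasis] at this

lemma gMat_det_pos (he : e ∈ atlas E3 M) {y : E3} (hy : y ∈ e.target) : 0 < (gMat g e y).det :=
  (gMat_posDef g he hy).det_pos

lemma continuousOn_gMat_entry (he : e ∈ atlas E3 M) (i j : Fin 3) :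
    ContinuousOn (fun y => gMat g e y i j) e.target :=
  (contDiffOn_gMat g he i j).continuousOn

lemma continuousOn_gMat (he : e ∈ atlas E3 M) : ContinuousOn (gMat g e) e.target :=
  continuousOn_pi.2 fun i => continuousOn_pi.2 fun j => continuousOn_gMat_entry g he i j

lemma continuousOn_gMat_det (he : e ∈ atlas E3 M) :
    ContinuousOn (fun y => (gMat g e y).det) e.target :=
  continuous_id.matrix_det.comp_continuousOn (continuousOn_gMat g he)

lemma continuousOn_gMat_inv (he : e ∈ atlas E3 M) (i j : Fin 3) :
    ContinuousOn (fun y => (gMat g e y)⁻¹ i j) e.target := by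
  have h : ContinuousOn (fun y => ((gMat g e y).det)⁻¹ * (gMat g e y).adjugate i j) e.target :=
    ((continuousOn_gMat_det g he).inv₀ fun y hy => (gMat_det_pos g he hy).ne').mul
      ((continuous_id.matrix_adjugate.matrix_elem i j).comp_continuousOn (continuousOn_gMat g he))
  refine h.congr fun y _ => ?_
  rw [Matrix.inv_def, Ring.inverse_eq_inv']
  rfl

lemma continuousOn_christoffel (he : e ∈ atlas E3 M) (k i j : Fin 3) :
    ContinuousOn (christoffel g e k i j) e.target := by
  have hd : ∀ l i j, ContinuousOn (dgMat g e l i j) e.target := fun l i j =>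
    ((contDiffOn_gMat g he i j).continuousOn_fderiv_of_isOpen e.open_target (by simp)).clm_apply
      continuousOn_const
  exact continuousOn_const.mul (continuousOn_finsetSum _ fun l _ =>
    (continuousOn_gMat_inv g he k l).mul (((hd i j l).add (hd j i l)).sub (hd l i j)))

lemma christoffel_symm (k i j : Fin 3) (y : E3) :
    christoffel g e k i j y = christoffel g e k j i y := by
  have h : ∀ l i j, dgMat g e l i j y = dgMat g e l j i y := fun l i j => by
    have : (fun z => gMat g e z i j) = fun z => gMat g e z j i :=
      funext fun z => gramMat_symm g _ i j
    rw [dgMat, this]; rfl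
  simp only [christoffel]
  congr 1
  refine Finset.sum_congr rfl fun l _ => ?_
  rw [h l i j]; ring

/-! ### The Riemannian measure in a chart -/

lemma hasFDerivAt_transition (he : e ∈ atlas E3 M) (he' : e' ∈ atlas E3 M) {y : E3}
    (hy : y ∈ e.target) (hy' : e.symm y ∈ e'.source) :
    HasFDerivAt (e' ∘ e.symm) (fderiv ℝ (e' ∘ e.symm) y) y := by
  have : MDifferentiableAt 𝓘(ℝ, E3) 𝓘(ℝ, E3) (e' ∘ e.symm) y :=
    ((mdifferentiable_chart he').mdifferentiableAt hy').comp y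
      ((mdifferentiable_chart he).mdifferentiableAt_symm hy)
  exact this.differentiableAt.hasFDerivAt

/-- The transformation of `√(det g)` under a change of charts, by the Jacobian determinant. -/
lemma sqrt_det_gMat_transition (he : e ∈ atlas E3 M) (he' : e' ∈ atlas E3 M) {y : E3}
    (hy : y ∈ e.target) (hy' : e.symm y ∈ e'.source) :
    √(gMat g e y).det =
      |(fderiv ℝ (e' ∘ e.symm) y).det| * √(gMat g e' ((e' ∘ e.symm) y)).det := by
  have hx := e.map_target hy
  set c := coordBasis he hx
  set c' := coordBasis he' hy'
  have hcomp : fderiv ℝ (e' ∘ e.symm) y =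
      (mfderiv 𝓘(ℝ, E3) 𝓘(ℝ, E3) e' (e.symm y)).comp (mfderiv 𝓘(ℝ, E3) 𝓘(ℝ, E3) e.symm y) := by
    rw [← mfderiv_eq_fderiv]
    exact mfderiv_comp y ((mdifferentiable_chart he').mdifferentiableAt hy')
      ((mdifferentiable_chart he).mdifferentiableAt_symm hy)
  have hQ : (c'.toMatrix c).det = (fderiv ℝ (e' ∘ e.symm) y).det := by
    rw [ContinuousLinearMap.det, ← LinearMap.det_toMatrix (EuclideanSpace.basisFun (Fin 3) ℝ).toBasis]
    congr 1
    ext k i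
    rw [Module.Basis.toMatrix_apply, LinearMap.toMatrix_apply, coe_coordBasis,
      coordVec_eq_mfderiv_symm he hy]
    simp only [OrthonormalBasis.coe_toBasis, EuclideanSpace.basisFun_apply]
    rw [hcomp]
    rfl
  have hG : gMat g e y = (c'.toMatrix c)ᵀ * gMat g e' ((e' ∘ e.symm) y) * c'.toMatrix c := by
    have h := gramMat_basis g c' c
    rw [coe_coordBasis he hx, coe_coordBasis he' hy'] at h
    have h3 : e'.symm ((e' ∘ e.symm) y) = e.symm y := e'.left_inv hy'
    rw [gMat, gMat, h3]
    rw [coe_coordBasis he hx]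
    exact h
  rw [hG, det_mul, det_mul, det_transpose, ← hQ, ← Real.sqrt_sq_eq_abs, ← Real.sqrt_mul (sq_nonneg _)]
  congr 1; ring

section Measure

variable [MeasurableSpace M] [BorelSpace M]

/-- The measure `√(det g) dy` on the target of a chart. -/
def targetVolume (e : OpenPartialHomeomorph M E3) : Measure E3 :=
  (volume.restrict e.target).withDensity fun y => ENNReal.ofReal √(gMat g e y).det

lemma chartVolume_eq_map (e : OpenPartialHomeomorph M E3) :
    chartVolume g e = (targetVolume g e).map e.symm := rfl

lemma targetVolume_ac (e : OpenPartialHomeomorph M E3) :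
    targetVolume g e ≪ volume.restrict e.target := withDensity_absolutelyContinuous _ _

lemma aemeasurable_chart_symm (e : OpenPartialHomeomorph M E3) :
    AEMeasurable e.symm (volume.restrict e.target) :=
  e.continuousOn_symm.aemeasurable e.open_target.measurableSet

lemma aemeasurable_chart_symm' (e : OpenPartialHomeomorph M E3) :
    AEMeasurable e.symm (targetVolume g e) :=
  (aemeasurable_chart_symm e).mono_ac (targetVolume_ac g e)

lemma measurableSet_target_inter_preimage (e : OpenPartialHomeomorph M E3) {S : Set M}
    (hS : MeasurableSet S) : MeasurableSet (e.target ∩ e.symm ⁻¹' S) := by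
  have h : Measurable (e.target.domRestrict e.symm) :=
    (continuousOn_iff_continuous_domRestrict.1 e.continuousOn_symm).measurable
  have := e.open_target.measurableSet.subtype_image (h hS)
  convert this using 1
  ext y
  simp [Set.domRestrict, and_comm]

lemma chartVolume_apply (e : OpenPartialHomeomorph M E3) {S : Set M} (hS : MeasurableSet S) :
    chartVolume g e S =
      ∫⁻ y in e.target ∩ e.symm ⁻¹' S, ENNReal.ofReal √(gMat g e y).det := by
  have hm := measurableSet_target_inter_preimage e hS
  have h0 : targetVolume g e e.targetᶜ = 0 := targetVolume_ac g e (by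
    rw [Measure.restrict_apply e.open_target.measurableSet.compl]; simp)
  rw [chartVolume_eq_map, Measure.map_apply_of_aemeasurable (aemeasurable_chart_symm' g e) hS]
  have h1 : targetVolume g e (e.symm ⁻¹' S) = targetVolume g e (e.target ∩ e.symm ⁻¹' S) := by
    refine le_antisymm ?_ (measure_mono inter_subset_right)
    calc targetVolume g e (e.symm ⁻¹' S)
        ≤ targetVolume g e ((e.target ∩ e.symm ⁻¹' S) ∪ e.targetᶜ) :=
          measure_mono fun y hy => by
            by_cases h : y ∈ e.target
            · exact Or.inl ⟨h, hy⟩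
            · exact Or.inr h
      _ ≤ _ := (measure_union_le _ _).trans (by rw [h0, add_zero])
  rw [h1, targetVolume, withDensity_apply _ hm, Measure.restrict_restrict hm]
  congr 2
  ext y; simp only [mem_inter_iff]; tauto

/-- The measures of two charts agree where both charts are defined. -/
lemma chartVolume_eq_of_subset (he : e ∈ atlas E3 M) (he' : e' ∈ atlas E3 M) {S : Set M}
    (hS : MeasurableSet S) (h : S ⊆ e.source) (h' : S ⊆ e'.source) :
    chartVolume g e S = chartVolume g e' S := by
  rw [chartVolume_apply g e hS, chartVolume_apply g e' hS]
  set U := e.target ∩ e.symm ⁻¹' S with hU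
  have hUm : MeasurableSet U := measurableSet_target_inter_preimage e hS
  have himg : e'.target ∩ e'.symm ⁻¹' S = (e' ∘ e.symm) '' U := by
    ext z
    constructor
    · rintro ⟨hz, hz'⟩
      refine ⟨e (e'.symm z), ⟨e.map_source (h hz'), ?_⟩, ?_⟩
      · show e.symm (e (e'.symm z)) ∈ S
        rw [e.left_inv (h hz')]; exact hz'
      · show e' (e.symm (e (e'.symm z))) = z
        rw [e.left_inv (h hz'), e'.right_inv hz]
    · rintro ⟨y, ⟨hy, hy'⟩, rfl⟩
      refine ⟨e'.map_source (h' hy'), ?_⟩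
      show e'.symm (e' (e.symm y)) ∈ S
      rw [e'.left_inv (h' hy')]; exact hy'
  have hinj : InjOn (e' ∘ e.symm) U := by
    rintro y ⟨hy, hyS⟩ z ⟨hz, hzS⟩ hyz
    exact e.symm.injOn hy hz (e'.injOn (h' hyS) (h' hzS) hyz)
  rw [himg, lintegral_image_eq_lintegral_abs_det_fderiv_mul volume hUm
    (fun y hy => (hasFDerivAt_transition he he' hy.1 (h' hy.2)).hasFDerivWithinAt) hinj]
  refine setLIntegral_congr_fun hUm fun y hy => ?_
  show ENNReal.ofReal √(gMat g e y).det = _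
  rw [sqrt_det_gMat_transition g he he' hy.1 (h' hy.2), ENNReal.ofReal_mul (abs_nonneg _)]

lemma chartVolume_compl_source (e : OpenPartialHomeomorph M E3) :
    chartVolume g e e.sourceᶜ = 0 := by
  rw [chartVolume_apply g e e.open_source.measurableSet.compl]
  have : e.target ∩ e.symm ⁻¹' e.sourceᶜ = ∅ := by
    ext y
    simp only [mem_inter_iff, mem_preimage, mem_compl_iff, mem_empty_iff_false, iff_false, not_and, not_not]
    exact fun hy => e.map_target hy
  rw [this]; simp

lemma chartVolume_inter_source (e : OpenPartialHomeomorph M E3) (S : Set M) :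
    chartVolume g e (S ∩ e.source) = chartVolume g e S := by
  refine le_antisymm (measure_mono inter_subset_left) ?_
  calc chartVolume g e S ≤ chartVolume g e ((S ∩ e.source) ∪ e.sourceᶜ) :=
        measure_mono fun x hx => by
          by_cases h : x ∈ e.source
          · exact Or.inl ⟨hx, h⟩
          · exact Or.inr h
    _ ≤ _ := (measure_union_le _ _).trans (by rw [chartVolume_compl_source, add_zero])

lemma chartVolume_le (he : e ∈ atlas E3 M) : chartVolume g e ≤ riemVolume g :=
  le_iSup₂ (f := fun e (_ : e ∈ atlas E3 M) => chartVolume g e) e he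

/-- In the source of a chart the Riemannian measure is `√(det g) dy`. -/
lemma riemVolume_restrict_source (he : e ∈ atlas E3 M) :
    (riemVolume g).restrict e.source = chartVolume g e := by
  have hsm := e.open_source.measurableSet
  -- `riemVolume g` is the supremum of the measures of all charts, and these agree on overlaps.
  have key : riemVolume g ≤ chartVolume g e + (riemVolume g).restrict e.sourceᶜ := by
    refine iSup₂_le fun e' he' => Measure.le_iff.2 fun S hS => ?_
    rw [Measure.add_apply, Measure.restrict_apply hS]
    have hSs : MeasurableSet (S ∩ e.source ∩ e'.source) :=
      (hS.inter hsm).inter e'.open_source.measurableSet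
    calc chartVolume g e' S = chartVolume g e' (S ∩ e.source) + chartVolume g e' (S \ e.source) :=
          (measure_inter_add_sdiff S hsm).symm
      _ ≤ chartVolume g e S + riemVolume g (S ∩ e.sourceᶜ) := by
          refine add_le_add ?_ (chartVolume_le g he' _)
          rw [← chartVolume_inter_source, ← chartVolume_eq_of_subset g he he' hSs
            (fun x hx => hx.1.2) (fun x hx => hx.2)]
          exact measure_mono fun x hx => hx.1.1
  refine Measure.ext fun S hS => ?_
  rw [Measure.restrict_apply hS]
  refine le_antisymm ?_ ?_
  · refine (key _).trans ?_
    rw [Measure.add_apply, Measure.restrict_apply (hS.inter hsm), chartVolume_inter_source]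
    have : S ∩ e.source ∩ e.sourceᶜ = ∅ := by
      rw [inter_assoc, inter_compl_self, inter_empty]
    rw [this]; simp
  · rw [← chartVolume_inter_source]
    exact chartVolume_le g he _

end Measure

end Charts

/-! ### Transfer between the manifold and its charts -/

section Transfer

variable {M : Type*} [TopologicalSpace M] [ChartedSpace E3 M] [IsManifold 𝓘(ℝ, E3) ∞ M]
  [MeasurableSpace M] [BorelSpace M] {e : OpenPartialHomeomorph M E3} (g : RMetric M)

lemma continuousOn_volumeDensity (he : e ∈ atlas E3 M) :
    ContinuousOn (fun y => √(gMat g e y).det) e.target :=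
  Real.continuous_sqrt.comp_continuousOn (continuousOn_gMat_det g he)

lemma aemeasurable_volumeDensity (he : e ∈ atlas E3 M) :
    AEMeasurable (fun y => ENNReal.ofReal √(gMat g e y).det) (volume.restrict e.target) :=
  ((continuousOn_volumeDensity g he).aemeasurable e.open_target.measurableSet).ennreal_ofReal

lemma map_chart_chartVolume (e : OpenPartialHomeomorph M E3) :
    AEMeasurable e (chartVolume g e) ∧ (chartVolume g e).map e = targetVolume g e := by
  have h0 : ∀ᵐ x ∂(chartVolume g e), x ∈ e.source := by
    rw [ae_iff]; exact chartVolume_compl_source g e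
  have h1 : AEMeasurable e (chartVolume g e) := by
    have : AEMeasurable e ((chartVolume g e).restrict e.source) :=
      e.continuousOn.aemeasurable e.open_source.measurableSet
    rwa [Measure.restrict_eq_self_of_ae_mem h0] at this
  refine ⟨h1, ?_⟩
  have h2 : (fun y => e (e.symm y)) =ᵐ[targetVolume g e] id := by
    refine (targetVolume_ac g e).ae_le ?_
    exact (ae_restrict_iff' e.open_target.measurableSet).2 (ae_of_all _ fun y hy => e.right_inv hy)
  rw [chartVolume_eq_map] at h1 ⊢
  rw [AEMeasurable.map_map_of_aemeasurable h1 (aemeasurable_chart_symm' g e)]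
  exact (Measure.map_congr h2).trans Measure.map_id

lemma ae_chartVolume_of_ae {P : M → Prop}
    (h : ∀ᵐ y ∂(volume.restrict e.target), P (e.symm y)) : ∀ᵐ x ∂(chartVolume g e), P x := by
  have h1 : ∀ᵐ y ∂((chartVolume g e).map e), P (e.symm y) := by
    rw [(map_chart_chartVolume g e).2]; exact (targetVolume_ac g e).ae_le h
  have h0 : ∀ᵐ x ∂(chartVolume g e), x ∈ e.source := by
    rw [ae_iff]; exact chartVolume_compl_source g e
  filter_upwards [ae_of_ae_map (map_chart_chartVolume g e).1 h1, h0] with x hx hx'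
  rwa [e.left_inv hx'] at hx

lemma aestronglyMeasurable_chartVolume {f : M → ℝ}
    (h : AEStronglyMeasurable (fun y => f (e.symm y)) (volume.restrict e.target)) :
    AEStronglyMeasurable f (chartVolume g e) := by
  have h0 : ∀ᵐ x ∂(chartVolume g e), x ∈ e.source := by
    rw [ae_iff]; exact chartVolume_compl_source g e
  have h1 : AEStronglyMeasurable (fun y => f (e.symm y)) ((chartVolume g e).map e) := by
    rw [(map_chart_chartVolume g e).2]; exact h.mono_ac (targetVolume_ac g e)
  refine (h1.comp_aemeasurable (map_chart_chartVolume g e).1).congr ?_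
  filter_upwards [h0] with x hx
  simp only [Function.comp, e.left_inv hx]

variable [CompactSpace M]

omit [IsManifold 𝓘(ℝ, E3) ∞ M] [MeasurableSpace M] [BorelSpace M] in
variable (M) in
/-- Finitely many charts cover a compact manifold. -/
lemma exists_finite_chart_cover :
    ∃ t : Finset M, (⋃ x ∈ t, (chartAt E3 x).source) = univ := by
  obtain ⟨t, ht⟩ := isCompact_univ.elim_finite_subcover (fun x : M => (chartAt E3 x).source)
    (fun x => (chartAt E3 x).open_source) fun x _ => mem_iUnion.2 ⟨x, mem_chart_source E3 x⟩
  exact ⟨t, univ_subset_iff.1 ht⟩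

/-- A property that holds almost everywhere in every chart holds almost everywhere. -/
lemma ae_of_ae_chart {P : M → Prop}
    (h : ∀ e ∈ atlas E3 M, ∀ᵐ y ∂(volume.restrict e.target), P (e.symm y)) :
    ∀ᵐ x ∂(riemVolume g), P x := by
  obtain ⟨t, ht⟩ := exists_finite_chart_cover M
  rw [← Measure.restrict_univ (μ := riemVolume g), ← ht]
  refine (ae_restrict_biUnion_finset_iff _ t _).2 fun x _ => ?_
  rw [riemVolume_restrict_source g (chart_mem_atlas E3 x)]
  exact ae_chartVolume_of_ae g (h _ (chart_mem_atlas E3 x))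

lemma aestronglyMeasurable_of_chart {f : M → ℝ}
    (h : ∀ e ∈ atlas E3 M,
      AEStronglyMeasurable (fun y => f (e.symm y)) (volume.restrict e.target)) :
    AEStronglyMeasurable f (riemVolume g) := by
  obtain ⟨t, ht⟩ := exists_finite_chart_cover M
  have ht' : (⋃ x : t, (chartAt E3 (x : M)).source) = univ := by rw [← ht]; ext; simp
  rw [← Measure.restrict_univ (μ := riemVolume g), ← ht']
  refine (aestronglyMeasurable_iUnion_iff).2 fun x => ?_
  rw [riemVolume_restrict_source g (chart_mem_atlas E3 _)]
  exact aestronglyMeasurable_chartVolume g (h _ (chart_mem_atlas E3 _))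

/-! ### Comparison of norms on compact subsets of charts -/

/-- On compact subsets of a chart the Riemannian measure is comparable to Lebesgue measure. -/
lemma exists_targetVolume_bounds (he : e ∈ atlas E3 M) {K : Set E3} (hK : IsCompact K)
    (hKe : K ⊆ e.target) : ∃ C : ℝ≥0, (targetVolume g e).restrict K ≤ (C : ℝ≥0∞) • volume.restrict K ∧
      volume.restrict K ≤ (C : ℝ≥0∞) • (targetVolume g e).restrict K := by
  have hKm := hK.measurableSet
  have hd : (targetVolume g e).restrict K =
      (volume.restrict K).withDensity fun y => ENNReal.ofReal √(gMat g e y).det := by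
    rw [targetVolume, restrict_withDensity hKm, Measure.restrict_restrict hKm,
      inter_eq_self_of_subset_left hKe]
  have hc := (continuousOn_volumeDensity g he).mono hKe
  have hpos : ∀ y ∈ K, √(gMat g e y).det ≠ 0 := fun y hy =>
    (Real.sqrt_pos.2 (gMat_det_pos g he (hKe hy))).ne'
  obtain ⟨C₁, h1⟩ := hK.exists_bound_of_continuousOn hc
  obtain ⟨C₂, h2⟩ := hK.exists_bound_of_continuousOn (hc.inv₀ hpos)
  refine ⟨(max C₁ C₂).toNNReal, ?_, ?_⟩
  · rw [hd, ← withDensity_const]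
    refine withDensity_mono ((ae_restrict_iff' hKm).2 (ae_of_all _ fun y hy => ?_))
    refine ENNReal.ofReal_le_ofReal ?_
    exact (le_abs_self _).trans ((h1 y hy).trans (le_max_left _ _))
  · rw [hd, ← withDensity_smul']
    · conv_lhs => rw [← withDensity_one (μ := volume.restrict K)]
      refine withDensity_mono ((ae_restrict_iff' hKm).2 (ae_of_all _ fun y hy => ?_))
      have h3 : 1 ≤ max C₁ C₂ * √(gMat g e y).det := by
        have h4 := ((le_abs_self _).trans (h2 y hy)).trans (le_max_right C₁ C₂)
        have h5 := Real.sqrt_pos.2 (gMat_det_pos g he (hKe hy))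
        calc (1 : ℝ) = (√(gMat g e y).det)⁻¹ * √(gMat g e y).det := (inv_mul_cancel₀ h5.ne').symm
          _ ≤ _ := by gcongr; exact h4
      have h6 : ((max C₁ C₂).toNNReal : ℝ≥0∞) = ENNReal.ofReal (max C₁ C₂) := rfl
      simp only [Pi.one_apply, Pi.smul_apply, smul_eq_mul]
      rw [h6]
      have h0 : 0 ≤ max C₁ C₂ := by
        by_contra hneg
        push Not at hneg
        have := mul_nonpos_of_nonpos_of_nonneg hneg.le (Real.sqrt_nonneg (gMat g e y).det)
        linarith
      rw [← ENNReal.ofReal_mul h0, ← ENNReal.ofReal_one]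
      exact ENNReal.ofReal_le_ofReal h3
    · exact ENNReal.coe_ne_top

variable [T2Space M]

lemma riemVolume_restrict_image (he : e ∈ atlas E3 M) {K : Set E3} (hK : IsCompact K)
    (hKe : K ⊆ e.target) :
    (riemVolume g).restrict (e.symm '' K) = ((targetVolume g e).restrict K).map e.symm := by
  have hKc : IsCompact (e.symm '' K) := hK.image_of_continuousOn (e.continuousOn_symm.mono hKe)
  have hsub : e.symm '' K ⊆ e.source := by
    rintro _ ⟨y, hy, rfl⟩; exact e.map_target (hKe hy)
  have h1 : (riemVolume g).restrict (e.symm '' K) = (chartVolume g e).restrict (e.symm '' K) := by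
    rw [← riemVolume_restrict_source g he, Measure.restrict_restrict hKc.measurableSet,
      inter_eq_self_of_subset_left hsub]
  rw [h1, chartVolume_eq_map, Measure.restrict_map_of_aemeasurable (aemeasurable_chart_symm' g e)
    hKc.measurableSet]
  congr 1
  refine Measure.restrict_congr_set ?_
  refine (targetVolume_ac g e).ae_le ?_
  refine (ae_restrict_iff' e.open_target.measurableSet).2 (ae_of_all _ fun y hy => ?_)
  refine propext ⟨?_, fun hyK => ⟨y, hyK, rfl⟩⟩
  rintro ⟨z, hz, hzy⟩
  have : z = y := e.symm.injOn (hKe hz) hy hzy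
  exact this ▸ hz

/-- On a compact subset of a chart, the `L^p` norms with respect to the Riemannian measure and with
respect to Lebesgue measure in coordinates are comparable. -/
lemma exists_eLpNorm_bounds (he : e ∈ atlas E3 M) {K : Set E3} (hK : IsCompact K)
    (hKe : K ⊆ e.target) {p : ℝ≥0∞} (hp : p ≠ ⊤) :
    ∃ C : ℝ≥0, ∀ f : M → ℝ, AEStronglyMeasurable f (riemVolume g) →
      eLpNorm f p ((riemVolume g).restrict (e.symm '' K)) ≤
          C * eLpNorm (fun y => f (e.symm y)) p (volume.restrict K) ∧
        eLpNorm (fun y => f (e.symm y)) p (volume.restrict K) ≤ C * eLpNorm f p (riemVolume g) := by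
  obtain ⟨C, h1, h2⟩ := exists_targetVolume_bounds g he hK hKe
  have hCr : (C : ℝ≥0∞) ^ (1 / p).toReal = ((C ^ (1 / p).toReal : ℝ≥0) : ℝ≥0∞) :=
    ENNReal.coe_rpow_of_nonneg _ ENNReal.toReal_nonneg |>.symm
  refine ⟨C ^ (1 / p).toReal, fun f hf => ?_⟩
  have hm : AEMeasurable e.symm ((targetVolume g e).restrict K) :=
    (aemeasurable_chart_symm' g e).mono_measure Measure.restrict_le_self
  have e1 : eLpNorm f p ((riemVolume g).restrict (e.symm '' K)) =
      eLpNorm (fun y => f (e.symm y)) p ((targetVolume g e).restrict K) := by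
    rw [riemVolume_restrict_image g he hK hKe]
    refine eLpNorm_map_measure ?_ hm
    rw [← riemVolume_restrict_image g he hK hKe]
    exact hf.restrict
  constructor
  · rw [e1]
    refine (eLpNorm_mono_measure _ h1).trans ?_
    rw [eLpNorm_smul_measure_of_ne_top hp, smul_eq_mul, hCr]
  · refine (eLpNorm_mono_measure _ h2).trans ?_
    rw [eLpNorm_smul_measure_of_ne_top hp, smul_eq_mul, hCr, ← e1]
    gcongr
    exact Measure.restrict_le_self

/-- The integral of a function supported in a chart, in coordinates. -/
lemma integral_riemVolume_eq (he : e ∈ atlas E3 M) {f : M → ℝ}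
    (hf : AEStronglyMeasurable f (riemVolume g)) (h0 : ∀ x ∉ e.source, f x = 0) :
    ∫ x, f x ∂(riemVolume g) = ∫ y in e.target, √(gMat g e y).det * f (e.symm y) := by
  have h1 : ∫ x, f x ∂(riemVolume g) = ∫ x in e.source, f x ∂(riemVolume g) :=
    (setIntegral_eq_integral_of_forall_compl_eq_zero h0).symm
  have hf' := hf.restrict (s := e.source)
  rw [h1]
  rw [riemVolume_restrict_source g he, chartVolume_eq_map] at hf' ⊢
  rw [integral_map (aemeasurable_chart_symm' g e) hf', targetVolume,
    integral_withDensity_eq_integral_toReal_smul₀ (aemeasurable_volumeDensity g he)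
      (ae_of_all _ fun _ => ENNReal.ofReal_lt_top)]
  refine integral_congr_ae (ae_of_all _ fun y => ?_)
  simp [ENNReal.toReal_ofReal (Real.sqrt_nonneg _)]

end Transfer

/-! ### Components in a chart -/

section Components

variable {M : Type*} [TopologicalSpace M] [ChartedSpace E3 M] [IsManifold 𝓘(ℝ, E3) ∞ M]
  {e : OpenPartialHomeomorph M E3} (g : RMetric M) {x : M}

lemma suInner_sum_self_le {ι : Type*} (s : Finset ι) (X : ι → su2) :
    suInner (∑ i ∈ s, X i) (∑ i ∈ s, X i) ≤ s.card * ∑ i ∈ s, suInner (X i) (X i) := by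
  have h : ∀ i j, suInner (X i) (X j) ≤ (suInner (X i) (X i) + suInner (X j) (X j)) / 2 := by
    intro i j
    have h := suInner_self_nonneg (X i - X j)
    simp only [← suForm_apply, map_sub, LinearMap.sub_apply] at h ⊢
    have hc : suForm (X j) (X i) = suForm (X i) (X j) := suInner_comm _ _
    linarith
  calc suInner (∑ i ∈ s, X i) (∑ i ∈ s, X i) = ∑ i ∈ s, ∑ j ∈ s, suInner (X i) (X j) := by
        simp only [← suForm_apply, map_sum, LinearMap.sum_apply]
        exact Finset.sum_comm
    _ ≤ ∑ i ∈ s, ∑ j ∈ s, (suInner (X i) (X i) + suInner (X j) (X j)) / 2 :=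
        Finset.sum_le_sum fun i _ => Finset.sum_le_sum fun j _ => h i j
    _ = s.card * ∑ i ∈ s, suInner (X i) (X i) := by
        simp only [← Finset.sum_div, Finset.sum_add_distrib, Finset.sum_const, nsmul_eq_mul,
          ← Finset.mul_sum]
        ring

lemma inner_self_eq_sum_sq {u : Module.Basis (Fin 3) ℝ (TangentSpace 𝓘(ℝ, E3) x)}
    (hu : gramMat g x u = 1) (v : TangentSpace 𝓘(ℝ, E3) x) :
    g.inner x v v = ∑ i, u.repr v i ^ 2 := by
  have h : gForm g x v v = ∑ i, ∑ j, u.repr v i * u.repr v j * gramMat g x u i j := by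
    conv_lhs => rw [← u.sum_repr v]
    simp only [map_sum, map_smul, LinearMap.sum_apply, LinearMap.smul_apply, smul_eq_mul,
      Finset.mul_sum]
    rw [Finset.sum_comm]
    refine Finset.sum_congr rfl fun i _ => Finset.sum_congr rfl fun j _ => ?_
    simp only [gramMat, of_apply, gForm, LinearMap.mk₂_apply]; ring
  rw [show g.inner x v v = gForm g x v v from rfl, h, hu]
  simp [Matrix.one_apply, sq]

lemma suInner_apply_le (a : OneForm M) (v : TangentSpace 𝓘(ℝ, E3) x) :
    suInner (a x v) (a x v) ≤ 3 * g.inner x v v * norm₁ g a x ^ 2 := by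
  obtain ⟨u, hu⟩ := exists_orthonormal g x
  rw [norm₁_sq g a hu, inner_self_eq_sum_sq g hu v]
  conv_lhs => rw [← u.sum_repr v]
  simp only [map_sum, map_smul]
  refine (suInner_sum_self_le _ _).trans ?_
  simp only [Finset.card_univ, Fintype.card_fin, Nat.cast_ofNat, suInner_smul_self]
  rw [mul_assoc]
  gcongr
  rw [Finset.mul_sum]
  refine Finset.sum_le_sum fun i _ => ?_
  gcongr
  · exact suInner_self_nonneg _
  · exact Finset.single_le_sum (f := fun i => u.repr v i ^ 2) (fun i _ => sq_nonneg _) (Finset.mem_univ i)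

lemma suInner_apply₂_le (Ψ : TwoTensor M) (v w : TangentSpace 𝓘(ℝ, E3) x) :
    suInner (Ψ x v w) (Ψ x v w) ≤ 9 * g.inner x v v * g.inner x w w * norm₂ g Ψ x ^ 2 := by
  classical
  obtain ⟨u, hu⟩ := exists_orthonormal g x
  -- Both slots are one-forms when the other is fixed.
  have h1 := suInner_apply_le g (fun y => (Ψ y).flip (if h : x = y then h ▸ w else 0)) v
  have h2 : ∀ i, suInner (Ψ x (u i) w) (Ψ x (u i) w) ≤
      3 * g.inner x w w * ∑ j, suInner (Ψ x (u i) (u j)) (Ψ x (u i) (u j)) := by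
    intro i
    have h := suInner_apply_le g (fun y => Ψ y (if h : x = y then h ▸ (u i) else 0)) w
    rw [norm₁_sq g _ hu] at h
    simpa using h
  rw [norm₁_sq g _ hu] at h1
  simp only [dite_true, LinearMap.flip_apply] at h1
  refine h1.trans ?_
  have hv : 0 ≤ g.inner x v v := by rw [inner_self_eq_sum_sq g hu]; positivity
  rw [norm₂_sq, normSq₂_eq_orthonormal g Ψ hu]
  calc _ ≤ 3 * g.inner x v v * ∑ i, 3 * g.inner x w w * ∑ j, suInner (Ψ x (u i) (u j)) (Ψ x (u i) (u j)) := by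
        gcongr with i _; exact h2 i
    _ = _ := by rw [← Finset.mul_sum]; ring

lemma norm_entry_sq_le (X : su2) (r s : Fin 2) :
    ‖(X : Matrix (Fin 2) (Fin 2) ℂ) r s‖ ^ 2 ≤ suInner X X := by
  rw [suInner_self]
  exact (Finset.single_le_sum (f := fun s => ‖(X : Matrix (Fin 2) (Fin 2) ℂ) r s‖ ^ 2)
    (fun _ _ => by positivity) (Finset.mem_univ s)).trans
    (Finset.single_le_sum (f := fun r => ∑ s, ‖(X : Matrix (Fin 2) (Fin 2) ℂ) r s‖ ^ 2)
    (fun _ _ => by positivity) (Finset.mem_univ r))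

lemma abs_suInner_le_entries (X Y : su2) : |suInner X Y| ≤
    (∑ r, ∑ s, ‖(X : Matrix (Fin 2) (Fin 2) ℂ) r s‖) *
      ∑ r, ∑ s, ‖(Y : Matrix (Fin 2) (Fin 2) ℂ) r s‖ := by
  have h : ∀ Z : su2, suInner Z Z ≤ (∑ r, ∑ s, ‖(Z : Matrix (Fin 2) (Fin 2) ℂ) r s‖) ^ 2 := by
    intro Z
    rw [suInner_self]
    simp only [Fin.sum_univ_two]
    nlinarith [norm_nonneg ((Z : Matrix (Fin 2) (Fin 2) ℂ) 0 0), norm_nonneg ((Z : Matrix (Fin 2) (Fin 2) ℂ) 0 1),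
      norm_nonneg ((Z : Matrix (Fin 2) (Fin 2) ℂ) 1 0), norm_nonneg ((Z : Matrix (Fin 2) (Fin 2) ℂ) 1 1),
      mul_nonneg (norm_nonneg ((Z : Matrix (Fin 2) (Fin 2) ℂ) 0 0)) (norm_nonneg ((Z : Matrix (Fin 2) (Fin 2) ℂ) 0 1)),
      mul_nonneg (norm_nonneg ((Z : Matrix (Fin 2) (Fin 2) ℂ) 0 0)) (norm_nonneg ((Z : Matrix (Fin 2) (Fin 2) ℂ) 1 0)),
      mul_nonneg (norm_nonneg ((Z : Matrix (Fin 2) (Fin 2) ℂ) 0 0)) (norm_nonneg ((Z : Matrix (Fin 2) (Fin 2) ℂ) 1 1)),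
      mul_nonneg (norm_nonneg ((Z : Matrix (Fin 2) (Fin 2) ℂ) 0 1)) (norm_nonneg ((Z : Matrix (Fin 2) (Fin 2) ℂ) 1 0)),
      mul_nonneg (norm_nonneg ((Z : Matrix (Fin 2) (Fin 2) ℂ) 0 1)) (norm_nonneg ((Z : Matrix (Fin 2) (Fin 2) ℂ) 1 1)),
      mul_nonneg (norm_nonneg ((Z : Matrix (Fin 2) (Fin 2) ℂ) 1 0)) (norm_nonneg ((Z : Matrix (Fin 2) (Fin 2) ℂ) 1 1))]
  refine abs_le_of_sq_le_sq ?_ (by positivity)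
  rw [mul_pow]
  exact (suInner_sq_le X Y).trans (mul_le_mul (h X) (h Y) (suInner_self_nonneg Y) (by positivity))

lemma norm₁_chart (he : e ∈ atlas E3 M) (a : OneForm M) {y : E3} (hy : y ∈ e.target) :
    norm₁ g a (e.symm y) = √(∑ i, ∑ j, (gMat g e y)⁻¹ i j *
      suInner (a (e.symm y) (coordVec e (e.symm y) i)) (a (e.symm y) (coordVec e (e.symm y) j))) := by
  have := norm₁_eq_basis g a (coordBasis he (e.map_target hy))
  rwa [coe_coordBasis] at this

lemma normSq₂_chart (he : e ∈ atlas E3 M) (Ψ : TwoTensor M) {y : E3} (hy : y ∈ e.target) :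
    normSq₂ g Ψ (e.symm y) = ∑ i, ∑ j, ∑ k, ∑ l, (gMat g e y)⁻¹ i k * (gMat g e y)⁻¹ j l *
      suInner (Ψ (e.symm y) (coordVec e (e.symm y) i) (coordVec e (e.symm y) j))
        (Ψ (e.symm y) (coordVec e (e.symm y) k) (coordVec e (e.symm y) l)) := by
  have := normSq₂_eq_basis g Ψ (coordBasis he (e.map_target hy))
  rwa [coe_coordBasis] at this

/-- On a compact subset of a chart the pointwise norms are comparable to the sizes of the
components, and the Christoffel symbols are bounded. -/
lemma exists_component_bounds (he : e ∈ atlas E3 M) {K : Set E3} (hK : IsCompact K)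
    (hKe : K ⊆ e.target) : ∃ C : ℝ≥0, ∀ y ∈ K,
      (∀ (a : OneForm M) (i : Fin 3) (r s : Fin 2), ‖oneComp e a i y r s‖ ≤ C * norm₁ g a (e.symm y)) ∧
      (∀ a : OneForm M, norm₁ g a (e.symm y) ≤ C * ∑ i, ∑ r, ∑ s, ‖oneComp e a i y r s‖) ∧
      (∀ (Ψ : TwoTensor M) (i j : Fin 3) (r s : Fin 2),
        ‖twoComp e Ψ i j y r s‖ ≤ C * norm₂ g Ψ (e.symm y)) ∧
      ∀ k i j, |christoffel g e k i j y| ≤ C := by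
  have hb : ∀ f : E3 → ℝ, ContinuousOn f e.target → ∃ C : ℝ, ∀ y ∈ K, |f y| ≤ C := fun f hf =>
    hK.exists_bound_of_continuousOn (hf.mono hKe)
  choose C₁ h1 using fun i => hb _ (continuousOn_gMat_entry g he i i)
  obtain ⟨C₂, h2⟩ := hb (fun y => ∑ i, ∑ j, |(gMat g e y)⁻¹ i j|)
    (continuousOn_finsetSum _ fun i _ => continuousOn_finsetSum _ fun j _ =>
      (continuousOn_gMat_inv g he i j).abs)
  choose C₃ h3 using fun k i j => hb _ (continuousOn_christoffel g he k i j)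
  set S : ℝ := 1 + ∑ i, |C₁ i| with hS
  set T : ℝ := 3 * S + |C₂| + ∑ k, ∑ i, ∑ j, |C₃ k i j| + 1 with hT
  have hS1 : 1 ≤ S := by rw [hS]; linarith [Finset.sum_nonneg (s := Finset.univ) fun i _ => abs_nonneg (C₁ i)]
  have hsum3 : 0 ≤ ∑ k, ∑ i, ∑ j, |C₃ k i j| := by positivity
  have hT0 : 0 ≤ T := by positivity
  refine ⟨T.toNNReal, fun y hy => ?_⟩
  rw [Real.coe_toNNReal _ hT0]
  have hyt := hKe hy
  have hgi : ∀ i, g.inner (e.symm y) (coordVec e (e.symm y) i) (coordVec e (e.symm y) i) ≤ S := by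
    intro i
    have h4 : gMat g e y i i ≤ |C₁ i| := (le_abs_self _).trans ((h1 i y hy).trans (le_abs_self _))
    have h5 : |C₁ i| ≤ ∑ i, |C₁ i| :=
      Finset.single_le_sum (f := fun i => |C₁ i|) (fun _ _ => abs_nonneg _) (Finset.mem_univ i)
    exact h4.trans (by linarith)
  have hST : 3 * S ≤ T := by
    have := abs_nonneg C₂
    rw [hT]; linarith
  have hg0 : ∀ i, 0 ≤ g.inner (e.symm y) (coordVec e (e.symm y) i) (coordVec e (e.symm y) i) := by
    intro i
    obtain ⟨u, hu⟩ := exists_orthonormal g (e.symm y)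
    rw [inner_self_eq_sum_sq g hu]; positivity
  refine ⟨fun a i r s => ?_, fun a => ?_, fun Ψ i j r s => ?_, fun k i j => ?_⟩
  · refine le_of_sq_bound (mul_nonneg hT0 (norm₁_nonneg g a)) ?_
    refine ((norm_entry_sq_le _ r s).trans (suInner_apply_le g a _)).trans ?_
    rw [mul_pow]
    gcongr
    nlinarith [hgi i]
  · rw [norm₁_chart g he a hyt]
    refine Real.sqrt_le_left (by positivity) |>.2 ?_ 
    set N := ∑ i, ∑ r, ∑ s, ‖oneComp e a i y r s‖ with hN
    have hN0 : 0 ≤ N := by positivity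
    have hNi : ∀ i, ∑ r, ∑ s, ‖oneComp e a i y r s‖ ≤ N := fun i =>
      Finset.single_le_sum (f := fun i => ∑ r, ∑ s, ‖oneComp e a i y r s‖)
        (fun _ _ => by positivity) (Finset.mem_univ i)
    have h6 : ∀ i j, (gMat g e y)⁻¹ i j *
        suInner (a (e.symm y) (coordVec e (e.symm y) i)) (a (e.symm y) (coordVec e (e.symm y) j)) ≤
        |(gMat g e y)⁻¹ i j| * N ^ 2 := by
      intro i j
      refine (le_abs_self _).trans ?_
      rw [abs_mul]
      gcongr
      refine (abs_suInner_le_entries _ _).trans ?_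
      rw [sq]
      exact mul_le_mul (hNi i) (hNi j) (by positivity) hN0
    calc _ ≤ ∑ i, ∑ j, |(gMat g e y)⁻¹ i j| * N ^ 2 :=
          Finset.sum_le_sum fun i _ => Finset.sum_le_sum fun j _ => h6 i j
      _ = (∑ i, ∑ j, |(gMat g e y)⁻¹ i j|) * N ^ 2 := by simp only [Finset.sum_mul]
      _ ≤ T ^ 2 * N ^ 2 := by
          gcongr
          have h7 := (le_abs_self _).trans ((h2 y hy).trans (le_abs_self _))
          have : 1 ≤ T := by linarith
          calc _ ≤ |C₂| := h7
            _ ≤ T := by rw [hT]; linarith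
            _ ≤ T ^ 2 := by nlinarith
      _ = _ := by ring
  · refine le_of_sq_bound (mul_nonneg hT0 (norm₂_nonneg g Ψ)) ?_
    refine ((norm_entry_sq_le _ r s).trans (suInner_apply₂_le g Ψ _ _)).trans ?_
    rw [mul_pow]
    gcongr
    have := mul_le_mul (hgi i) (hgi j) (hg0 j) (by linarith)
    nlinarith
  · have h4 : |C₃ k i j| ≤ ∑ k, ∑ i, ∑ j, |C₃ k i j| :=
      ((Finset.single_le_sum (f := fun j => |C₃ k i j|) (fun _ _ => abs_nonneg _) (Finset.mem_univ j)).trans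
      (Finset.single_le_sum (f := fun i => ∑ j, |C₃ k i j|) (fun _ _ => by positivity) (Finset.mem_univ i))).trans
      (Finset.single_le_sum (f := fun k => ∑ i, ∑ j, |C₃ k i j|) (fun _ _ => by positivity) (Finset.mem_univ k))
    have := abs_nonneg C₂
    calc _ ≤ |C₃ k i j| := (h3 k i j y hy).trans (le_abs_self _)
      _ ≤ T := by rw [hT]; linarith

/-! ### Measurability -/

/-- The components of the one-form are measurable in every chart. -/
def MeasComp₁ (a : OneForm M) : Prop := ∀ e ∈ atlas E3 M, ∀ i r s,
  AEStronglyMeasurable (fun y => oneComp e a i y r s) (volume.restrict e.target)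

/-- The components of the two-tensor are measurable in every chart. -/
def MeasComp₂ (Ψ : TwoTensor M) : Prop := ∀ e ∈ atlas E3 M, ∀ i j r s,
  AEStronglyMeasurable (fun y => twoComp e Ψ i j y r s) (volume.restrict e.target)

lemma aestronglyMeasurable_gMat_inv (he : e ∈ atlas E3 M) (i j : Fin 3) :
    AEStronglyMeasurable (fun y => (gMat g e y)⁻¹ i j) (volume.restrict e.target) :=
  (continuousOn_gMat_inv g he i j).aestronglyMeasurable e.open_target.measurableSet

lemma aestronglyMeasurable_suInner {μ : Measure E3} {X Y : E3 → su2}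
    (hX : ∀ r s, AEStronglyMeasurable (fun y => (X y : Matrix (Fin 2) (Fin 2) ℂ) r s) μ)
    (hY : ∀ r s, AEStronglyMeasurable (fun y => (Y y : Matrix (Fin 2) (Fin 2) ℂ) r s) μ) :
    AEStronglyMeasurable (fun y => suInner (X y) (Y y)) μ := by
  simp only [suInner_eq_sum]
  refine Finset.aestronglyMeasurable_fun_sum _ fun r _ => Finset.aestronglyMeasurable_fun_sum _ fun s _ => ?_
  exact Complex.continuous_re.comp_aestronglyMeasurable
    ((Complex.continuous_conj.comp_aestronglyMeasurable (hX r s)).mul (hY r s))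

lemma MeasComp₁.norm₁_chart {a : OneForm M} (ha : MeasComp₁ a) (he : e ∈ atlas E3 M) :
    AEStronglyMeasurable (fun y => norm₁ g a (e.symm y)) (volume.restrict e.target) := by
  have h : AEStronglyMeasurable (fun y => √(∑ i, ∑ j, (gMat g e y)⁻¹ i j *
      suInner (a (e.symm y) (coordVec e (e.symm y) i)) (a (e.symm y) (coordVec e (e.symm y) j))))
      (volume.restrict e.target) :=
    Real.continuous_sqrt.comp_aestronglyMeasurable
      (Finset.aestronglyMeasurable_fun_sum _ fun i _ => Finset.aestronglyMeasurable_fun_sum _ fun j _ =>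
        (aestronglyMeasurable_gMat_inv g he i j).mul
          (aestronglyMeasurable_suInner (fun r s => ha e he i r s) (fun r s => ha e he j r s)))
  refine h.congr ((ae_restrict_iff' e.open_target.measurableSet).2 (ae_of_all _ fun y hy => ?_))
  exact (CSBound.norm₁_chart g he a hy).symm

lemma MeasComp₂.normSq₂_chart {Ψ : TwoTensor M} (hΨ : MeasComp₂ Ψ) (he : e ∈ atlas E3 M) :
    AEStronglyMeasurable (fun y => normSq₂ g Ψ (e.symm y)) (volume.restrict e.target) := by
  have h : AEStronglyMeasurable (fun y => ∑ i, ∑ j, ∑ k, ∑ l, (gMat g e y)⁻¹ i k * (gMat g e y)⁻¹ j l *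
      suInner (Ψ (e.symm y) (coordVec e (e.symm y) i) (coordVec e (e.symm y) j))
        (Ψ (e.symm y) (coordVec e (e.symm y) k) (coordVec e (e.symm y) l)))
      (volume.restrict e.target) :=
    (Finset.aestronglyMeasurable_fun_sum _ fun i _ => Finset.aestronglyMeasurable_fun_sum _ fun j _ =>
      Finset.aestronglyMeasurable_fun_sum _ fun k _ => Finset.aestronglyMeasurable_fun_sum _ fun l _ =>
        ((aestronglyMeasurable_gMat_inv g he i k).mul (aestronglyMeasurable_gMat_inv g he j l)).mul
          (aestronglyMeasurable_suInner (fun r s => hΨ e he i j r s) (fun r s => hΨ e he k l r s)))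
  refine h.congr ((ae_restrict_iff' e.open_target.measurableSet).2 (ae_of_all _ fun y hy => ?_))
  exact (CSBound.normSq₂_chart g he Ψ hy).symm

variable [MeasurableSpace M] [BorelSpace M] [CompactSpace M]

lemma MeasComp₁.norm₁ {a : OneForm M} (ha : MeasComp₁ a) :
    AEStronglyMeasurable (norm₁ g a) (riemVolume g) :=
  aestronglyMeasurable_of_chart g fun _ he => ha.norm₁_chart g he

lemma MeasComp₂.norm₂ {Ψ : TwoTensor M} (hΨ : MeasComp₂ Ψ) :
    AEStronglyMeasurable (norm₂ g Ψ) (riemVolume g) :=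
  aestronglyMeasurable_of_chart g fun _ he =>
    Real.continuous_sqrt.comp_aestronglyMeasurable (hΨ.normSq₂_chart g he)

lemma MeasComp₂.normForm₂ {Ψ : TwoTensor M} (hΨ : MeasComp₂ Ψ) :
    AEStronglyMeasurable (normForm₂ g Ψ) (riemVolume g) :=
  aestronglyMeasurable_of_chart g fun _ he =>
    (Real.continuous_sqrt.comp (continuous_id.div_const 2)).comp_aestronglyMeasurable
      (hΨ.normSq₂_chart g he)

lemma MeasComp₁.sub {a b : OneForm M} (ha : MeasComp₁ a) (hb : MeasComp₁ b) :
    MeasComp₁ (a - b) := fun e he i r s => (ha e he i r s).sub (hb e he i r s)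

lemma MeasComp₂.sub {a b : TwoTensor M} (ha : MeasComp₂ a) (hb : MeasComp₂ b) :
    MeasComp₂ (a - b) := fun e he i j r s => (ha e he i j r s).sub (hb e he i j r s)

lemma MeasComp₂.add {a b : TwoTensor M} (ha : MeasComp₂ a) (hb : MeasComp₂ b) :
    MeasComp₂ (a + b) := fun e he i j r s => (ha e he i j r s).add (hb e he i j r s)

lemma MeasComp₁.lieTensor {a b : OneForm M} (ha : MeasComp₁ a) (hb : MeasComp₁ b) :
    MeasComp₂ (lieTensor a b) := fun e he i j r s => by
  have : (fun y => twoComp e (CSBound.lieTensor a b) i j y r s) = fun y =>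
      (∑ k, oneComp e a i y r k * oneComp e b j y k s) - ∑ k, oneComp e b j y r k * oneComp e a i y k s := by
    ext y
    show (oneComp e a i y * oneComp e b j y - oneComp e b j y * oneComp e a i y) r s = _
    rw [Matrix.sub_apply, Matrix.mul_apply, Matrix.mul_apply]
  rw [this]
  exact (Finset.aestronglyMeasurable_fun_sum _ fun k _ => (ha e he i r k).mul (hb e he j k s)).sub
    (Finset.aestronglyMeasurable_fun_sum _ fun k _ => (hb e he j r k).mul (ha e he i k s))

end Components

/-! ### Weak covariant and exterior derivatives -/

section WeakDerivatives

variable {M : Type*} [TopologicalSpace M] [ChartedSpace E3 M] [IsManifold 𝓘(ℝ, E3) ∞ M]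
  {e : OpenPartialHomeomorph M E3} {g : RMetric M} {B a b : OneForm M} {Ψ Φ η : TwoTensor M}

lemma IsWeakPartial.aestronglyMeasurable {Ω : Set E3} {i : Fin 3}
    {f h : E3 → Matrix (Fin 2) (Fin 2) ℂ} (H : IsWeakPartial Ω i f h) (r s : Fin 2) :
    AEStronglyMeasurable (fun y => f y r s) (volume.restrict Ω) ∧
      AEStronglyMeasurable (fun y => h y r s) (volume.restrict Ω) :=
  ⟨(H r s).1.aestronglyMeasurable, (H r s).2.1.aestronglyMeasurable⟩

lemma IsWeakPartial.sub {Ω : Set E3} {i : Fin 3} {f h f' h' : E3 → Matrix (Fin 2) (Fin 2) ℂ}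
    (H : IsWeakPartial Ω i f h) (H' : IsWeakPartial Ω i f' h') :
    IsWeakPartial Ω i (fun y => f y - f' y) (fun y => h y - h' y) :=
  fun r s => WeakPartial.sub (H r s) (H' r s)

lemma IsWeakPartial.ae_unique {Ω : Set E3} (hΩ : IsOpen Ω) {i : Fin 3}
    {f h h' : E3 → Matrix (Fin 2) (Fin 2) ℂ} (H : IsWeakPartial Ω i f h)
    (H' : IsWeakPartial Ω i f h') : ∀ᵐ y ∂(volume.restrict Ω), h y = h' y := by
  have h1 : ∀ᵐ y ∂(volume.restrict Ω), ∀ r s, h y r s = h' y r s :=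
    ae_all_iff.2 fun r => ae_all_iff.2 fun s => WeakPartial.ae_unique hΩ (H r s) (H' r s)
  filter_upwards [h1] with y hy
  ext r s; exact hy r s

lemma oneComp_sub (e : OpenPartialHomeomorph M E3) (a b : OneForm M) (i : Fin 3) (y : E3) :
    oneComp e (a - b) i y = oneComp e a i y - oneComp e b i y := rfl

lemma twoComp_sub (e : OpenPartialHomeomorph M E3) (Ψ Φ : TwoTensor M) (i j : Fin 3) (y : E3) :
    twoComp e (Ψ - Φ) i j y = twoComp e Ψ i j y - twoComp e Φ i j y := rfl

lemma twoComp_add (e : OpenPartialHomeomorph M E3) (Ψ Φ : TwoTensor M) (i j : Fin 3) (y : E3) :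
    twoComp e (Ψ + Φ) i j y = twoComp e Ψ i j y + twoComp e Φ i j y := rfl

lemma twoComp_lieTensor (e : OpenPartialHomeomorph M E3) (B a : OneForm M) (i j : Fin 3) (y : E3) :
    twoComp e (lieTensor B a) i j y = ⁅oneComp e B i y, oneComp e a j y⁆ := rfl

lemma twoComp_altTensor (e : OpenPartialHomeomorph M E3) (Ψ : TwoTensor M) (i j : Fin 3) (y : E3) :
    twoComp e (altTensor Ψ) i j y = twoComp e Ψ i j y - twoComp e Ψ j i y := rfl

lemma oneComp_zero (e : OpenPartialHomeomorph M E3) (i : Fin 3) (y : E3) :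
    oneComp e (0 : OneForm M) i y = 0 := rfl

lemma IsWeakCovDeriv.measComp₁ (H : IsWeakCovDeriv g B a Ψ) : MeasComp₁ a := fun e he i r s => by
  obtain ⟨h, h1, -⟩ := H e he
  exact ((h1 0 i).aestronglyMeasurable r s).1

lemma aestronglyMeasurable_christoffel (he : e ∈ atlas E3 M) (k i j : Fin 3) :
    AEStronglyMeasurable (christoffel g e k i j) (volume.restrict e.target) :=
  (continuousOn_christoffel g he k i j).aestronglyMeasurable e.open_target.measurableSet

lemma IsWeakCovDeriv.measComp₂ (H : IsWeakCovDeriv g 0 a Ψ) : MeasComp₂ Ψ := fun e he i j r s => by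
  have ha := H.measComp₁
  obtain ⟨h, h1, h2⟩ := H e he
  have h3 : AEStronglyMeasurable (fun y => h i j y r s -
      ∑ k, christoffel g e k i j y • oneComp e a k y r s) (volume.restrict e.target) :=
    ((h1 i j).aestronglyMeasurable r s).2.sub
      (Finset.aestronglyMeasurable_fun_sum _ fun k _ =>
        (aestronglyMeasurable_christoffel he k i j).smul (ha e he k r s))
  refine h3.congr ?_
  filter_upwards [h2] with y hy
  rw [hy i j, oneComp_zero, zero_lie, add_zero, Matrix.sub_apply, Matrix.sum_apply]
  simp only [Matrix.smul_apply]

lemma IsWeakCovDeriv.sub (H : IsWeakCovDeriv g B a Ψ) (H' : IsWeakCovDeriv g B b Φ) :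
    IsWeakCovDeriv g B (a - b) (Ψ - Φ) := fun e he => by
  obtain ⟨h, h1, h2⟩ := H e he
  obtain ⟨h', h1', h2'⟩ := H' e he
  refine ⟨fun i j y => h i j y - h' i j y, fun i j => (h1 i j).sub (h1' i j), ?_⟩
  filter_upwards [h2, h2'] with y hy hy' i j
  rw [twoComp_sub, hy i j, hy' i j]
  simp only [oneComp_sub, smul_sub, Finset.sum_sub_distrib, lie_sub]
  abel

lemma IsWeakCovDeriv.add_lieTensor (H : IsWeakCovDeriv g 0 a Ψ) (B : OneForm M) :
    IsWeakCovDeriv g B a (Ψ + lieTensor B a) := fun e he => by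
  obtain ⟨h, h1, h2⟩ := H e he
  refine ⟨h, h1, ?_⟩
  filter_upwards [h2] with y hy i j
  rw [twoComp_add, hy i j, twoComp_lieTensor, oneComp_zero, zero_lie, add_zero]

lemma IsWeakCovDeriv.sub_lieTensor (H : IsWeakCovDeriv g B a Ψ) :
    IsWeakCovDeriv g 0 a (Ψ - lieTensor B a) := fun e he => by
  obtain ⟨h, h1, h2⟩ := H e he
  refine ⟨h, h1, ?_⟩
  filter_upwards [h2] with y hy i j
  rw [twoComp_sub, hy i j, twoComp_lieTensor, oneComp_zero, zero_lie]
  abel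

/-- The exterior derivative is the skew part of the covariant derivative, because the Levi-Civita
connection is torsion free. -/
lemma IsWeakCovDeriv.isWeakExtDeriv (H : IsWeakCovDeriv g 0 a Ψ) :
    IsWeakExtDeriv a (altTensor Ψ) := fun e he => by
  obtain ⟨h, h1, h2⟩ := H e he
  refine ⟨h, h1, ?_⟩
  filter_upwards [h2] with y hy i j
  rw [twoComp_altTensor, hy i j, hy j i]
  simp only [christoffel_symm g _ i j, oneComp_zero, zero_lie]
  abel

lemma twoTensor_ext_of_comp (he : e ∈ atlas E3 M) {y : E3} (hy : y ∈ e.target)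
    (h : ∀ i j, twoComp e Ψ i j y = twoComp e Φ i j y) : Ψ (e.symm y) = Φ (e.symm y) := by
  refine (coordBasis he (e.map_target hy)).ext fun i => (coordBasis he (e.map_target hy)).ext fun j => ?_
  rw [coe_coordBasis]
  exact Subtype.ext (h i j)

variable [MeasurableSpace M] [BorelSpace M] [CompactSpace M]

/-- Weak covariant derivatives are unique up to null sets. -/
lemma IsWeakCovDeriv.ae_unique (H : IsWeakCovDeriv g B a Ψ) (H' : IsWeakCovDeriv g B a Φ) :
    ∀ᵐ x ∂(riemVolume g), Ψ x = Φ x := by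
  refine ae_of_ae_chart g fun e he => ?_
  obtain ⟨h, h1, h2⟩ := H e he
  obtain ⟨h', h1', h2'⟩ := H' e he
  have h3 : ∀ᵐ y ∂(volume.restrict e.target), ∀ i j, h i j y = h' i j y :=
    ae_all_iff.2 fun i => ae_all_iff.2 fun j => (h1 i j).ae_unique e.open_target (h1' i j)
  filter_upwards [h2, h2', h3, ae_restrict_mem e.open_target.measurableSet] with y hy hy' hh hyt
  refine twoTensor_ext_of_comp he hyt fun i j => ?_
  rw [hy, hy', hh]

/-- Weak exterior derivatives are unique up to null sets. -/
lemma IsWeakExtDeriv.ae_unique (g : RMetric M) (H : IsWeakExtDeriv a Ψ) (H' : IsWeakExtDeriv a Φ) :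
    ∀ᵐ x ∂(riemVolume g), Ψ x = Φ x := by
  refine ae_of_ae_chart g fun e he => ?_
  obtain ⟨h, h1, h2⟩ := H e he
  obtain ⟨h', h1', h2'⟩ := H' e he
  have h3 : ∀ᵐ y ∂(volume.restrict e.target), ∀ i j, h i j y = h' i j y :=
    ae_all_iff.2 fun i => ae_all_iff.2 fun j => (h1 i j).ae_unique e.open_target (h1' i j)
  filter_upwards [h2, h2', h3, ae_restrict_mem e.open_target.measurableSet] with y hy hy' hh hyt
  refine twoTensor_ext_of_comp he hyt fun i j => ?_
  rw [hy, hy', hh, hh]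

lemma isWeakExtDeriv_weakExtDeriv (H : IsWeakExtDeriv a η) : IsWeakExtDeriv a (weakExtDeriv a) := by
  rw [weakExtDeriv, dif_pos ⟨η, H⟩]
  exact Exists.choose_spec (⟨η, H⟩ : ∃ η : TwoTensor M, IsWeakExtDeriv a η)

lemma IsWeakCovDeriv.weakExtDeriv_ae_eq (H : IsWeakCovDeriv g 0 a Ψ) :
    ∀ᵐ x ∂(riemVolume g), weakExtDeriv a x = altTensor Ψ x :=
  (isWeakExtDeriv_weakExtDeriv H.isWeakExtDeriv).ae_unique g H.isWeakExtDeriv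

lemma norm₂_congr {x : M} (h : Ψ x = Φ x) : norm₂ g Ψ x = norm₂ g Φ x := by
  simp only [norm₂, normSq₂, h]

lemma normForm₂_congr {x : M} (h : Ψ x = Φ x) : normForm₂ g Ψ x = normForm₂ g Φ x := by
  simp only [normForm₂, normSq₂, h]

/-- The Sobolev norm may be evaluated with any weak covariant derivative. -/
lemma IsWeakCovDeriv.sobolevNorm_eq (H : IsWeakCovDeriv g B a Ψ) (p : ℝ≥0∞) :
    sobolevNorm g B p a = (eLpNorm (norm₁ g a) p (riemVolume g) ^ p.toReal +
      eLpNorm (norm₂ g Ψ) p (riemVolume g) ^ p.toReal) ^ (1 / p.toReal) := by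
  refine le_antisymm (iInf₂_le Ψ H) (le_iInf₂ fun Φ HΦ => le_of_eq ?_)
  rw [eLpNorm_congr_ae ((H.ae_unique HΦ).mono fun x hx => norm₂_congr hx)]

lemma IsWeakCovDeriv.eLpNorm_le_sobolevNorm (H : IsWeakCovDeriv g B a Ψ) {p : ℝ≥0∞} (hp : p ≠ 0)
    (hp' : p ≠ ⊤) : eLpNorm (CSBound.norm₁ g a) p (riemVolume g) ≤ sobolevNorm g B p a ∧
      eLpNorm (CSBound.norm₂ g Ψ) p (riemVolume g) ≤ sobolevNorm g B p a := by
  have h0 : 0 < p.toReal := ENNReal.toReal_pos hp hp'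
  have key : ∀ x z : ℝ≥0∞, x ^ p.toReal ≤ z → x ≤ z ^ (1 / p.toReal) := fun x z h => by
    rw [one_div]; exact (ENNReal.le_rpow_inv_iff h0).2 h
  rw [H.sobolevNorm_eq]
  exact ⟨key _ _ le_self_add, key _ _ le_add_self⟩

lemma IsWeakCovDeriv.sobolevNorm_ne_top (H : IsWeakCovDeriv g B a Ψ) {p : ℝ≥0∞}
    (h1 : eLpNorm (CSBound.norm₁ g a) p (riemVolume g) ≠ ⊤)
    (h2 : eLpNorm (CSBound.norm₂ g Ψ) p (riemVolume g) ≠ ⊤) : sobolevNorm g B p a ≠ ⊤ := by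
  rw [H.sobolevNorm_eq]
  exact ENNReal.rpow_ne_top_of_nonneg (by positivity) (ENNReal.add_ne_top.2
    ⟨ENNReal.rpow_ne_top_of_nonneg ENNReal.toReal_nonneg h1,
      ENNReal.rpow_ne_top_of_nonneg ENNReal.toReal_nonneg h2⟩)

end WeakDerivatives

/-! ### Smooth partitions of unity subordinate to charts -/

section Partition

variable {M : Type*} [TopologicalSpace M] [ChartedSpace E3 M] [IsManifold 𝓘(ℝ, E3) ∞ M]
  {e : OpenPartialHomeomorph M E3}

/-- A function that is smooth on the target of a chart and vanishes off a compact set extends by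
zero to a test function. -/
lemma testFunction_indicator (e : OpenPartialHomeomorph M E3) {f : E3 → ℝ} {K : Set E3}
    (hK : IsCompact K) (hKe : K ⊆ e.target) (hf : ContDiffOn ℝ ∞ f e.target)
    (h0 : ∀ y ∈ e.target, y ∉ K → f y = 0) :
    ContDiff ℝ ∞ (e.target.indicator f) ∧ HasCompactSupport (e.target.indicator f) ∧
      tsupport (e.target.indicator f) ⊆ K := by
  have hsupp : Function.support (e.target.indicator f) ⊆ K := by
    intro y hy
    by_contra hyK
    refine hy ?_
    by_cases h : y ∈ e.target
    · rw [indicator_of_mem h, h0 y h hyK]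
    · exact indicator_of_notMem h f
  have hts : tsupport (e.target.indicator f) ⊆ K := closure_minimal hsupp hK.isClosed
  refine ⟨?_, HasCompactSupport.of_support_subset_isCompact hK hsupp, hts⟩
  refine contDiff_iff_contDiffAt.2 fun y => ?_
  by_cases hy : y ∈ tsupport (e.target.indicator f)
  swap
  · exact contDiffAt_const.congr_of_eventuallyEq (notMem_tsupport_iff_eventuallyEq.1 hy)
  have hyt := hKe (hts hy)
  refine (hf.contDiffAt (e.open_target.mem_nhds hyt)).congr_of_eventuallyEq ?_
  filter_upwards [e.open_target.mem_nhds hyt] with z hz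
  exact indicator_of_mem hz f

lemma contDiffOn_comp_chart_symm (he : e ∈ atlas E3 M) {χ : M → ℝ}
    (hχ : ContMDiff 𝓘(ℝ, E3) 𝓘(ℝ) ∞ χ) : ContDiffOn ℝ ∞ (fun y => χ (e.symm y)) e.target :=
  contMDiffOn_iff_contDiffOn.1 (hχ.comp_contMDiffOn (contMDiffOn_chart_symm he))

/-- The cutoff function `χ` in the coordinates of the chart `e`. -/
def chartCutoff (e : OpenPartialHomeomorph M E3) (χ : M → ℝ) : E3 → ℝ :=
  e.target.indicator fun y => χ (e.symm y)

variable [CompactSpace M]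

lemma isCompact_chart_image_tsupport (e : OpenPartialHomeomorph M E3) {χ : M → ℝ}
    (hs : tsupport χ ⊆ e.source) : IsCompact (e '' tsupport χ) ∧ e '' tsupport χ ⊆ e.target := by
  refine ⟨(isClosed_tsupport χ).isCompact.image_of_continuousOn (e.continuousOn.mono hs), ?_⟩
  rintro _ ⟨x, hx, rfl⟩
  exact e.map_source (hs hx)

lemma eq_zero_of_notMem_chart_image (e : OpenPartialHomeomorph M E3) {χ : M → ℝ} {y : E3}
    (hy : y ∈ e.target) (h : y ∉ e '' tsupport χ) : χ (e.symm y) = 0 := by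
  by_contra hne
  exact h ⟨e.symm y, subset_tsupport _ hne, e.right_inv hy⟩

lemma chartCutoff_testFunction (he : e ∈ atlas E3 M) {χ : M → ℝ}
    (hχ : ContMDiff 𝓘(ℝ, E3) 𝓘(ℝ) ∞ χ) (hs : tsupport χ ⊆ e.source) :
    ContDiff ℝ ∞ (chartCutoff e χ) ∧ HasCompactSupport (chartCutoff e χ) ∧
      tsupport (chartCutoff e χ) ⊆ e '' tsupport χ :=
  testFunction_indicator e (isCompact_chart_image_tsupport e hs).1
    (isCompact_chart_image_tsupport e hs).2 (contDiffOn_comp_chart_symm he hχ)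
    fun _ hy h => eq_zero_of_notMem_chart_image e hy h

variable [T2Space M]

variable (M) in
/-- A finite smooth partition of unity subordinate to charts. -/
lemma exists_chart_partition : ∃ (t : Finset M) (χ : t → M → ℝ),
    (∀ k, ContMDiff 𝓘(ℝ, E3) 𝓘(ℝ) ∞ (χ k)) ∧
    (∀ k : t, tsupport (χ k) ⊆ (chartAt E3 (k : M)).source) ∧ ∀ x, ∑ k, χ k x = 1 := by
  obtain ⟨t, ht⟩ := exists_finite_chart_cover M
  obtain ⟨f, hf⟩ := SmoothPartitionOfUnity.exists_isSubordinate 𝓘(ℝ, E3) (s := (univ : Set M))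
    isClosed_univ (fun k : t => (chartAt E3 (k : M)).source) (fun k => (chartAt E3 (k : M)).open_source)
    (by rw [← ht]; intro x hx; simpa using hx)
  refine ⟨t, fun k => f k, fun k => (f k).contMDiff, hf, fun x => ?_⟩
  rw [← finsum_eq_sum_of_fintype]
  exact f.sum_eq_one (mem_univ x)

end Partition

/-! ### The Sobolev inequality on the manifold -/

section Sobolev

variable {M : Type*} [TopologicalSpace M] [ChartedSpace E3 M] [IsManifold 𝓘(ℝ, E3) ∞ M]
  {e : OpenPartialHomeomorph M E3} (g : RMetric M)
  [MeasurableSpace M] [BorelSpace M] [CompactSpace M] [T2Space M]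

lemma isFiniteMeasure_riemVolume : IsFiniteMeasure (riemVolume g) := by
  refine ⟨?_⟩
  obtain ⟨t, χ, -, hs, h1⟩ := exists_chart_partition M
  have hcov : (univ : Set M) ⊆ ⋃ k : t, tsupport (χ k) := by
    intro x _
    by_contra hx
    simp only [mem_iUnion, not_exists] at hx
    have := h1 x
    rw [Finset.sum_eq_zero fun k _ => image_eq_zero_of_notMem_tsupport (hx k)] at this
    exact zero_ne_one this
  refine (measure_mono hcov).trans_lt ((measure_iUnion_fintype_le _ _).trans_lt ?_)
  refine ENNReal.sum_lt_top.2 fun k _ => ?_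
  set e := chartAt E3 (k : M) with he
  have hea : e ∈ atlas E3 M := chart_mem_atlas E3 _
  obtain ⟨hK, hKe⟩ := isCompact_chart_image_tsupport e (hs k)
  have himg : e.symm '' (e '' tsupport (χ k)) = tsupport (χ k) :=
    e.symm_image_image_of_subset_source (hs k)
  have h2 := congrArg (fun μ => μ univ) (riemVolume_restrict_image g hea hK hKe)
  simp only [Measure.restrict_apply_univ] at h2
  rw [himg] at h2
  rw [h2, Measure.map_apply_of_aemeasurable ((aemeasurable_chart_symm' g e).mono_measure
    Measure.restrict_le_self) MeasurableSet.univ, preimage_univ]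
  obtain ⟨C, hC, -⟩ := exists_targetVolume_bounds g hea hK hKe
  refine (hC univ).trans_lt ?_
  simp only [Measure.smul_apply, Measure.restrict_apply_univ, smul_eq_mul]
  exact ENNReal.mul_lt_top ENNReal.coe_lt_top hK.measure_lt_top

/-- The Sobolev inequality for the components of a one-form in a chart, after cutting off. -/
lemma exists_chart_sobolev (he : e ∈ atlas E3 M) {χ : M → ℝ}
    (hχ : ContMDiff 𝓘(ℝ, E3) 𝓘(ℝ) ∞ χ) (hs : tsupport χ ⊆ e.source) {p q : ℝ≥0} (hp : 1 ≤ p)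
    (hq : (q : ℝ)⁻¹ = (p : ℝ)⁻¹ - 3⁻¹) :
    ∃ C : ℝ≥0, ∀ (a : OneForm M) (Ψ : TwoTensor M), IsWeakCovDeriv g 0 a Ψ → ∀ i r s,
      eLpNorm (fun y => (chartCutoff e χ y : ℂ) * oneComp e a i y r s) q volume ≤
        C * (eLpNorm (norm₁ g a) p (riemVolume g) + eLpNorm (norm₂ g Ψ) p (riemVolume g)) := by
  obtain ⟨hφ, hc, hsub⟩ := chartCutoff_testFunction he hχ hs
  obtain ⟨hK, hKe⟩ := isCompact_chart_image_tsupport e hs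
  set φ := chartCutoff e χ with hφdef
  set K := e '' tsupport χ with hKdef
  obtain ⟨C₁, hC₁⟩ := exists_sobolev_const (p := p) (q := q) hp hq
  obtain ⟨C₂, hC₂⟩ := exists_component_bounds g he hK hKe
  obtain ⟨C₃, hC₃⟩ := exists_eLpNorm_bounds g he hK hKe (p := (p : ℝ≥0∞)) ENNReal.coe_ne_top
  obtain ⟨D₀, hD₀⟩ := hK.exists_bound_of_continuousOn hφ.continuous.continuousOn
  choose D₁ hD₁ using fun i => hK.exists_bound_of_continuousOn (continuous_partial hφ i).continuousOn
  set D : ℝ := |D₀| + ∑ i, |D₁ i| with hD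
  have hD0 : 0 ≤ D := by positivity
  have hDφ : ∀ y ∈ K, |φ y| ≤ D := fun y hy => (hD₀ y hy).trans ((le_abs_self _).trans
    (le_add_of_nonneg_right (by positivity)))
  have hDd : ∀ i, ∀ y ∈ K, |fderiv ℝ φ y (EuclideanSpace.single i (1 : ℝ))| ≤ D := fun i y hy =>
    (hD₁ i y hy).trans ((le_abs_self _).trans ((Finset.single_le_sum (f := fun i => |D₁ i|)
      (fun _ _ => abs_nonneg _) (Finset.mem_univ i)).trans (le_add_of_nonneg_left (abs_nonneg _))))
  set F : ℝ := D * (2 * C₂ + 3 * C₂ ^ 2) with hF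
  have hF0 : 0 ≤ F := by positivity
  refine ⟨C₁ * (3 * (F.toNNReal * C₃)), fun a Ψ H i r s => ?_⟩
  have hm1 := H.measComp₁.norm₁ g
  have hm2 := H.measComp₂.norm₂ g
  have hm1' := (H.measComp₁.norm₁_chart g he).mono_measure (Measure.restrict_mono hKe le_rfl)
  have hm2' : AEStronglyMeasurable (fun y => norm₂ g Ψ (e.symm y)) (volume.restrict K) :=
    (Real.continuous_sqrt.comp_aestronglyMeasurable (H.measComp₂.normSq₂_chart g he)).mono_measure
      (Measure.restrict_mono hKe le_rfl)
  obtain ⟨h, h1, h2⟩ := H e he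
  have hcs : HasCompactSupport fun y => (φ y : ℂ) * oneComp e a i y r s :=
    hc.mono fun y hy h0 => hy (by simp [h0])
  refine (hC₁ _ _ hcs fun j => WeakPartial.cutoff (h1 j i r s) hφ hc (hsub.trans hKe)).trans ?_
  have key : ∀ j, eLpNorm (fun y => ((fderiv ℝ φ y (EuclideanSpace.single j (1 : ℝ)) : ℝ) : ℂ) *
      oneComp e a i y r s + (φ y : ℂ) * h j i y r s) p volume ≤
      F.toNNReal * C₃ * (eLpNorm (norm₁ g a) p (riemVolume g) +
        eLpNorm (norm₂ g Ψ) p (riemVolume g)) := by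
    intro j
    have hsupp : Function.support (fun y => ((fderiv ℝ φ y (EuclideanSpace.single j (1 : ℝ)) : ℝ) : ℂ) *
      oneComp e a i y r s + (φ y : ℂ) * h j i y r s) ⊆ K := by
      intro y hy
      by_contra hyK
      refine hy ?_
      have hyt : y ∉ tsupport φ := fun hh => hyK (hsub hh)
      have e1 : φ y = 0 := image_eq_zero_of_notMem_tsupport hyt
      have e2 : fderiv ℝ φ y (EuclideanSpace.single j (1 : ℝ)) = 0 :=
        image_eq_zero_of_notMem_tsupport (f := fun y => fderiv ℝ φ y (EuclideanSpace.single j (1 : ℝ)))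
          fun hh => hyt (tsupport_partial_subset φ j hh)
      simp only [e1, e2]; simp
    rw [← eLpNorm_restrict_eq_of_support_subset hsupp]
    calc _ ≤ eLpNorm (F • fun y => norm₁ g a (e.symm y) + norm₂ g Ψ (e.symm y)) p
          (volume.restrict K) := by
          refine eLpNorm_mono_ae ?_
          filter_upwards [ae_restrict_mem hK.measurableSet,
            ae_mono (Measure.restrict_mono hKe le_rfl) h2] with y hyK hy
          obtain ⟨b1, -, b2, b3⟩ := hC₂ y hyK
          have n1 := norm₁_nonneg (x := e.symm y) g a
          have n2 := norm₂_nonneg (x := e.symm y) g Ψ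
          have hh : h j i y r s = twoComp e Ψ j i y r s +
              ∑ k, (christoffel g e k j i y : ℂ) * oneComp e a k y r s := by
            rw [hy j i, oneComp_zero, zero_lie, add_zero, Matrix.sub_apply, Matrix.sum_apply]
            simp
          have hhn : ‖h j i y r s‖ ≤ C₂ * norm₂ g Ψ (e.symm y) + 3 * (C₂ * (C₂ * norm₁ g a (e.symm y))) := by
            rw [hh]
            refine (norm_add_le _ _).trans (add_le_add (b2 Ψ j i r s) ((norm_sum_le _ _).trans ?_))
            refine (Finset.sum_le_card_nsmul _ _ (C₂ * (C₂ * norm₁ g a (e.symm y))) fun k _ => ?_).trans_eq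
              (by simp)
            rw [norm_mul, Complex.norm_real]
            exact mul_le_mul (b3 k j i) (b1 a k r s) (norm_nonneg _) C₂.2
          calc _ ≤ D * (C₂ * norm₁ g a (e.symm y)) +
                D * (C₂ * norm₂ g Ψ (e.symm y) + 3 * (C₂ * (C₂ * norm₁ g a (e.symm y)))) := by
                refine (norm_add_le _ _).trans (add_le_add ?_ ?_)
                · rw [norm_mul, Complex.norm_real]
                  exact mul_le_mul (hDd j y hyK) (b1 a i r s) (norm_nonneg _) hD0
                · rw [norm_mul, Complex.norm_real]
                  exact mul_le_mul (hDφ y hyK) hhn (norm_nonneg _) hD0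
            _ ≤ F * (norm₁ g a (e.symm y) + norm₂ g Ψ (e.symm y)) := by
                have z1 : 0 ≤ D * C₂ * norm₁ g a (e.symm y) := by positivity
                have z2 : 0 ≤ D * C₂ * norm₂ g Ψ (e.symm y) := by positivity
                have z3 : 0 ≤ D * C₂ ^ 2 * norm₂ g Ψ (e.symm y) := by positivity
                rw [hF]
                nlinarith
            _ ≤ _ := by
                simp only [Pi.smul_apply, smul_eq_mul]
                exact le_abs_self _
      _ = F.toNNReal * eLpNorm (fun y => norm₁ g a (e.symm y) + norm₂ g Ψ (e.symm y)) p
          (volume.restrict K) := by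
          rw [eLpNorm_const_smul, Real.enorm_eq_ofReal hF0]; rfl
      _ ≤ F.toNNReal * (C₃ * eLpNorm (norm₁ g a) p (riemVolume g) +
          C₃ * eLpNorm (norm₂ g Ψ) p (riemVolume g)) := by
          gcongr
          refine (eLpNorm_add_le hm1' hm2' (by exact_mod_cast hp)).trans (add_le_add ?_ ?_)
          · exact (hC₃ _ hm1).2
          · exact (hC₃ _ hm2).2
      _ = _ := by ring
  calc _ ≤ (C₁ : ℝ≥0∞) * ∑ _j : Fin 3, F.toNNReal * C₃ * (eLpNorm (norm₁ g a) p (riemVolume g) +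
        eLpNorm (norm₂ g Ψ) p (riemVolume g)) := by
        gcongr with j _; exact key j
    _ = _ := by
        simp only [Finset.sum_const, Finset.card_univ, Fintype.card_fin, nsmul_eq_mul]
        push_cast; ring

/-- The Sobolev inequality `‖a‖_q ≤ C (‖a‖_p + ‖∇a‖_p)`, `1/q = 1/p - 1/3`, for one-forms on a
compact Riemannian three-manifold. -/
lemma exists_manifold_sobolev {p q : ℝ≥0} (hp : 1 ≤ p) (hq1 : 1 ≤ q)
    (hq : (q : ℝ)⁻¹ = (p : ℝ)⁻¹ - 3⁻¹) :
    ∃ C : ℝ≥0, ∀ (a : OneForm M) (Ψ : TwoTensor M), IsWeakCovDeriv g 0 a Ψ →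
      eLpNorm (norm₁ g a) q (riemVolume g) ≤
        C * (eLpNorm (norm₁ g a) p (riemVolume g) + eLpNorm (norm₂ g Ψ) p (riemVolume g)) := by
  obtain ⟨t, χ, hχ, hs, h1⟩ := exists_chart_partition M
  have hloc : ∀ k : t, ∃ C : ℝ≥0, ∀ (a : OneForm M) (Ψ : TwoTensor M), IsWeakCovDeriv g 0 a Ψ →
      eLpNorm (fun x => χ k x * norm₁ g a x) q (riemVolume g) ≤
        C * (eLpNorm (norm₁ g a) p (riemVolume g) + eLpNorm (norm₂ g Ψ) p (riemVolume g)) := by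
    intro k
    set e := chartAt E3 (k : M) with hedef
    have he : e ∈ atlas E3 M := chart_mem_atlas E3 _
    obtain ⟨hK, hKe⟩ := isCompact_chart_image_tsupport e (hs k)
    have himg : e.symm '' (e '' tsupport (χ k)) = tsupport (χ k) :=
      e.symm_image_image_of_subset_source (hs k)
    set K := e '' tsupport (χ k) with hKdef
    obtain ⟨C₁, hC₁⟩ := exists_chart_sobolev g he (hχ k) (hs k) hp hq
    obtain ⟨C₂, hC₂⟩ := exists_component_bounds g he hK hKe
    obtain ⟨C₃, hC₃⟩ := exists_eLpNorm_bounds g he hK hKe (p := (q : ℝ≥0∞)) ENNReal.coe_ne_top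
    refine ⟨C₃ * (C₂ * (12 * C₁)), fun a Ψ H => ?_⟩
    have hm : AEStronglyMeasurable (fun x => χ k x * norm₁ g a x) (riemVolume g) :=
      (hχ k).continuous.aestronglyMeasurable.mul (H.measComp₁.norm₁ g)
    have hsupp : Function.support (fun x => χ k x * norm₁ g a x) ⊆ e.symm '' K := by
      rw [himg]
      exact fun x hx => subset_tsupport _ fun h0 => hx (by simp [h0])
    rw [← eLpNorm_restrict_eq_of_support_subset hsupp]
    refine (hC₃ _ hm).1.trans ?_
    set S : ℝ≥0∞ := eLpNorm (norm₁ g a) p (riemVolume g) + eLpNorm (norm₂ g Ψ) p (riemVolume g)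
    set φ := chartCutoff e (χ k)
    have hφm : Continuous φ := (chartCutoff_testFunction he (hχ k) (hs k)).1.continuous
    have hmeas : ∀ i r s, AEStronglyMeasurable (fun y => ‖(φ y : ℂ) * oneComp e a i y r s‖)
        (volume.restrict K) := fun i r s =>
      ((Complex.continuous_ofReal.comp hφm).aestronglyMeasurable.mul
        ((H.measComp₁ e he i r s).mono_measure (Measure.restrict_mono hKe le_rfl))).norm
    have hq1' : (1 : ℝ≥0∞) ≤ q := by exact_mod_cast hq1
    calc _ ≤ (C₃ : ℝ≥0∞) * (C₂ * ∑ _i : Fin 3, ∑ _r : Fin 2, ∑ _s : Fin 2, C₁ * S) := by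
          gcongr
          calc _ ≤ eLpNorm ((C₂ : ℝ) • fun y => ∑ i, ∑ r, ∑ s, ‖(φ y : ℂ) * oneComp e a i y r s‖) q
                (volume.restrict K) := by
                refine eLpNorm_mono_ae ?_
                filter_upwards [ae_restrict_mem hK.measurableSet] with y hyK
                have hφy : φ y = χ k (e.symm y) := indicator_of_mem (hKe hyK) _
                simp only [Pi.smul_apply, smul_eq_mul, norm_mul, Complex.norm_real, hφy]
                rw [Real.norm_of_nonneg (norm₁_nonneg g a)]
                simp only [← Finset.mul_sum]
                rw [norm_mul, norm_norm, Real.norm_of_nonneg (by positivity : (0:ℝ) ≤ C₂), Real.norm_of_nonneg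
                  (by positivity : (0:ℝ) ≤ ∑ i, ∑ r, ∑ s, ‖oneComp e a i y r s‖)]
                calc _ ≤ ‖χ k (e.symm y)‖ * (C₂ * ∑ i, ∑ r, ∑ s, ‖oneComp e a i y r s‖) := by
                      gcongr; exact (hC₂ y hyK).2.1 a
                  _ = _ := by ring
            _ = C₂ * eLpNorm (fun y => ∑ i, ∑ r, ∑ s, ‖(φ y : ℂ) * oneComp e a i y r s‖) q
                (volume.restrict K) := by
                rw [eLpNorm_const_smul, Real.enorm_eq_ofReal (NNReal.coe_nonneg C₂), ENNReal.ofReal_coe_nnreal]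
            _ ≤ _ := by
                gcongr
                have e3 : (fun y => ∑ i, ∑ r, ∑ s, ‖(φ y : ℂ) * oneComp e a i y r s‖) =
                    ∑ i, ∑ r, ∑ s, fun y => ‖(φ y : ℂ) * oneComp e a i y r s‖ := by
                  ext y; simp only [Finset.sum_apply]
                rw [e3]
                refine (eLpNorm_sum_le (fun i _ => Finset.aestronglyMeasurable_sum _ fun r _ =>
                  Finset.aestronglyMeasurable_sum _ fun s _ => hmeas i r s) hq1').trans ?_
                gcongr with i _
                refine (eLpNorm_sum_le (fun r _ =>
                  Finset.aestronglyMeasurable_sum _ fun s _ => hmeas i r s) hq1').trans ?_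
                gcongr with r _
                refine (eLpNorm_sum_le (fun s _ => hmeas i r s) hq1').trans ?_
                gcongr with s _
                rw [eLpNorm_norm]
                exact (eLpNorm_mono_measure _ Measure.restrict_le_self).trans (hC₁ a Ψ H i r s)
      _ = _ := by
          simp only [Finset.sum_const, Finset.card_univ, Fintype.card_fin, nsmul_eq_mul]
          push_cast; ring
  choose C hC using hloc
  refine ⟨∑ k, C k, fun a Ψ H => ?_⟩
  have e1 : norm₁ g a = ∑ k, fun x => χ k x * norm₁ g a x := by
    ext x
    rw [Finset.sum_apply, ← Finset.sum_mul, h1, one_mul]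
  conv_lhs => rw [e1]
  refine (eLpNorm_sum_le (fun k _ => (hχ k).continuous.aestronglyMeasurable.mul
    (H.measComp₁.norm₁ g)) (by exact_mod_cast hq1)).trans ?_
  push_cast
  rw [Finset.sum_mul]
  exact Finset.sum_le_sum fun k _ => hC k a Ψ H

end Sobolev

/-! ### Sobolev embeddings relative to a connection -/

lemma holderTriple_of_eq_two_mul {a b : ℝ≥0∞} (hb : b = 2 * a) :
    ENNReal.HolderTriple b b a where
  inv_add_inv_eq_inv := by
    rw [hb, ENNReal.mul_inv (by simp) (by simp), ← two_mul, ← mul_assoc,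
      ENNReal.mul_inv_cancel (by simp) (by simp), one_mul]

instance holderTriple_three_three : ENNReal.HolderTriple 3 3 (3 / 2) :=
  holderTriple_of_eq_two_mul (ENNReal.mul_div_cancel (by simp) (by simp)).symm

instance holderTriple_four_four : ENNReal.HolderTriple 4 4 2 :=
  holderTriple_of_eq_two_mul (by norm_num)

lemma one_le_three_halves : (1 : ℝ≥0∞) ≤ 3 / 2 := by
  rw [ENNReal.le_div_iff_mul_le (by simp) (by simp)]; norm_num

lemma three_halves_le_two : (3 / 2 : ℝ≥0∞) ≤ 2 := by
  rw [ENNReal.div_le_iff_le_mul (by simp) (by simp)]; norm_num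

lemma three_halves_ne_top : (3 / 2 : ℝ≥0∞) ≠ ⊤ := by simp [ENNReal.div_eq_top]

lemma three_halves_ne_zero : (3 / 2 : ℝ≥0∞) ≠ 0 := by simp

section Embedding

variable {M : Type*} [TopologicalSpace M] [ChartedSpace E3 M] [IsManifold 𝓘(ℝ, E3) ∞ M]
  {g : RMetric M} [MeasurableSpace M] [BorelSpace M] [CompactSpace M] [T2Space M]
  {B a b : OneForm M} {Ψ Φ : TwoTensor M} {p q : ℝ≥0∞}

lemma memLp_norm₂_add (hΨ : MeasComp₂ Ψ) (hΦ : MeasComp₂ Φ)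
    (h : MemLp (norm₂ g Ψ) p (riemVolume g)) (h' : MemLp (norm₂ g Φ) p (riemVolume g)) :
    MemLp (norm₂ g (Ψ + Φ)) p (riemVolume g) := by
  refine ((h.const_mul 2).add (h'.const_mul 2)).mono' ((hΨ.add hΦ).norm₂ g) (ae_of_all _ fun x => ?_)
  rw [Real.norm_of_nonneg (norm₂_nonneg g _)]
  exact norm₂_add_le g Ψ Φ

lemma memLp_norm₂_sub (hΨ : MeasComp₂ Ψ) (hΦ : MeasComp₂ Φ)
    (h : MemLp (norm₂ g Ψ) p (riemVolume g)) (h' : MemLp (norm₂ g Φ) p (riemVolume g)) :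
    MemLp (norm₂ g (Ψ - Φ)) p (riemVolume g) := by
  refine ((h.const_mul 2).add (h'.const_mul 2)).mono' ((hΨ.sub hΦ).norm₂ g) (ae_of_all _ fun x => ?_)
  rw [Real.norm_of_nonneg (norm₂_nonneg g _)]
  exact norm₂_sub_le g Ψ Φ

lemma memLp_norm₁_sub (ha : MeasComp₁ a) (hb : MeasComp₁ b)
    (h : MemLp (norm₁ g a) p (riemVolume g)) (h' : MemLp (norm₁ g b) p (riemVolume g)) :
    MemLp (norm₁ g (a - b)) p (riemVolume g) := by
  refine ((h.const_mul 2).add (h'.const_mul 2)).mono' ((ha.sub hb).norm₁ g) (ae_of_all _ fun x => ?_)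
  rw [Real.norm_of_nonneg (norm₁_nonneg g _)]
  exact norm₁_sub_le g a b

lemma memLp_norm₂_lieTensor [ENNReal.HolderTriple q q p] (hB : MeasComp₁ B) (ha : MeasComp₁ a)
    (h : MemLp (norm₁ g B) q (riemVolume g)) (h' : MemLp (norm₁ g a) q (riemVolume g)) :
    MemLp (norm₂ g (lieTensor B a)) p (riemVolume g) := by
  have h1 : MemLp (norm₁ g B * norm₁ g a) p (riemVolume g) := h'.mul h
  refine (h1.const_mul 2).mono' ((hB.lieTensor ha).norm₂ g) (ae_of_all _ fun x => ?_)
  rw [Real.norm_of_nonneg (norm₂_nonneg g _)]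
  exact (norm₂_lieTensor_le g B a).trans_eq (by simp only [Pi.mul_apply]; ring)

lemma MemSobolev.sub (ha : MemSobolev g p a) (hb : MemSobolev g p b) : MemSobolev g p (a - b) := by
  obtain ⟨Ψ, H, h1, h2⟩ := ha
  obtain ⟨Φ, H', h1', h2'⟩ := hb
  exact ⟨Ψ - Φ, H.sub H', memLp_norm₁_sub H.measComp₁ H'.measComp₁ h1 h1',
    memLp_norm₂_sub H.measComp₂ H'.measComp₂ h2 h2'⟩

lemma MemSobolev.mono_exponent (ha : MemSobolev g q a) (hpq : p ≤ q) : MemSobolev g p a := by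
  have := isFiniteMeasure_riemVolume g
  obtain ⟨Ψ, H, h1, h2⟩ := ha
  exact ⟨Ψ, H, h1.mono_exponent hpq, h2.mono_exponent hpq⟩

/-- The embedding `L^{3/2}_1 ⊂ L^3`. -/
lemma exists_sobolev_three (g : RMetric M) : ∃ C : ℝ≥0, ∀ (a : OneForm M) (Ψ : TwoTensor M),
    IsWeakCovDeriv g 0 a Ψ → eLpNorm (norm₁ g a) 3 (riemVolume g) ≤
      C * (eLpNorm (norm₁ g a) (3 / 2) (riemVolume g) + eLpNorm (norm₂ g Ψ) (3 / 2) (riemVolume g)) := by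
  have h := exists_manifold_sobolev g (p := 3 / 2) (q := 3) (by rw [le_div_iff₀ (by norm_num)]; norm_num)
    (by norm_num) (by push_cast; norm_num)
  simpa using h

lemma MemSobolev.memLp_three (ha : MemSobolev g (3 / 2) a) :
    MemLp (norm₁ g a) 3 (riemVolume g) := by
  obtain ⟨Ψ, H, h1, h2⟩ := ha
  obtain ⟨C, hC⟩ := exists_sobolev_three g
  exact ⟨H.measComp₁.norm₁ g, (hC a Ψ H).trans_lt
    (ENNReal.mul_lt_top ENNReal.coe_lt_top (ENNReal.add_lt_top.2 ⟨h1.2, h2.2⟩))⟩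

/-- The embedding `L^2_1 ⊂ L^6 ⊂ L^4`; the exponent `4` is what `A ∧ A ∈ L^2` needs. -/
lemma MemSobolev.memLp_four (ha : MemSobolev g 2 a) : MemLp (norm₁ g a) 4 (riemVolume g) := by
  have := isFiniteMeasure_riemVolume g
  obtain ⟨Ψ, H, h1, h2⟩ := ha
  obtain ⟨C, hC⟩ := exists_manifold_sobolev g (p := 2) (q := 6) (by norm_num) (by norm_num)
    (by push_cast; norm_num)
  have h6 : MemLp (norm₁ g a) ((6 : ℝ≥0) : ℝ≥0∞) (riemVolume g) :=
    ⟨H.measComp₁.norm₁ g, (hC a Ψ H).trans_lt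
      (ENNReal.mul_lt_top ENNReal.coe_lt_top (ENNReal.add_lt_top.2 ⟨h1.2, h2.2⟩))⟩
  refine h6.mono_exponent ?_
  norm_num

/-- For `a` in `L^p_1` the covariant derivative `∇_B a` is in `L^p`, if `a` and `B` are in
`L^{2p}`. -/
lemma MemSobolev.exists_covDeriv [ENNReal.HolderTriple q q p] (ha : MemSobolev g p a)
    (haq : MemLp (norm₁ g a) q (riemVolume g)) (hB : MeasComp₁ B)
    (hBq : MemLp (norm₁ g B) q (riemVolume g)) :
    ∃ Ψ, IsWeakCovDeriv g B a Ψ ∧ MeasComp₂ Ψ ∧ MemLp (norm₂ g Ψ) p (riemVolume g) := by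
  obtain ⟨Ψ, H, -, h2⟩ := ha
  have hl := hB.lieTensor H.measComp₁
  exact ⟨Ψ + lieTensor B a, H.add_lieTensor B, H.measComp₂.add hl,
    memLp_norm₂_add H.measComp₂ hl h2 (memLp_norm₂_lieTensor hB H.measComp₁ hBq haq)⟩

/-- The embedding `L^{3/2}_1 ⊂ L^3` relative to a connection `d + B` with `B ∈ L^{3/2}_1`. The
commutator `[B, a]` is absorbed, after `B` has been written as the sum of a part that is small in
`L^3` and a bounded part. -/
lemma exists_sobolev_three_connection (hB : MemSobolev g (3 / 2) B) :
    ∃ C : ℝ≥0, ∀ (a : OneForm M) (Ψ : TwoTensor M), MemSobolev g (3 / 2) a →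
      IsWeakCovDeriv g B a Ψ → eLpNorm (norm₁ g a) 3 (riemVolume g) ≤
      C * (eLpNorm (norm₁ g a) (3 / 2) (riemVolume g) + eLpNorm (norm₂ g Ψ) (3 / 2) (riemVolume g)) := by
  obtain ⟨C, hC⟩ := exists_sobolev_three g
  set μ := riemVolume g
  -- `∇a = ∇_B a - [B, a]`, so the part of `B` that is small in `L^3` enters with the factor `4 C`; with
  -- `ε = 1 / (8 (C + 1))` this factor times `ε` is at most `1 / 2`.
  have hε : (ENNReal.ofReal (1 / (8 * (C + 1)))) ≠ 0 := by
    rw [ne_eq, ENNReal.ofReal_eq_zero, not_le]; positivity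
  have hB3 := hB.memLp_three
  obtain ⟨s, hs, -⟩ := hB3.exists_simpleFunc_eLpNorm_sub_lt (by simp) hε
  obtain ⟨R, hR⟩ := s.exists_forall_norm_le
  obtain ⟨_, HB, -, -⟩ := hB
  refine ⟨(2 * C * (4 + 4 * |R|)).toNNReal, fun a Ψ ha H => ?_⟩
  have H0 := H.sub_lieTensor
  have hma := H.measComp₁
  have hmB := HB.measComp₁
  have hmΨ0 := H0.measComp₂
  have hmΨ : MeasComp₂ Ψ := by
    have := hmΨ0.add (hmB.lieTensor hma)
    rwa [sub_add_cancel] at this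
  have ha3 := ha.memLp_three
  have hN := hma.norm₁ g
  have hT := hmΨ.norm₂ g
  set f : M → ℝ := norm₁ g B - s with hf
  have hfm : AEStronglyMeasurable f μ := (hmB.norm₁ g).sub s.aestronglyMeasurable
  have hN0 : ∀ x, 0 ≤ norm₁ g a x := fun x => norm₁_nonneg g a
  have key : eLpNorm (norm₂ g (Ψ - lieTensor B a)) (3 / 2) μ ≤
      2 * eLpNorm (norm₂ g Ψ) (3 / 2) μ + (4 * (eLpNorm f 3 μ * eLpNorm (norm₁ g a) 3 μ) +
        ENNReal.ofReal (4 * |R|) * eLpNorm (norm₁ g a) (3 / 2) μ) := by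
    calc _ ≤ eLpNorm ((2 : ℝ) • norm₂ g Ψ + ((4 : ℝ) • ((fun x => ‖f x‖) • norm₁ g a) +
          (4 * |R|) • norm₁ g a)) (3 / 2) μ := by
          refine eLpNorm_mono_real fun x => ?_
          rw [Real.norm_of_nonneg (norm₂_nonneg g _)]
          have h1 := norm₂_sub_le (x := x) g Ψ (lieTensor B a)
          have h2 := norm₂_lieTensor_le (x := x) g B a
          have h3 : norm₁ g B x ≤ |f x| + |R| := by
            have e1 : norm₁ g B x = f x + s x := by simp [hf]
            rw [e1]
            exact add_le_add (le_abs_self _) ((le_abs_self _).trans ((hR x).trans (le_abs_self _)))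
          have h4 := mul_le_mul_of_nonneg_right h3 (hN0 x)
          simp only [Pi.add_apply, Pi.smul_apply, smul_eq_mul, Pi.mul_apply, Real.norm_eq_abs]
          linarith
      _ ≤ _ := by
          have m1 : AEStronglyMeasurable ((fun x => ‖f x‖) • norm₁ g a) μ := hfm.norm.smul hN
          refine (eLpNorm_add_le (hT.const_smul _) ((m1.const_smul _).add (hN.const_smul _))
            one_le_three_halves).trans (add_le_add ?_ ?_)
          · rw [eLpNorm_const_smul]
            gcongr
            rw [Real.enorm_eq_ofReal (by norm_num)]; simp
          · refine (eLpNorm_add_le (m1.const_smul _) (hN.const_smul _)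
              one_le_three_halves).trans (add_le_add ?_ ?_)
            · rw [eLpNorm_const_smul]
              refine mul_le_mul' ?_ ?_
              · rw [Real.enorm_eq_ofReal (by norm_num)]; simp
              · rw [← eLpNorm_norm f]
                exact eLpNorm_smul_le_mul_eLpNorm hN hfm.norm
            · rw [eLpNorm_const_smul, Real.enorm_eq_ofReal (by positivity)]
  have hmain := hC a _ H0
  by_cases htop : eLpNorm (norm₂ g Ψ) (3 / 2) μ = ⊤
  · rw [htop, add_top]
    by_cases hC0 : C = 0
    · rw [hC0] at hmain
      have hz : eLpNorm (norm₁ g a) 3 μ ≤ 0 := by simpa using hmain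
      exact hz.trans zero_le
    · rw [ENNReal.mul_top]
      · exact le_top
      · simp only [ne_eq, ENNReal.coe_eq_zero, Real.toNNReal_eq_zero, not_le]
        have : 0 < (C : ℝ) := NNReal.coe_pos.2 (pos_iff_ne_zero.2 hC0)
        positivity
  obtain ⟨_, _, ha32, -⟩ := ha
  have hx := ha3.2.ne
  have hu := ha32.2.ne
  have hfε := hs.le
  have hftop : eLpNorm f 3 μ ≠ ⊤ := (hs.trans ENNReal.ofReal_lt_top).ne
  have hfr : (eLpNorm f 3 μ).toReal ≤ 1 / (8 * (C + 1)) :=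
    ENNReal.toReal_le_of_le_ofReal (by positivity) hfε
  have hall : eLpNorm (norm₁ g a) 3 μ ≤ C * (eLpNorm (norm₁ g a) (3 / 2) μ +
      (2 * eLpNorm (norm₂ g Ψ) (3 / 2) μ + (4 * (eLpNorm f 3 μ * eLpNorm (norm₁ g a) 3 μ) +
        ENNReal.ofReal (4 * |R|) * eLpNorm (norm₁ g a) (3 / 2) μ))) :=
    hmain.trans (by gcongr)
  have hc : ∀ c : ℝ, ENNReal.ofReal c = ((c.toNNReal : ℝ≥0) : ℝ≥0∞) := fun _ => rfl
  -- The absorption needs `‖a‖₃ < ∞`, which the embedding for the trivial connection provides.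
  lift eLpNorm (norm₁ g a) 3 μ to ℝ≥0 using hx with x
  lift eLpNorm (norm₁ g a) (3 / 2) μ to ℝ≥0 using hu with u
  lift eLpNorm (norm₂ g Ψ) (3 / 2) μ to ℝ≥0 using htop with v
  lift eLpNorm f 3 μ to ℝ≥0 using hftop with w
  rw [hc] at hall
  have hall' : x ≤ C * (u + (2 * v + (4 * (w * x) + (4 * |R|).toNNReal * u))) := by exact_mod_cast hall
  have hallr : (x : ℝ) ≤ C * (u + (2 * v + (4 * (w * x) + 4 * |R| * u))) := by
    have := NNReal.coe_le_coe.2 hall'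
    push_cast at this
    rwa [Real.coe_toNNReal _ (by positivity)] at this
  have goal' : x ≤ (2 * C * (4 + 4 * |R|)).toNNReal * (u + v) := by
    rw [← NNReal.coe_le_coe]
    push_cast
    rw [Real.coe_toNNReal _ (by positivity)]
    have hw : (w : ℝ) * (8 * (C + 1)) ≤ 1 := by
      rw [ENNReal.coe_toReal, le_div_iff₀ (by positivity)] at hfr
      exact hfr
    have hCw : 4 * (C : ℝ) * w ≤ 1 / 2 := by nlinarith [w.2, NNReal.coe_nonneg w]
    have h5 : 4 * (C : ℝ) * w * x ≤ 1 / 2 * x := mul_le_mul_of_nonneg_right hCw x.2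
    have h6 : 0 ≤ (C : ℝ) * |R| * v := by positivity
    have h7 : 0 ≤ (C : ℝ) * u := by positivity
    have h8 : 0 ≤ (C : ℝ) * v := by positivity
    nlinarith
  exact_mod_cast goal'

lemma exists_isSobolevConst_three_halves (hB : MemSobolev g (3 / 2) B) :
    ∃ c : ℝ≥0, 0 < c ∧ IsSobolevConst g B (3 / 2) c := by
  obtain ⟨C, hC⟩ := exists_sobolev_three_connection hB
  refine ⟨2 * C + 1, by positivity, fun a ha => ?_⟩
  obtain ⟨Ψ, H, -, -⟩ := id ha
  have HB := H.add_lieTensor B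
  obtain ⟨h1, h2⟩ := HB.eLpNorm_le_sobolevNorm three_halves_ne_zero three_halves_ne_top
  calc _ ≤ C * (sobolevNorm g B (3 / 2) a + sobolevNorm g B (3 / 2) a) :=
        (hC a _ ha HB).trans (by gcongr)
    _ = ((2 * C : ℝ≥0) : ℝ≥0∞) * sobolevNorm g B (3 / 2) a := by push_cast; ring
    _ ≤ _ := by gcongr; exact le_self_add

lemma exists_isSobolevConst_two (hB : MemSobolev g 2 B) :
    ∃ c : ℝ≥0, 0 < c ∧ IsSobolevConst g B 2 c := by
  have hfin := isFiniteMeasure_riemVolume g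
  have hB' := hB.mono_exponent three_halves_le_two
  obtain ⟨C, hC⟩ := exists_sobolev_three_connection hB'
  set V : ℝ≥0∞ := riemVolume g univ ^ (1 / (3 / 2 : ℝ≥0∞).toReal - 1 / (2 : ℝ≥0∞).toReal) with hV
  have hVtop : V ≠ ⊤ := by
    refine ENNReal.rpow_ne_top_of_nonneg ?_ (measure_ne_top _ _)
    simp only [ENNReal.toReal_div, ENNReal.toReal_ofNat]
    norm_num
  refine ⟨2 * C * V.toNNReal + 1, by positivity, fun a ha => ?_⟩
  obtain ⟨Ψ, H, -, -⟩ := id ha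
  have HB := H.add_lieTensor B
  obtain ⟨_, HBB, _, _⟩ := hB
  have hm2 := (H.measComp₂.add (HBB.measComp₁.lieTensor H.measComp₁)).norm₂ g
  have hm1 := H.measComp₁.norm₁ g
  obtain ⟨h1, h2⟩ := HB.eLpNorm_le_sobolevNorm (p := 2) (by simp) (by simp)
  calc _ ≤ C * (sobolevNorm g B 2 a * V + sobolevNorm g B 2 a * V) := by
        refine (hC a _ (ha.mono_exponent three_halves_le_two) HB).trans ?_
        gcongr
        · exact (eLpNorm_le_eLpNorm_mul_rpow_measure_univ three_halves_le_two hm1).trans (by gcongr)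
        · exact (eLpNorm_le_eLpNorm_mul_rpow_measure_univ three_halves_le_two hm2).trans (by gcongr)
    _ = ((2 * C * V.toNNReal : ℝ≥0) : ℝ≥0∞) * sobolevNorm g B 2 a := by
        push_cast; rw [ENNReal.coe_toNNReal hVtop]; ring
    _ ≤ _ := by gcongr; exact le_self_add

end Embedding

/-! ### Leibniz rule for traces and differentials of functions -/

section Stokes

variable {Ω : Set E3} {i : Fin 3} {f h f' h' : E3 → Matrix (Fin 2) (Fin 2) ℂ}

/-- The weak Leibniz rule for the trace of a product. -/
lemma IsWeakPartial.integral_trace_mul (hΩ : IsOpen Ω) (H : IsWeakPartial Ω i f h)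
    (H' : IsWeakPartial Ω i f' h') (hf : ∀ r s, MemLpLoc Ω 3 fun y => f y r s)
    (hh : ∀ r s, MemLpLoc Ω (3 / 2) fun y => h y r s)
    (hf' : ∀ r s, MemLpLoc Ω 3 fun y => f' y r s)
    (hh' : ∀ r s, MemLpLoc Ω (3 / 2) fun y => h' y r s)
    {φ : E3 → ℝ} (hφ : ContDiff ℝ ∞ φ) (hc : HasCompactSupport φ) (hs : tsupport φ ⊆ Ω) :
    Integrable (fun y => φ y * (trace (h y * f' y + f y * h' y)).re) ∧
    Integrable (fun y => fderiv ℝ φ y (EuclideanSpace.single i (1 : ℝ)) * (trace (f y * f' y)).re) ∧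
    ∫ y, φ y * (trace (h y * f' y + f y * h' y)).re =
      - ∫ y, fderiv ℝ φ y (EuclideanSpace.single i (1 : ℝ)) * (trace (f y * f' y)).re := by
  have key := fun r s => WeakPartial.integral_mul hΩ (H r s) (H' s r) (hf r s) (hh r s) (hf' s r)
    (hh' s r) hφ hc hs
  have e1 : (fun y => φ y * (trace (h y * f' y + f y * h' y)).re) = fun y =>
      Complex.reCLM (∑ r, ∑ s, (φ y : ℂ) * (h y r s * f' y s r + f y r s * h' y s r)) := by
    ext y
    simp only [trace, Matrix.diag, Matrix.add_apply, Matrix.mul_apply, Fin.sum_univ_two, Complex.reCLM_apply,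
      Complex.add_re, Complex.re_ofReal_mul]
    ring
  have e2 : (fun y => fderiv ℝ φ y (EuclideanSpace.single i (1 : ℝ)) * (trace (f y * f' y)).re) = fun y =>
      Complex.reCLM (∑ r, ∑ s, ((fderiv ℝ φ y (EuclideanSpace.single i (1 : ℝ)) : ℝ) : ℂ) *
        (f y r s * f' y s r)) := by
    ext y
    simp only [trace, Matrix.diag, Matrix.mul_apply, Fin.sum_univ_two, Complex.reCLM_apply,
      Complex.add_re, Complex.re_ofReal_mul]
    ring
  have I1 : Integrable fun y => ∑ r, ∑ s, (φ y : ℂ) * (h y r s * f' y s r + f y r s * h' y s r) :=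
    integrable_finsetSum _ fun r _ => integrable_finsetSum _ fun s _ => (key r s).1
  have I2 : Integrable fun y => ∑ r, ∑ s, ((fderiv ℝ φ y (EuclideanSpace.single i (1 : ℝ)) : ℝ) : ℂ) *
        (f y r s * f' y s r) :=
    integrable_finsetSum _ fun r _ => integrable_finsetSum _ fun s _ => (key r s).2.1
  rw [e1, e2]
  refine ⟨Complex.reCLM.integrable_comp I1, Complex.reCLM.integrable_comp I2, ?_⟩
  rw [ContinuousLinearMap.integral_comp_comm _ I1, ContinuousLinearMap.integral_comp_comm _ I2,
    ← map_neg]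
  congr 1
  rw [integral_finsetSum _ fun r _ => integrable_finsetSum _ fun s _ => (key r s).1,
    integral_finsetSum _ fun r _ => integrable_finsetSum _ fun s _ => (key r s).2.1,
    ← Finset.sum_neg_distrib]
  refine Finset.sum_congr rfl fun r _ => ?_
  rw [integral_finsetSum _ fun s _ => (key r s).1, integral_finsetSum _ fun s _ => (key r s).2.1,
    ← Finset.sum_neg_distrib]
  exact Finset.sum_congr rfl fun s _ => (key r s).2.2

variable {M : Type*} [TopologicalSpace M] [ChartedSpace E3 M] [IsManifold 𝓘(ℝ, E3) ∞ M]
  {e : OpenPartialHomeomorph M E3}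

/-- The differential of a function, as a linear form on the tangent space. -/
def diff (χ : M → ℝ) (x : M) : TangentSpace 𝓘(ℝ, E3) x →ₗ[ℝ] ℝ :=
  (NormedSpace.fromTangentSpace (𝕜 := ℝ) (χ x)).toLinearEquiv.toLinearMap ∘ₗ
    (mfderiv 𝓘(ℝ, E3) 𝓘(ℝ) χ x).toLinearMap

lemma diff_coordVec (he : e ∈ atlas E3 M) {χ : M → ℝ} (hχ : ContMDiff 𝓘(ℝ, E3) 𝓘(ℝ) ∞ χ) {y : E3}
    (hy : y ∈ e.target) (i : Fin 3) : diff χ (e.symm y) (coordVec e (e.symm y) i) =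
      fderiv ℝ (fun z => χ (e.symm z)) y (EuclideanSpace.single i (1 : ℝ)) := by
  rw [coordVec_eq_mfderiv_symm he hy, ← mfderiv_eq_fderiv]
  have h := mfderiv_comp (I := 𝓘(ℝ, E3)) (I' := 𝓘(ℝ, E3)) (I'' := 𝓘(ℝ)) y
    ((hχ.mdifferentiable (by simp)) (e.symm y)) ((mdifferentiable_chart he).mdifferentiableAt_symm hy)
  have h' : mfderiv 𝓘(ℝ, E3) 𝓘(ℝ) (fun z => χ (e.symm z)) y = _ := h
  rw [h']
  rfl

/-- `∑ dχₖ = 0` for a smooth partition of unity. -/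
lemma sum_diff_eq_zero {ι : Type*} [Fintype ι] {χ : ι → M → ℝ}
    (hχ : ∀ k, ContMDiff 𝓘(ℝ, E3) 𝓘(ℝ) ∞ (χ k)) (h1 : ∀ x, ∑ k, χ k x = 1) (x : M)
    (v : TangentSpace 𝓘(ℝ, E3) x) : ∑ k, diff (χ k) x v = 0 := by
  suffices h : ∀ e ∈ atlas E3 M, ∀ y ∈ e.target, ∑ k, diff (χ k) (e.symm y) = 0 by
    have hx := mem_chart_source E3 x
    have h2 := h _ (chart_mem_atlas E3 x) _ ((chartAt E3 x).map_source hx)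
    rw [(chartAt E3 x).left_inv hx] at h2
    simpa using LinearMap.congr_fun h2 v
  intro e he y hy
  refine (coordBasis he (e.map_target hy)).ext fun i => ?_
  rw [coe_coordBasis, LinearMap.sum_apply]
  simp only [diff_coordVec he (hχ _) hy, LinearMap.zero_apply]
  have hd : ∀ k ∈ Finset.univ, DifferentiableAt ℝ (fun z => χ k (e.symm z)) y := fun k _ =>
    ((contDiffOn_comp_chart_symm he (hχ k)).contDiffAt (e.open_target.mem_nhds hy)).differentiableAt
      (by simp)
  have h2 := fderiv_fun_sum hd
  simp only [h1] at h2
  rw [fderiv_fun_const] at h2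
  have h3 := congrArg (fun L => L (EuclideanSpace.single i (1 : ℝ))) h2
  simpa using h3.symm

lemma diff_eq_zero {χ : M → ℝ} {x : M} (hx : x ∉ tsupport χ) : diff χ x = 0 := by
  have h : χ =ᶠ[𝓝 x] fun _ => 0 := notMem_tsupport_iff_eventuallyEq.1 hx
  rw [diff, h.mfderiv_eq, mfderiv_const]
  rfl

/-- The three-form `dχ ∧ tr (A ∧ B)`. -/
def diffWedgeTrace (χ : M → ℝ) (A B : OneForm M) (x : M)
    (b : Fin 3 → TangentSpace 𝓘(ℝ, E3) x) : ℝ :=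
  (suInner (A x (b 1)) (B x (b 0)) - suInner (A x (b 0)) (B x (b 1))) * diff χ x (b 2) +
  (suInner (A x (b 2)) (B x (b 1)) - suInner (A x (b 1)) (B x (b 2))) * diff χ x (b 0) +
  (suInner (A x (b 0)) (B x (b 2)) - suInner (A x (b 2)) (B x (b 0))) * diff χ x (b 1)

lemma isThreeForm_diffWedgeTrace (χ : M → ℝ) (A B : OneForm M) (x : M) :
    IsThreeForm (diffWedgeTrace χ A B x) := by
  let τ : TangentSpace 𝓘(ℝ, E3) x →ₗ[ℝ] TangentSpace 𝓘(ℝ, E3) x →ₗ[ℝ]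
      TangentSpace 𝓘(ℝ, E3) x →ₗ[ℝ] ℝ :=
    LinearMap.mk₂ ℝ (fun u v => (suForm (A x v) (B x u) - suForm (A x u) (B x v)) • diff χ x)
      (fun u u' v => by ext; simp; ring) (fun c u v => by ext; simp; ring)
      (fun u v v' => by ext; simp; ring) (fun c u v => by ext; simp; ring)
  exact isThreeForm_cyclic τ fun u v w => by
    simp only [τ, LinearMap.mk₂_apply, LinearMap.smul_apply, smul_eq_mul]; ring

/-! ### The sign of a chart -/

variable (g : RMetric M) (o : MfdOrientation M)

lemma eventually_frameSign_eq {y : E3} (hy : y ∈ e.target) (he : e ∈ atlas E3 M) :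
    ∀ᶠ z in 𝓝 y, frameSign o (coordVec e (e.symm z)) = frameSign o (coordVec e (e.symm y)) := by
  filter_upwards [(e.continuousAt_symm hy).eventually (o.locConst e he _ (e.map_target hy))] with z hz
  simp only [frameSign]
  split_ifs with h1 h2 h2
  exacts [rfl, absurd (hz.1 h1) h2, absurd (hz.2 h2) h1, rfl]

lemma contDiffOn_frameSign (he : e ∈ atlas E3 M) :
    ContDiffOn ℝ ∞ (fun y => frameSign o (coordVec e (e.symm y))) e.target := fun _ hy =>
  (contDiffAt_const.congr_of_eventuallyEq (eventually_frameSign_eq o hy he)).contDiffWithinAt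

/-- The cutoff function `χ` in the coordinates of the chart `e`, multiplied by the sign of the
orientation of the chart. This sign is locally constant, so that the product is a test function. -/
def signedCutoff (e : OpenPartialHomeomorph M E3) (χ : M → ℝ) : E3 → ℝ :=
  e.target.indicator fun y => frameSign o (coordVec e (e.symm y)) * χ (e.symm y)

lemma fderiv_signedCutoff (he : e ∈ atlas E3 M) {χ : M → ℝ}
    (hχ : ContMDiff 𝓘(ℝ, E3) 𝓘(ℝ) ∞ χ) {y : E3} (hy : y ∈ e.target) (i : Fin 3) :
    fderiv ℝ (signedCutoff o e χ) y (EuclideanSpace.single i (1 : ℝ)) =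
      frameSign o (coordVec e (e.symm y)) * diff χ (e.symm y) (coordVec e (e.symm y) i) := by
  have h : signedCutoff o e χ =ᶠ[𝓝 y]
      fun z => frameSign o (coordVec e (e.symm y)) * χ (e.symm z) := by
    filter_upwards [eventually_frameSign_eq o hy he, e.open_target.mem_nhds hy] with z hz hzt
    rw [signedCutoff, indicator_of_mem hzt, hz]
  have hd : DifferentiableAt ℝ (fun z => χ (e.symm z)) y :=
    ((contDiffOn_comp_chart_symm he hχ).contDiffAt (e.open_target.mem_nhds hy)).differentiableAt
      (by simp)
  rw [h.fderiv_eq, fderiv_const_mul hd, diff_coordVec he hχ hy]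
  rfl

/-- The coordinate form of a density: multiplication by `√(det g)` removes the metric. -/
lemma formDensity_chart (he : e ∈ atlas E3 M)
    {η : (x : M) → (Fin 3 → TangentSpace 𝓘(ℝ, E3) x) → ℝ} {y : E3} (hy : y ∈ e.target)
    (h : IsThreeForm (η (e.symm y))) :
    √(gMat g e y).det * formDensity g o η (e.symm y) =
      frameSign o (coordVec e (e.symm y)) * η (e.symm y) (coordVec e (e.symm y)) := by
  have := formDensity_eq_basis g o h (coordBasis he (e.map_target hy))
  rw [coe_coordBasis] at this
  rw [this]
  have h0 : √(gMat g e y).det ≠ 0 := (Real.sqrt_pos.2 (gMat_det_pos g he hy)).ne'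
  rw [mul_comm]
  exact div_mul_cancel₀ _ h0

variable [CompactSpace M]

lemma signedCutoff_testFunction (he : e ∈ atlas E3 M) {χ : M → ℝ}
    (hχ : ContMDiff 𝓘(ℝ, E3) 𝓘(ℝ) ∞ χ) (hs : tsupport χ ⊆ e.source) :
    ContDiff ℝ ∞ (signedCutoff o e χ) ∧ HasCompactSupport (signedCutoff o e χ) ∧
      tsupport (signedCutoff o e χ) ⊆ e.target := by
  obtain ⟨hK, hKe⟩ := isCompact_chart_image_tsupport e hs
  obtain ⟨h1, h2, h3⟩ := testFunction_indicator e hK hKe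
    ((contDiffOn_frameSign o he).mul (contDiffOn_comp_chart_symm he hχ))
    fun y hy h => by
      show frameSign o (coordVec e (e.symm y)) * χ (e.symm y) = 0
      rw [eq_zero_of_notMem_chart_image e hy h, mul_zero]
  exact ⟨h1, h2, h3.trans hKe⟩

variable [MeasurableSpace M] [BorelSpace M]

lemma aestronglyMeasurable_formDensity {η : (x : M) → (Fin 3 → TangentSpace 𝓘(ℝ, E3) x) → ℝ}
    (h : ∀ x, IsThreeForm (η x))
    (hm : ∀ e ∈ atlas E3 M, AEStronglyMeasurable
      (fun y => η (e.symm y) (coordVec e (e.symm y))) (volume.restrict e.target)) :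
    AEStronglyMeasurable (formDensity g o η) (riemVolume g) := by
  refine aestronglyMeasurable_of_chart g fun e he => ?_
  have h1 : AEStronglyMeasurable (fun y => (√(gMat g e y).det)⁻¹ *
      (frameSign o (coordVec e (e.symm y)) * η (e.symm y) (coordVec e (e.symm y))))
      (volume.restrict e.target) :=
    ((continuousOn_volumeDensity g he).inv₀ fun y hy =>
      (Real.sqrt_pos.2 (gMat_det_pos g he hy)).ne').aestronglyMeasurable e.open_target.measurableSet
      |>.mul (((contDiffOn_frameSign o he).continuousOn.aestronglyMeasurable
        e.open_target.measurableSet).mul (hm e he))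
  refine h1.congr ?_
  filter_upwards [ae_restrict_mem e.open_target.measurableSet] with y hy
  rw [← formDensity_chart g o he hy (h _), inv_mul_cancel_left₀
    (Real.sqrt_pos.2 (gMat_det_pos g he hy)).ne']

lemma MeasComp₂.aestronglyMeasurable_trWedge {Ψ : TwoTensor M} {a : OneForm M} (hΨ : MeasComp₂ Ψ)
    (ha : MeasComp₁ a) (h : ∀ x, IsAltAt Ψ x) :
    AEStronglyMeasurable (formDensity g o (trWedge Ψ a)) (riemVolume g) := by
  refine aestronglyMeasurable_formDensity g o (fun x => isThreeForm_trWedge (h x) a) fun e he => ?_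
  simp only [trWedge_eq]
  exact (((aestronglyMeasurable_suInner (hΨ e he 0 1) (ha e he 2)).add
    (aestronglyMeasurable_suInner (hΨ e he 1 2) (ha e he 0))).add
    (aestronglyMeasurable_suInner (hΨ e he 2 0) (ha e he 1))).neg

lemma MeasComp₁.aestronglyMeasurable_diffWedgeTrace {χ : M → ℝ}
    (hχ : ContMDiff 𝓘(ℝ, E3) 𝓘(ℝ) ∞ χ) {A B : OneForm M} (hA : MeasComp₁ A) (hB : MeasComp₁ B) :
    AEStronglyMeasurable (formDensity g o (diffWedgeTrace χ A B)) (riemVolume g) := by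
  refine aestronglyMeasurable_formDensity g o (isThreeForm_diffWedgeTrace χ A B) fun e he => ?_
  have hd : ∀ i, AEStronglyMeasurable (fun y => diff χ (e.symm y) (coordVec e (e.symm y) i))
      (volume.restrict e.target) := by
    intro i
    have h1 : AEStronglyMeasurable (fun y => fderiv ℝ (fun z => χ (e.symm z)) y
        (EuclideanSpace.single i (1 : ℝ))) (volume.restrict e.target) :=
      (((contDiffOn_comp_chart_symm he hχ).continuousOn_fderiv_of_isOpen e.open_target
        (by simp)).clm_apply continuousOn_const).aestronglyMeasurable e.open_target.measurableSet
    refine h1.congr ?_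
    filter_upwards [ae_restrict_mem e.open_target.measurableSet] with y hy
    exact (diff_coordVec he hχ hy i).symm
  have hs : ∀ i j, AEStronglyMeasurable (fun y => suInner (A (e.symm y) (coordVec e (e.symm y) i))
      (B (e.symm y) (coordVec e (e.symm y) j))) (volume.restrict e.target) := fun i j =>
    aestronglyMeasurable_suInner (hA e he i) (hB e he j)
  exact (((hs 1 0).sub (hs 0 1)).mul (hd 2)).add (((hs 2 1).sub (hs 1 2)).mul (hd 0)) |>.add
    (((hs 0 2).sub (hs 2 0)).mul (hd 1))

variable [T2Space M]

lemma integrable_riemVolume_of_chart (he : e ∈ atlas E3 M) {f : M → ℝ}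
    (hf : AEStronglyMeasurable f (riemVolume g)) (h0 : ∀ x ∉ e.source, f x = 0)
    (hi : IntegrableOn (fun y => √(gMat g e y).det * f (e.symm y)) e.target) :
    Integrable f (riemVolume g) := by
  rw [← integrableOn_iff_integrable_of_support_subset (s := e.source)
    (fun x hx => by by_contra hxs; exact hx (h0 x hxs))]
  have hf' := hf.restrict (s := e.source)
  rw [IntegrableOn]
  rw [riemVolume_restrict_source g he, chartVolume_eq_map] at hf' ⊢
  rw [integrable_map_measure hf' (aemeasurable_chart_symm' g e), targetVolume,
    integrable_withDensity_iff_integrable_smul₀' (aemeasurable_volumeDensity g he)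
      (ae_of_all _ fun _ => ENNReal.ofReal_lt_top)]
  refine hi.congr (ae_of_all _ fun y => ?_)
  simp [ENNReal.toReal_ofReal (Real.sqrt_nonneg _)]

end Stokes

/-! ### Stokes' theorem -/

section StokesManifold

variable {M : Type*} [TopologicalSpace M] [ChartedSpace E3 M] [IsManifold 𝓘(ℝ, E3) ∞ M]
  {e : OpenPartialHomeomorph M E3} {g : RMetric M} (o : MfdOrientation M)
  [MeasurableSpace M] [BorelSpace M] [CompactSpace M]
  {A B a : OneForm M} {Ψ Φ : TwoTensor M} {p q : ℝ≥0∞}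

omit [IsManifold 𝓘(ℝ, E3) ∞ M] [MeasurableSpace M] [BorelSpace M] [CompactSpace M] in
lemma MeasComp₂.altTensor (h : MeasComp₂ Ψ) : MeasComp₂ (altTensor Ψ) := fun e he i j r s =>
  (h e he i j r s).sub (h e he j i r s)

lemma MeasComp₂.memLp_normForm₂_altTensor (h : MeasComp₂ Ψ)
    (h' : MemLp (CSBound.norm₂ g Ψ) p (riemVolume g)) :
    MemLp (CSBound.normForm₂ g (CSBound.altTensor Ψ)) p (riemVolume g) := by
  refine (h'.const_mul 2).mono' (h.altTensor.normForm₂ g) (ae_of_all _ fun x => ?_)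
  rw [Real.norm_of_nonneg (normForm₂_nonneg g _)]
  exact normForm₂_altTensor_le g Ψ

lemma integrable_formDensity_trWedge [ENNReal.HolderTriple p q 1] (hΨ : MeasComp₂ Ψ)
    (ha : MeasComp₁ a) (h : ∀ x, IsAltAt Ψ x) (h1 : MemLp (normForm₂ g Ψ) p (riemVolume g))
    (h2 : MemLp (norm₁ g a) q (riemVolume g)) :
    Integrable (formDensity g o (trWedge Ψ a)) (riemVolume g) := by
  have h3 : Integrable (normForm₂ g Ψ * norm₁ g a) (riemVolume g) :=
    memLp_one_iff_integrable.1 (h2.mul h1)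
  exact h3.mono' (hΨ.aestronglyMeasurable_trWedge g o ha h)
    (ae_of_all _ fun x => abs_formDensity_trWedge_le g o (h x) a)

variable [T2Space M]

lemma memLpLoc_oneComp (he : e ∈ atlas E3 M) (ha : MeasComp₁ a) (hp : p ≠ ⊤)
    (h : MemLp (norm₁ g a) p (riemVolume g)) (i : Fin 3) (r s : Fin 2) :
    MemLpLoc e.target p fun y => oneComp e a i y r s := by
  intro K hKe hK
  obtain ⟨C, hC⟩ := exists_component_bounds g he hK hKe
  obtain ⟨C', hC'⟩ := exists_eLpNorm_bounds g he hK hKe hp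
  have h1 : MemLp (fun y => norm₁ g a (e.symm y)) p (volume.restrict K) :=
    ⟨(ha.norm₁_chart g he).mono_measure (Measure.restrict_mono hKe le_rfl),
      (hC' _ (ha.norm₁ g)).2.trans_lt (ENNReal.mul_lt_top ENNReal.coe_lt_top h.2)⟩
  refine (h1.const_mul (C : ℝ)).mono' ((ha e he i r s).mono_measure (Measure.restrict_mono hKe le_rfl)) ?_
  filter_upwards [ae_restrict_mem hK.measurableSet] with y hy
  exact (hC y hy).1 a i r s

lemma memLpLoc_twoComp (he : e ∈ atlas E3 M) (hΨ : MeasComp₂ Ψ) (hp : p ≠ ⊤)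
    (h : MemLp (norm₂ g Ψ) p (riemVolume g)) (i j : Fin 3) (r s : Fin 2) :
    MemLpLoc e.target p fun y => twoComp e Ψ i j y r s := by
  intro K hKe hK
  obtain ⟨C, hC⟩ := exists_component_bounds g he hK hKe
  obtain ⟨C', hC'⟩ := exists_eLpNorm_bounds g he hK hKe hp
  have h1 : MemLp (fun y => norm₂ g Ψ (e.symm y)) p (volume.restrict K) :=
    ⟨(Real.continuous_sqrt.comp_aestronglyMeasurable (hΨ.normSq₂_chart g he)).mono_measure
      (Measure.restrict_mono hKe le_rfl),
      (hC' _ (hΨ.norm₂ g)).2.trans_lt (ENNReal.mul_lt_top ENNReal.coe_lt_top h.2)⟩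
  refine (h1.const_mul (C : ℝ)).mono' ((hΨ e he i j r s).mono_measure (Measure.restrict_mono hKe le_rfl)) ?_
  filter_upwards [ae_restrict_mem hK.measurableSet] with y hy
  exact (hC y hy).2.2.1 Ψ i j r s

/-- In a chart the weak partial derivatives of the components are the components of `∇a` up to
Christoffel terms, and thus as integrable as `a` and `∇a`. -/
lemma memLpLoc_partial (he : e ∈ atlas E3 M) (H : IsWeakCovDeriv g 0 a Ψ) (hp : p ≠ ⊤)
    (h1 : MemLp (norm₁ g a) p (riemVolume g)) (h2 : MemLp (norm₂ g Ψ) p (riemVolume g))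
    {h : Fin 3 → Fin 3 → E3 → Matrix (Fin 2) (Fin 2) ℂ}
    (hh : ∀ᵐ y ∂(volume.restrict e.target), ∀ i j, twoComp e Ψ i j y =
      h i j y - ∑ k, christoffel g e k i j y • oneComp e a k y +
        ⁅oneComp e (0 : OneForm M) i y, oneComp e a j y⁆)
    (i j : Fin 3) (r s : Fin 2) : MemLpLoc e.target p fun y => h i j y r s := by
  intro K hKe hK
  obtain ⟨C, hC⟩ := exists_component_bounds g he hK hKe
  have hk : ∀ k, MemLp (fun y => (christoffel g e k i j y : ℂ) * oneComp e a k y r s) p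
      (volume.restrict K) := by
    intro k
    have h3 := memLpLoc_oneComp he H.measComp₁ hp h1 k r s K hKe hK
    refine (h3.norm.const_mul (C : ℝ)).mono'
      (((Complex.continuous_ofReal.comp_aestronglyMeasurable
        (aestronglyMeasurable_christoffel he k i j)).mono_measure
          (Measure.restrict_mono hKe le_rfl)).mul h3.1) ?_
    filter_upwards [ae_restrict_mem hK.measurableSet] with y hy
    rw [norm_mul, Complex.norm_real]
    exact mul_le_mul_of_nonneg_right ((hC y hy).2.2.2 k i j) (norm_nonneg _)
  refine ((memLpLoc_twoComp he H.measComp₂ hp h2 i j r s K hKe hK).add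
    (memLp_finsetSum Finset.univ fun k _ => hk k)).ae_eq ?_
  filter_upwards [ae_mono (Measure.restrict_mono hKe le_rfl) hh] with y hy
  rw [Pi.add_apply, hy i j, oneComp_zero, zero_lie, add_zero, Matrix.sub_apply, Matrix.sum_apply]
  simp

/-- Stokes' theorem for `χ tr (A ∧ B)`, where `χ` is supported in a chart. -/
lemma chart_stokes (he : e ∈ atlas E3 M) {χ : M → ℝ} (hχ : ContMDiff 𝓘(ℝ, E3) 𝓘(ℝ) ∞ χ)
    (hs : tsupport χ ⊆ e.source)
    (HA : IsWeakCovDeriv g 0 A Ψ) (HB : IsWeakCovDeriv g 0 B Φ)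
    (hA : MemLp (norm₁ g A) 3 (riemVolume g)) (hB : MemLp (norm₁ g B) 3 (riemVolume g))
    (hA' : MemLp (norm₁ g A) (3 / 2) (riemVolume g)) (hB' : MemLp (norm₁ g B) (3 / 2) (riemVolume g))
    (hΨ : MemLp (norm₂ g Ψ) (3 / 2) (riemVolume g)) (hΦ : MemLp (norm₂ g Φ) (3 / 2) (riemVolume g)) :
    Integrable (formDensity g o (diffWedgeTrace χ A B)) (riemVolume g) ∧
    ∫ x, χ x * (formDensity g o (trWedge (altTensor Ψ) B) x -
        formDensity g o (trWedge (altTensor Φ) A) x) ∂(riemVolume g) =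
      - ∫ x, formDensity g o (diffWedgeTrace χ A B) x ∂(riemVolume g) := by
  obtain ⟨hψ, hc, hsub⟩ := signedCutoff_testFunction o he hχ hs
  have hψt : ∀ y ∈ e.target, signedCutoff o e χ y = frameSign o (coordVec e (e.symm y)) * χ (e.symm y) :=
    fun y hy => indicator_of_mem hy _
  have hdψ := fun y hy i => fderiv_signedCutoff o he hχ (y := y) hy i
  have hψ0 : ∀ y ∉ e.target, signedCutoff o e χ y = 0 := fun y hy => indicator_of_notMem hy _
  have hdψ0 : ∀ y ∉ e.target, ∀ i, fderiv ℝ (signedCutoff o e χ) y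
      (EuclideanSpace.single i (1 : ℝ)) = 0 := fun y hy i =>
    image_eq_zero_of_notMem_tsupport (f := fun y => fderiv ℝ (signedCutoff o e χ) y
      (EuclideanSpace.single i (1 : ℝ))) fun hh => hy (hsub (tsupport_partial_subset _ i hh))
  set ψ := signedCutoff o e χ
  obtain ⟨h, h1, h2⟩ := HA e he
  obtain ⟨k, k1, k2⟩ := HB e he
  have key := fun i j l => (h1 i j).integral_trace_mul e.open_target (k1 i l)
    (memLpLoc_oneComp he HA.measComp₁ (by simp) hA j)
    (memLpLoc_partial he HA three_halves_ne_top hA' hΨ h2 i j)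
    (memLpLoc_oneComp he HB.measComp₁ (by simp) hB l)
    (memLpLoc_partial he HB three_halves_ne_top hB' hΦ k2 i l) hψ hc hsub
  set T : Fin 3 → Fin 3 → Fin 3 → E3 → ℝ := fun i j l y =>
    ψ y * (trace (h i j y * oneComp e B l y + oneComp e A j y * k i l y)).re with hT
  set S : Fin 3 → Fin 3 → Fin 3 → E3 → ℝ := fun i j l y =>
    fderiv ℝ ψ y (EuclideanSpace.single i (1 : ℝ)) * (trace (oneComp e A j y * oneComp e B l y)).re with hS
  have IT : ∀ i j l, Integrable (T i j l) := fun i j l => (key i j l).1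
  have IS : ∀ i j l, Integrable (S i j l) := fun i j l => (key i j l).2.1
  have ITS : ∀ i j l, ∫ y, T i j l y = - ∫ y, S i j l y := fun i j l => (key i j l).2.2
  have hS' : ∀ y ∈ e.target, √(gMat g e y).det * formDensity g o (diffWedgeTrace χ A B) (e.symm y) =
      S 0 1 2 y - S 0 2 1 y + (S 1 2 0 y - S 1 0 2 y) + (S 2 0 1 y - S 2 1 0 y) := by
    intro y hy
    rw [formDensity_chart g o he hy (isThreeForm_diffWedgeTrace χ A B _)]
    simp only [hS, hdψ y hy, diffWedgeTrace, oneComp, re_trace_mul]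
    ring
  have hSint : Integrable fun y => S 0 1 2 y - S 0 2 1 y + (S 1 2 0 y - S 1 0 2 y) +
      (S 2 0 1 y - S 2 1 0 y) :=
    (((IS 0 1 2).sub (IS 0 2 1)).add ((IS 1 2 0).sub (IS 1 0 2))).add ((IS 2 0 1).sub (IS 2 1 0))
  have hmD := HA.measComp₁.aestronglyMeasurable_diffWedgeTrace g o hχ HB.measComp₁
  have hD0 : ∀ x ∉ e.source, formDensity g o (diffWedgeTrace χ A B) x = 0 := by
    intro x hx
    simp [formDensity, diffWedgeTrace, diff_eq_zero fun hh => hx (hs hh)]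
  have hae : ∀ᵐ y ∂(volume.restrict e.target),
      √(gMat g e y).det * (χ (e.symm y) * (formDensity g o (trWedge (altTensor Ψ) B) (e.symm y) -
        formDensity g o (trWedge (altTensor Φ) A) (e.symm y))) =
      T 0 1 2 y - T 0 2 1 y + (T 1 2 0 y - T 1 0 2 y) + (T 2 0 1 y - T 2 1 0 y) := by
    filter_upwards [ae_restrict_mem e.open_target.measurableSet, h2, k2] with y hy hy2 hyk
    have c1 := formDensity_chart g o he hy (isThreeForm_trWedge (isAltAt_altTensor Ψ) B)
    have c2 := formDensity_chart g o he hy (isThreeForm_trWedge (isAltAt_altTensor Φ) A)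
    -- The Christoffel symbols are symmetric and cancel in the skew part of `∇A`.
    have d1 : ∀ i j, twoComp e (altTensor Ψ) i j y = h i j y - h j i y := fun i j => by
      rw [twoComp_altTensor, hy2 i j, hy2 j i]
      simp only [christoffel_symm g _ i j, oneComp_zero, zero_lie]
      abel
    have d2 : ∀ i j, twoComp e (altTensor Φ) i j y = k i j y - k j i y := fun i j => by
      rw [twoComp_altTensor, hyk i j, hyk j i]
      simp only [christoffel_symm g _ i j, oneComp_zero, zero_lie]
      abel
    have w1 : trWedge (altTensor Ψ) B (e.symm y) (coordVec e (e.symm y)) =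
        (trace ((h 0 1 y - h 1 0 y) * oneComp e B 2 y + (h 1 2 y - h 2 1 y) * oneComp e B 0 y +
          (h 2 0 y - h 0 2 y) * oneComp e B 1 y)).re := by
      rw [← d1, ← d1, ← d1]; rfl
    have w2 : trWedge (altTensor Φ) A (e.symm y) (coordVec e (e.symm y)) =
        (trace ((k 0 1 y - k 1 0 y) * oneComp e A 2 y + (k 1 2 y - k 2 1 y) * oneComp e A 0 y +
          (k 2 0 y - k 0 2 y) * oneComp e A 1 y)).re := by
      rw [← d2, ← d2, ← d2]; rfl
    rw [w1] at c1
    rw [w2] at c2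
    have e1 : √(gMat g e y).det * (χ (e.symm y) * (formDensity g o (trWedge (altTensor Ψ) B) (e.symm y) -
        formDensity g o (trWedge (altTensor Φ) A) (e.symm y))) = χ (e.symm y) *
        (√(gMat g e y).det * formDensity g o (trWedge (altTensor Ψ) B) (e.symm y) -
        √(gMat g e y).det * formDensity g o (trWedge (altTensor Φ) A) (e.symm y)) := by ring
    rw [e1, c1, c2]
    simp only [hT, hψt y hy, trace_add, sub_mul, trace_sub, Complex.add_re, Complex.sub_re,
      trace_mul_comm (k _ _ y)]
    ring
  have hmF : AEStronglyMeasurable (fun x => χ x * (formDensity g o (trWedge (altTensor Ψ) B) x -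
        formDensity g o (trWedge (altTensor Φ) A) x)) (riemVolume g) :=
    hχ.continuous.aestronglyMeasurable.mul
      ((HA.measComp₂.altTensor.aestronglyMeasurable_trWedge g o HB.measComp₁
        fun x => isAltAt_altTensor Ψ).sub
      (HB.measComp₂.altTensor.aestronglyMeasurable_trWedge g o HA.measComp₁
        fun x => isAltAt_altTensor Φ))
  have hset : ∀ y, y ∉ e.target → ∀ i j l, T i j l y = 0 ∧ S i j l y = 0 := fun y hy i j l => by
    simp only [hT, hS, hψ0 y hy, hdψ0 y hy, zero_mul, and_self]
  refine ⟨integrable_riemVolume_of_chart g he hmD hD0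
    ((hSint.integrableOn (s := e.target)).congr_fun (fun y hy => (hS' y hy).symm)
      e.open_target.measurableSet), ?_⟩
  rw [integral_riemVolume_eq g he hmF fun x hx => by
      rw [image_eq_zero_of_notMem_tsupport fun hh => hx (hs hh), zero_mul],
    integral_riemVolume_eq g he hmD hD0, integral_congr_ae hae,
    setIntegral_congr_fun e.open_target.measurableSet hS',
    setIntegral_eq_integral_of_forall_compl_eq_zero fun y hy => by simp [hset y hy],
    setIntegral_eq_integral_of_forall_compl_eq_zero fun y hy => by simp [hset y hy]]
  have hlin : ∀ R : Fin 3 → Fin 3 → Fin 3 → E3 → ℝ, (∀ i j l, Integrable (R i j l)) →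
      ∫ y, R 0 1 2 y - R 0 2 1 y + (R 1 2 0 y - R 1 0 2 y) + (R 2 0 1 y - R 2 1 0 y) =
        (∫ y, R 0 1 2 y) - (∫ y, R 0 2 1 y) + ((∫ y, R 1 2 0 y) - ∫ y, R 1 0 2 y) +
          ((∫ y, R 2 0 1 y) - ∫ y, R 2 1 0 y) := by
    intro R IR
    have J : ∀ i j l i' j' l', Integrable fun y => R i j l y - R i' j' l' y :=
      fun i j l i' j' l' => (IR i j l).sub (IR i' j' l')
    have J2 : Integrable fun y => R 0 1 2 y - R 0 2 1 y + (R 1 2 0 y - R 1 0 2 y) :=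
      (J 0 1 2 0 2 1).add (J 1 2 0 1 0 2)
    rw [integral_add J2 (J 2 0 1 2 1 0), integral_add (J 0 1 2 0 2 1) (J 1 2 0 1 0 2),
      integral_sub (IR 0 1 2) (IR 0 2 1), integral_sub (IR 1 2 0) (IR 1 0 2),
      integral_sub (IR 2 0 1) (IR 2 1 0)]
  rw [hlin T IT, hlin S IS]
  simp only [ITS]
  ring

/-- Stokes' theorem `∫ tr (dA ∧ B) = ∫ tr (dB ∧ A)` for `A`, `B` in `L^{3/2}_1`. The forms
`dχ ∧ tr (A ∧ B)` that come from a partition of unity add up to zero. -/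
lemma integral_trWedge_comm (HA : IsWeakCovDeriv g 0 A Ψ) (HB : IsWeakCovDeriv g 0 B Φ)
    (hA : MemLp (norm₁ g A) 3 (riemVolume g)) (hB : MemLp (norm₁ g B) 3 (riemVolume g))
    (hA' : MemLp (norm₁ g A) (3 / 2) (riemVolume g)) (hB' : MemLp (norm₁ g B) (3 / 2) (riemVolume g))
    (hΨ : MemLp (norm₂ g Ψ) (3 / 2) (riemVolume g)) (hΦ : MemLp (norm₂ g Φ) (3 / 2) (riemVolume g)) :
    ∫ x, formDensity g o (trWedge (altTensor Ψ) B) x ∂(riemVolume g) =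
      ∫ x, formDensity g o (trWedge (altTensor Φ) A) x ∂(riemVolume g) := by
  obtain ⟨t, χ, hχ, hs, h1⟩ := exists_chart_partition M
  have I1 := integrable_formDensity_trWedge o HA.measComp₂.altTensor HB.measComp₁
    (fun x => isAltAt_altTensor Ψ) (HA.measComp₂.memLp_normForm₂_altTensor hΨ) hB
  have I2 := integrable_formDensity_trWedge o HB.measComp₂.altTensor HA.measComp₁
    (fun x => isAltAt_altTensor Φ) (HB.measComp₂.memLp_normForm₂_altTensor hΦ) hA
  have key := fun k : t => chart_stokes o (chart_mem_atlas E3 (k : M)) (hχ k) (hs k) HA HB hA hB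
    hA' hB' hΨ hΦ
  rw [← sub_eq_zero, ← integral_sub I1 I2]
  set F : M → ℝ := fun x => formDensity g o (trWedge (altTensor Ψ) B) x -
    formDensity g o (trWedge (altTensor Φ) A) x with hF
  have IF : ∀ k, Integrable (fun x => χ k x * F x) (riemVolume g) := by
    intro k
    obtain ⟨C, hC⟩ := isCompact_univ.exists_bound_of_continuousOn (hχ k).continuous.continuousOn
    exact (I1.sub I2).bdd_mul (c := C) (hχ k).continuous.aestronglyMeasurable
      (ae_of_all _ fun x => hC x (mem_univ x))
  calc ∫ x, F x ∂(riemVolume g) = ∫ x, ∑ k, χ k x * F x ∂(riemVolume g) := by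
        refine integral_congr_ae (ae_of_all _ fun x => ?_)
        simp only [← Finset.sum_mul, h1, one_mul]
    _ = ∑ k, - ∫ x, formDensity g o (diffWedgeTrace (χ k) A B) x ∂(riemVolume g) := by
        rw [integral_finsetSum _ fun k _ => IF k]
        exact Finset.sum_congr rfl fun k _ => (key k).2
    _ = - ∫ x, ∑ k, formDensity g o (diffWedgeTrace (χ k) A B) x ∂(riemVolume g) := by
        rw [Finset.sum_neg_distrib, integral_finsetSum _ fun k _ => (key k).1]
    _ = 0 := by
        have h0 : ∀ x, ∑ k, formDensity g o (diffWedgeTrace (χ k) A B) x = 0 := by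
          intro x
          simp only [formDensity, diffWedgeTrace, ← Finset.sum_div, ← Finset.mul_sum,
            Finset.sum_add_distrib, sum_diff_eq_zero hχ h1, mul_zero, add_zero, zero_div]
        simp only [h0, integral_zero, neg_zero]

end StokesManifold

/-! ### The difference of two Chern-Simons forms -/

/-- The trilinear form `⟨[X, Y], Z⟩` is cyclic, by the cyclicity of the trace. -/
lemma suInner_lie_cyclic (X Y Z : su2) : suInner ⁅X, Y⁆ Z = suInner ⁅Z, X⁆ Y := by
  have h : ∀ X Y Z : su2, suInner ⁅X, Y⁆ Z =
      - (trace (((X : Matrix (Fin 2) (Fin 2) ℂ) * (Y : Matrix (Fin 2) (Fin 2) ℂ) -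
        (Y : Matrix (Fin 2) (Fin 2) ℂ) * (X : Matrix (Fin 2) (Fin 2) ℂ)) *
          (Z : Matrix (Fin 2) (Fin 2) ℂ))).re := fun X Y Z => by
    have := re_trace_mul ⁅X, Y⁆ Z
    rw [LieSubalgebra.coe_bracket, Ring.lie_def] at this
    rw [this, neg_neg]
  rw [h, h, sub_mul, sub_mul, trace_sub, trace_sub, trace_mul_cycle (X : Matrix (Fin 2) (Fin 2) ℂ),
    trace_mul_cycle (Y : Matrix (Fin 2) (Fin 2) ℂ) (X : Matrix (Fin 2) (Fin 2) ℂ),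
    trace_mul_cycle (Z : Matrix (Fin 2) (Fin 2) ℂ) (Y : Matrix (Fin 2) (Fin 2) ℂ)]

section Difference

variable {M : Type*} [TopologicalSpace M] [ChartedSpace E3 M]

lemma wedgeSelf_apply (a : OneForm M) (x : M) (u v : TangentSpace 𝓘(ℝ, E3) x) :
    wedgeSelf a x u v = ⁅a x u, a x v⁆ := rfl

variable [IsManifold 𝓘(ℝ, E3) ∞ M] {g : RMetric M} (o : MfdOrientation M)
  {A B a : OneForm M} {Ψ Φ : TwoTensor M} {p q : ℝ≥0∞}

omit [IsManifold 𝓘(ℝ, E3) ∞ M] in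
lemma lieTensor_apply (B a : OneForm M) (x : M) (u v : TangentSpace 𝓘(ℝ, E3) x) :
    lieTensor B a x u v = ⁅B x u, a x v⁆ := rfl

omit [IsManifold 𝓘(ℝ, E3) ∞ M] in
lemma altTensor_apply (Ψ : TwoTensor M) (x : M) (u v : TangentSpace 𝓘(ℝ, E3) x) :
    altTensor Ψ x u v = Ψ x u v - Ψ x v u := rfl

lemma formDensity_def (η : (x : M) → (Fin 3 → TangentSpace 𝓘(ℝ, E3) x) → ℝ) (x : M) :
    formDensity g o η x =
      frameSign o (frame x) * η x (frame x) / √(gramMat g x (frame x)).det := rfl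

/-- The identity `CS(A) - CS(B) = tr ((F_A + F_B) ∧ a) - (1/3) tr (a ∧ a ∧ a)
+ (tr (dA ∧ B) - tr (dB ∧ A))` for `a = A - B`. -/
lemma csDensity_sub_csDensity {x : M} (hA : weakExtDeriv A x = altTensor Ψ x)
    (hB : weakExtDeriv B x = altTensor Φ x) :
    csDensity g o A x - csDensity g o B x =
      formDensity g o (trWedge (altTensor Ψ + wedgeSelf A) (A - B)) x +
      formDensity g o (trWedge (altTensor Φ + wedgeSelf B) (A - B)) x -
      1 / 3 * formDensity g o (trWedge (wedgeSelf (A - B)) (A - B)) x +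
      (formDensity g o (trWedge (altTensor Ψ) B) x - formDensity g o (trWedge (altTensor Φ) A) x) := by
  have key : ∀ b : Fin 3 → TangentSpace 𝓘(ℝ, E3) x,
      (trWedge (weakExtDeriv A) A x b + (2 / 3) * trWedge (wedgeSelf A) A x b) -
      (trWedge (weakExtDeriv B) B x b + (2 / 3) * trWedge (wedgeSelf B) B x b) =
      trWedge (altTensor Ψ + wedgeSelf A) (A - B) x b +
      trWedge (altTensor Φ + wedgeSelf B) (A - B) x b -
      1 / 3 * trWedge (wedgeSelf (A - B)) (A - B) x b +
      (trWedge (altTensor Ψ) B x b - trWedge (altTensor Φ) A x b) := by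
    intro b
    have r1 : ∀ U V W : OneForm M, suForm ⁅U x (b 1), V x (b 2)⁆ (W x (b 0)) =
      suForm ⁅W x (b 0), U x (b 1)⁆ (V x (b 2)) := fun U V W => suInner_lie_cyclic _ _ _
    have r2 : ∀ U V W : OneForm M, suForm ⁅U x (b 2), V x (b 0)⁆ (W x (b 1)) =
      suForm ⁅V x (b 0), W x (b 1)⁆ (U x (b 2)) := fun U V W => (suInner_lie_cyclic _ _ _).symm
    simp only [trWedge_eq, Pi.add_apply, LinearMap.add_apply, Pi.sub_apply, LinearMap.sub_apply,
      wedgeSelf_apply, ← suForm_apply, map_add, map_sub, lie_sub, sub_lie, r1, r2, hA, hB]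
    ring
  have h := key (frame x)
  simp only [csDensity, formDensity_def]
  linear_combination (frameSign o (frame x) / √(gramMat g x (frame x)).det) * h

/-- The curvatures in terms of `∇_B B` and `∇_B a`, where `a = A - B`:
`F_A + F_B = 2 Alt (∇_B B) - 2 B ∧ B + Alt (∇_B a) + a ∧ a`. -/
lemma formDensity_curvature_add (x : M) :
    formDensity g o (trWedge (altTensor Ψ + wedgeSelf A) (A - B)) x +
      formDensity g o (trWedge (altTensor Φ + wedgeSelf B) (A - B)) x =
    2 * formDensity g o (trWedge (altTensor (Φ + lieTensor B B)) (A - B)) x -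
      2 * formDensity g o (trWedge (wedgeSelf B) (A - B)) x +
      formDensity g o (trWedge (altTensor (Ψ - Φ + lieTensor B (A - B))) (A - B)) x +
      formDensity g o (trWedge (wedgeSelf (A - B)) (A - B)) x := by
  have key : ∀ b : Fin 3 → TangentSpace 𝓘(ℝ, E3) x,
      trWedge (altTensor Ψ + wedgeSelf A) (A - B) x b +
      trWedge (altTensor Φ + wedgeSelf B) (A - B) x b =
      2 * trWedge (altTensor (Φ + lieTensor B B)) (A - B) x b -
      2 * trWedge (wedgeSelf B) (A - B) x b +
      trWedge (altTensor (Ψ - Φ + lieTensor B (A - B))) (A - B) x b +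
      trWedge (wedgeSelf (A - B)) (A - B) x b := by
    intro b
    have s1 : ∀ U V : OneForm M, ⁅U x (b 1), V x (b 0)⁆ = -⁅V x (b 0), U x (b 1)⁆ :=
      fun U V => (lie_skew _ _).symm
    have s2 : ∀ U V : OneForm M, ⁅U x (b 2), V x (b 1)⁆ = -⁅V x (b 1), U x (b 2)⁆ :=
      fun U V => (lie_skew _ _).symm
    have s3 : ∀ U V : OneForm M, ⁅U x (b 0), V x (b 2)⁆ = -⁅V x (b 2), U x (b 0)⁆ :=
      fun U V => (lie_skew _ _).symm
    simp only [trWedge_eq, Pi.add_apply, LinearMap.add_apply, Pi.sub_apply, LinearMap.sub_apply,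
      wedgeSelf_apply, lieTensor_apply, altTensor_apply, ← suForm_apply, map_add, map_sub, lie_sub,
      sub_lie, s1, s2, s3, map_neg, LinearMap.neg_apply]
    ring
  have h := key (frame x)
  simp only [formDensity_def]
  linear_combination (frameSign o (frame x) / √(gramMat g x (frame x)).det) * h

/-! ### Integrals -/

lemma integral_mul_le {α : Type*} {_ : MeasurableSpace α} {μ : Measure α}
    [ENNReal.HolderTriple p q 1] {f h : α → ℝ} (hf : MemLp f p μ) (hh : MemLp h q μ)
    (hf0 : ∀ x, 0 ≤ f x) (hh0 : ∀ x, 0 ≤ h x) :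
    Integrable (fun x => f x * h x) μ ∧
      ∫ x, f x * h x ∂μ ≤ (eLpNorm f p μ).toReal * (eLpNorm h q μ).toReal := by
  have hm : MemLp (f * h) 1 μ := hh.mul hf
  refine ⟨memLp_one_iff_integrable.1 hm, ?_⟩
  have e1 : ∫ x, f x * h x ∂μ = (eLpNorm (f * h) 1 μ).toReal := by
    rw [eLpNorm_one_eq_lintegral_enorm, ← integral_norm_eq_lintegral_enorm hm.1]
    refine integral_congr_ae (ae_of_all _ fun x => ?_)
    simp only [Pi.mul_apply]
    rw [Real.norm_of_nonneg (mul_nonneg (hf0 x) (hh0 x))]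
  have h1 : eLpNorm (f • h) 1 μ ≤ eLpNorm f p μ * eLpNorm h q μ :=
    eLpNorm_smul_le_mul_eLpNorm hh.1 hf.1
  rw [e1, ← ENNReal.toReal_mul]
  exact ENNReal.toReal_mono (ENNReal.mul_ne_top hf.2.ne hh.2.ne) h1

/-- Hölder's inequality for the product of two functions in `L^3`. -/
lemma memLp_mul_three {α : Type*} {_ : MeasurableSpace α} {μ : Measure α} {f h : α → ℝ}
    (hf : MemLp f 3 μ) (hh : MemLp h 3 μ) :
    MemLp (fun x => f x * h x) (3 / 2) μ ∧ (eLpNorm (fun x => f x * h x) (3 / 2) μ).toReal ≤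
      (eLpNorm f 3 μ).toReal * (eLpNorm h 3 μ).toReal := by
  have hm : MemLp (f * h) (3 / 2) μ := hh.mul hf
  have h1 : eLpNorm (f • h) (3 / 2) μ ≤ eLpNorm f 3 μ * eLpNorm h 3 μ :=
    eLpNorm_smul_le_mul_eLpNorm hh.1 hf.1
  refine ⟨hm, ?_⟩
  rw [← ENNReal.toReal_mul]
  exact ENNReal.toReal_mono (ENNReal.mul_ne_top hf.2.ne hh.2.ne) h1

variable [MeasurableSpace M] [BorelSpace M] [CompactSpace M]

lemma memLp_normForm₂_wedgeSelf [ENNReal.HolderTriple q q p] (ha : MeasComp₁ a)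
    (h : MemLp (norm₁ g a) q (riemVolume g)) :
    MemLp (normForm₂ g (wedgeSelf a)) p (riemVolume g) := by
  have h1 : MemLp (norm₁ g a * norm₁ g a) p (riemVolume g) := h.mul h
  refine (h1.const_mul 2).mono' ((ha.lieTensor ha).normForm₂ g) (ae_of_all _ fun x => ?_)
  rw [Real.norm_of_nonneg (normForm₂_nonneg g _)]
  exact (normForm₂_wedgeSelf_le g a).trans_eq (by simp only [Pi.mul_apply]; ring)

lemma memLp_normForm₂_add (hΨ : MeasComp₂ Ψ) (hΦ : MeasComp₂ Φ)
    (h : MemLp (normForm₂ g Ψ) p (riemVolume g)) (h' : MemLp (normForm₂ g Φ) p (riemVolume g)) :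
    MemLp (normForm₂ g (Ψ + Φ)) p (riemVolume g) := by
  refine ((h.const_mul 2).add (h'.const_mul 2)).mono' ((hΨ.add hΦ).normForm₂ g)
    (ae_of_all _ fun x => ?_)
  rw [Real.norm_of_nonneg (normForm₂_nonneg g _)]
  exact normForm₂_add_le g Ψ Φ

lemma IsWeakCovDeriv.curvature_ae_eq (H : IsWeakCovDeriv g 0 A Ψ) :
    ∀ᵐ x ∂(riemVolume g), curvature A x = (altTensor Ψ + wedgeSelf A) x := by
  filter_upwards [H.weakExtDeriv_ae_eq] with x hx
  rw [curvature, Pi.add_apply, Pi.add_apply, hx]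

lemma IsWeakCovDeriv.memLp_curvature [ENNReal.HolderTriple q q p] (H : IsWeakCovDeriv g 0 A Ψ)
    (hA : MemLp (CSBound.norm₁ g A) q (riemVolume g))
    (hΨ : MemLp (CSBound.norm₂ g Ψ) p (riemVolume g)) :
    MemLp (normForm₂ g (curvature A)) p (riemVolume g) := by
  have h := memLp_normForm₂_add (g := g) H.measComp₂.altTensor (H.measComp₁.lieTensor H.measComp₁)
    (H.measComp₂.memLp_normForm₂_altTensor hΨ)
    (memLp_normForm₂_wedgeSelf (p := p) (q := q) H.measComp₁ hA)
  refine h.ae_eq ?_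
  filter_upwards [H.curvature_ae_eq] with x hx
  exact (normForm₂_congr hx).symm

variable [T2Space M]

/-- The Chern-Simons functional of a form in `L^{3/2}_1` is an absolutely convergent integral: `dA` is
in `L^{3/2}`, `A ∧ A` in `L^{3/2}` and `A` in `L^3`. -/
lemma MemSobolev.integrable_csDensity (hA : MemSobolev g (3 / 2) A) :
    Integrable (csDensity g o A) (riemVolume g) := by
  have hA3 := hA.memLp_three
  obtain ⟨Ψ, H, h1, h2⟩ := hA
  have I1 := integrable_formDensity_trWedge o H.measComp₂.altTensor H.measComp₁
    (fun x => isAltAt_altTensor Ψ) (H.measComp₂.memLp_normForm₂_altTensor h2) hA3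
  have I2 := integrable_formDensity_trWedge (p := 3 / 2) o (H.measComp₁.lieTensor H.measComp₁)
    H.measComp₁ (fun x => isAltAt_wedgeSelf A) (memLp_normForm₂_wedgeSelf H.measComp₁ hA3) hA3
  refine (I1.add (I2.const_mul (2 / 3))).congr ?_
  filter_upwards [H.weakExtDeriv_ae_eq] with x hx
  have h3 : trWedge (altTensor Ψ) A x = trWedge (weakExtDeriv A) A x := by
    ext b; simp only [trWedge, hx]
  have h4 : trWedge (lieTensor A A) A x = trWedge (wedgeSelf A) A x := rfl
  simp only [Pi.add_apply, h4, csDensity, formDensity_def, h3]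
  ring

/-- The difference of the Chern-Simons integrals; the exact term integrates to zero. -/
lemma integral_csDensity_sub (HA : IsWeakCovDeriv g 0 A Ψ) (HB : IsWeakCovDeriv g 0 B Φ)
    (hA : MemLp (norm₁ g A) (3 / 2) (riemVolume g)) (hB : MemLp (norm₁ g B) (3 / 2) (riemVolume g))
    (hΨ : MemLp (norm₂ g Ψ) (3 / 2) (riemVolume g)) (hΦ : MemLp (norm₂ g Φ) (3 / 2) (riemVolume g)) :
    ∫ x, csDensity g o A x ∂(riemVolume g) - ∫ x, csDensity g o B x ∂(riemVolume g) =
    ∫ x, (formDensity g o (trWedge (altTensor Ψ + wedgeSelf A) (A - B)) x +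
      formDensity g o (trWedge (altTensor Φ + wedgeSelf B) (A - B)) x -
      1 / 3 * formDensity g o (trWedge (wedgeSelf (A - B)) (A - B)) x) ∂(riemVolume g) := by
  have sA : MemSobolev g (3 / 2) A := ⟨Ψ, HA, hA, hΨ⟩
  have sB : MemSobolev g (3 / 2) B := ⟨Φ, HB, hB, hΦ⟩
  have ICA := sA.integrable_csDensity o
  have ICB := sB.integrable_csDensity o
  have I1 := integrable_formDensity_trWedge o HA.measComp₂.altTensor HB.measComp₁
    (fun x => isAltAt_altTensor Ψ) (HA.measComp₂.memLp_normForm₂_altTensor hΨ) sB.memLp_three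
  have I2 := integrable_formDensity_trWedge o HB.measComp₂.altTensor HA.measComp₁
    (fun x => isAltAt_altTensor Φ) (HB.measComp₂.memLp_normForm₂_altTensor hΦ) sA.memLp_three
  have hst := integral_trWedge_comm o HA HB sA.memLp_three sB.memLp_three hA hB hΨ hΦ
  have h1 := integral_sub ICA ICB
  have h2 := integral_sub I1 I2
  have h3 := integral_sub (ICA.sub ICB) (I1.sub I2)
  simp only [Pi.sub_apply] at h3
  rw [h1, h2, hst, sub_self, sub_zero] at h3
  rw [← h3]
  refine integral_congr_ae ?_
  filter_upwards [HA.weakExtDeriv_ae_eq, HB.weakExtDeriv_ae_eq] with x hxA hxB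
  rw [csDensity_sub_csDensity o hxA hxB]
  ring

lemma abs_chernSimons_sub (A B : OneForm M) :
    |chernSimons g o A - chernSimons g o B| = 1 / (8 * Real.pi ^ 2) *
      |∫ x, csDensity g o A x ∂(riemVolume g) - ∫ x, csDensity g o B x ∂(riemVolume g)| := by
  rw [chernSimons, chernSimons, ← mul_sub, abs_mul, abs_neg, abs_of_nonneg (by positivity)]

lemma one_div_eight_pi_sq_le : 1 / (8 * Real.pi ^ 2) ≤ 1 / 72 := by
  have := Real.pi_gt_three
  exact one_div_le_one_div_of_le (by norm_num) (by nlinarith)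

lemma isSobolevConst_toReal {c : ℝ≥0} (hc : IsSobolevConst g B p c) (ha : MemSobolev g p a)
    (hs : sobolevNorm g B p a ≠ ⊤) :
    (eLpNorm (norm₁ g a) 3 (riemVolume g)).toReal ≤ c * (sobolevNorm g B p a).toReal := by
  have := ENNReal.toReal_mono (ENNReal.mul_ne_top ENNReal.coe_ne_top hs) (hc a ha)
  rwa [ENNReal.toReal_mul, ENNReal.coe_toReal] at this

/-- The numerical part of the estimate for `L^2_1`. The Hölder bounds `b1`, `b2`, `b3` for the three
integrals of `hI` are combined with the Sobolev bound `n ≤ c s` for `n = ‖a‖₃`. -/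
lemma real_bound_two {FA FB s n n2 m c κ I J1 J2 J3 : ℝ} (hFA : 0 ≤ FA) (hFB : 0 ≤ FB) (hn : 0 ≤ n)
    (hκ : κ ≤ 1 / 72) (h2 : n2 ≤ s) (hns : n ≤ c * s) (b1 : J1 ≤ FA * n2)
    (b2 : J2 ≤ FB * n2) (c3 : m ≤ n * n) (b3 : J3 ≤ m * n) (hI : |I| ≤ J1 + J2 + 2 / 3 * J3) :
    κ * |I| ≤ (FA + FB) * s + c ^ 3 * s ^ 3 := by
  have k1 := mul_le_mul_of_nonneg_left h2 hFA
  have k2 := mul_le_mul_of_nonneg_left h2 hFB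
  have k3 := mul_le_mul_of_nonneg_right c3 hn
  have h0 := hn.trans hns
  have k4 : n * n * n ≤ (c * s) * (c * s) * (c * s) :=
    mul_le_mul (mul_le_mul hns hns hn h0) hns hn (mul_nonneg h0 h0)
  have k5 : (c * s) * (c * s) * (c * s) = c ^ 3 * s ^ 3 := by ring
  have k6 : 0 ≤ n * n * n := by positivity
  have k7 : κ * |I| ≤ 1 / 72 * |I| := mul_le_mul_of_nonneg_right hκ (abs_nonneg _)
  have k8 := abs_nonneg I
  rw [add_mul]
  linarith

/-- The numerical part of the estimate for `L^{3/2}_1`. Here `s = ‖a‖`, `β = ‖B‖` are Sobolev norms,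
and `n = ‖a‖₃`, `m = ‖B‖₃`. The factors `4`, `4`, `2` and `4 / 3` of the four integrals are absorbed
by `κ ≤ 1 / 72`. -/
lemma real_bound_three_halves {s β n m mm nn tB ta c κ I J1 J2 J3 J4 : ℝ} (hs : 0 ≤ s) (hβ : 0 ≤ β)
    (hn : 0 ≤ n) (hm : 0 ≤ m) (hc : 0 ≤ c) (hκ : κ ≤ 1 / 72) (hmβ : m ≤ c * β) (htB : tB ≤ β)
    (hns : n ≤ c * s) (hta : ta ≤ s) (b1 : J1 ≤ tB * n) (c2 : mm ≤ m * m) (b2 : J2 ≤ mm * n)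
    (b3 : J3 ≤ ta * n) (c4 : nn ≤ n * n) (b4 : J4 ≤ nn * n)
    (hI : |I| ≤ 4 * J1 + 4 * J2 + 2 * J3 + 4 / 3 * J4) :
    κ * |I| ≤ (c + (c + c ^ 3) * β + c ^ 3 * β ^ 2) * s + (c + c ^ 3 + c ^ 3 * β) * s ^ 3 := by
  have k1 : tB * n ≤ β * (c * s) := mul_le_mul htB hns hn hβ
  have k2 : m * m * n ≤ (c * β) * (c * β) * (c * s) := by gcongr
  have k3 : ta * n ≤ s * (c * s) := mul_le_mul hta hns hn hs
  have k4 : n * n * n ≤ (c * s) * (c * s) * (c * s) := by gcongr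
  have k2' := mul_le_mul_of_nonneg_right c2 hn
  have k4' := mul_le_mul_of_nonneg_right c4 hn
  -- `2 s² ≤ s + s³`
  have k5 : 0 ≤ c * (s * (s - 1) ^ 2) := by positivity
  have p1 : 0 ≤ c * s := by positivity
  have p2 : 0 ≤ c * β * s := by positivity
  have p3 : 0 ≤ c ^ 3 * β * s := by positivity
  have p4 : 0 ≤ c ^ 3 * β ^ 2 * s := by positivity
  have p5 : 0 ≤ c * s ^ 3 := by positivity
  have p6 : 0 ≤ c ^ 3 * s ^ 3 := by positivity
  have p7 : 0 ≤ c ^ 3 * β * s ^ 3 := by positivity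
  have hb : |I| ≤ 4 * (β * (c * s)) + 4 * ((c * β) * (c * β) * (c * s)) + 2 * (s * (c * s)) +
      4 / 3 * ((c * s) * (c * s) * (c * s)) := by linarith
  have h7 : κ * |I| ≤ 1 / 72 * |I| := mul_le_mul_of_nonneg_right hκ (abs_nonneg _)
  linarith

/-- The inequality for `A`, `B` in `L^2_1`. -/
lemma abs_chernSimons_sub_le_of_two (hA : MemSobolev g 2 A) (hB : MemSobolev g 2 B)
    {c : ℝ≥0} (hc : IsSobolevConst g B 2 c) :
    |chernSimons g o A - chernSimons g o B| ≤
      ((eLpNorm (normForm₂ g (curvature A)) 2 (riemVolume g)).toReal +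
        (eLpNorm (normForm₂ g (curvature B)) 2 (riemVolume g)).toReal) *
          (sobolevNorm g B 2 (A - B)).toReal +
      (c : ℝ) ^ 3 * (sobolevNorm g B 2 (A - B)).toReal ^ 3 := by
  have sAB := hA.sub hB
  have hA4 := hA.memLp_four
  have hB4 := hB.memLp_four
  have hA32 := hA.mono_exponent three_halves_le_two
  have hB32 := hB.mono_exponent three_halves_le_two
  have ha3 := (hA32.sub hB32).memLp_three
  obtain ⟨Ψ, HA, hA2, hΨ⟩ := hA
  obtain ⟨Φ, HB, hB2, hΦ⟩ := hB
  have := isFiniteMeasure_riemVolume g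
  obtain ⟨Θ, HΘ, -, hΘ⟩ := sAB.exists_covDeriv (q := 4) sAB.memLp_four HB.measComp₁ hB4
  have ha2 := memLp_norm₁_sub HA.measComp₁ HB.measComp₁ hA2 hB2
  have hs := HΘ.sobolevNorm_ne_top ha2.2.ne hΘ.2.ne
  have hc3 := isSobolevConst_toReal hc sAB hs
  have hl2 := ENNReal.toReal_mono hs (HΘ.eLpNorm_le_sobolevNorm (by simp) (by simp)).1
  have hFA := HA.memLp_curvature hA4 hΨ
  have hFB := HB.memLp_curvature hB4 hΦ
  have hN := fun x : M => norm₁_nonneg (x := x) g (A - B)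
  obtain ⟨J1, b1⟩ := integral_mul_le hFA ha2 (fun x => normForm₂_nonneg g _) hN
  obtain ⟨J2, b2⟩ := integral_mul_le hFB ha2 (fun x => normForm₂_nonneg g _) hN
  obtain ⟨m3, c3⟩ := memLp_mul_three ha3 ha3
  obtain ⟨J3, b3⟩ := integral_mul_le m3 ha3 (fun x => mul_nonneg (hN x) (hN x)) hN
  have hint : |∫ x, csDensity g o A x ∂(riemVolume g) - ∫ x, csDensity g o B x ∂(riemVolume g)| ≤
      ∫ x, (normForm₂ g (curvature A) x * norm₁ g (A - B) x +
        normForm₂ g (curvature B) x * norm₁ g (A - B) x +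
        2 / 3 * (norm₁ g (A - B) x * norm₁ g (A - B) x * norm₁ g (A - B) x)) ∂(riemVolume g) := by
    rw [integral_csDensity_sub o HA HB (hA2.mono_exponent three_halves_le_two)
      (hB2.mono_exponent three_halves_le_two) (hΨ.mono_exponent three_halves_le_two)
      (hΦ.mono_exponent three_halves_le_two), ← Real.norm_eq_abs]
    refine norm_integral_le_of_norm_le ((J1.add J2).add (J3.const_mul (2 / 3))) ?_
    filter_upwards [HA.curvature_ae_eq, HB.curvature_ae_eq] with x hxA hxB
    have z1 := abs_formDensity_trWedge_le g o ((isAltAt_altTensor Ψ).add (isAltAt_wedgeSelf (x := x) A)) (A - B)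
    have z2 := abs_formDensity_trWedge_le g o ((isAltAt_altTensor Φ).add (isAltAt_wedgeSelf (x := x) B)) (A - B)
    have z3 := abs_formDensity_trWedge_le g o (isAltAt_wedgeSelf (x := x) (A - B)) (A - B)
    rw [← normForm₂_congr hxA] at z1
    rw [← normForm₂_congr hxB] at z2
    have z4 := mul_le_mul_of_nonneg_right (normForm₂_wedgeSelf_le (x := x) g (A - B)) (hN x)
    have z5 : norm₁ g (A - B) x ^ 2 = norm₁ g (A - B) x * norm₁ g (A - B) x := sq _
    rw [z5] at z4
    rw [Real.norm_eq_abs]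
    have y1 := abs_le.1 z1
    have y2 := abs_le.1 z2
    have y3 := abs_le.1 z3
    exact abs_le.2 ⟨by linarith [y1.1, y2.1, y3.2], by linarith [y1.2, y2.2, y3.1]⟩
  have e1 := integral_add (J1.add J2) (J3.const_mul (2 / 3))
  have e2 := integral_add J1 J2
  simp only [Pi.add_apply] at e1 e2
  rw [e1, e2, integral_const_mul] at hint
  rw [abs_chernSimons_sub]
  exact real_bound_two ENNReal.toReal_nonneg ENNReal.toReal_nonneg ENNReal.toReal_nonneg
    one_div_eight_pi_sq_le hl2 hc3 b1 b2 c3 b3 hint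

/-- The inequality for `A`, `B` in `L^{3/2}_1`. -/
lemma abs_chernSimons_sub_le_of_three_halves (hA : MemSobolev g (3 / 2) A)
    (hB : MemSobolev g (3 / 2) B) {c : ℝ≥0} (hc : IsSobolevConst g B (3 / 2) c) {β : ℝ}
    (hβ : β = (sobolevNorm g B (3 / 2) B).toReal) :
    |chernSimons g o A - chernSimons g o B| ≤
      (c + (c + c ^ 3) * β + c ^ 3 * β ^ 2) * (sobolevNorm g B (3 / 2) (A - B)).toReal +
      (c + c ^ 3 + c ^ 3 * β) * (sobolevNorm g B (3 / 2) (A - B)).toReal ^ 3 := by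
  have sAB := hA.sub hB
  have ha3 := sAB.memLp_three
  have hB3 := hB.memLp_three
  have sB := hB
  obtain ⟨Ψ, HA, hA2, hΨ⟩ := hA
  obtain ⟨Φ, HB, hB2, hΦ⟩ := hB
  have mB := HB.measComp₁
  have ma := HA.measComp₁.sub mB
  have HBB := HB.add_lieTensor B
  have HBa := (HA.sub HB).add_lieTensor B
  have ha2 := memLp_norm₁_sub HA.measComp₁ HB.measComp₁ hA2 hB2
  have hlBB := mB.lieTensor mB
  have hlBa := mB.lieTensor ma
  have hmd := HA.measComp₂.sub HB.measComp₂
  have hΘB := memLp_norm₂_add HB.measComp₂ hlBB hΦ (memLp_norm₂_lieTensor mB mB hB3 hB3)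
  have hΘa := memLp_norm₂_add hmd hlBa (memLp_norm₂_sub HA.measComp₂ HB.measComp₂ hΨ hΦ)
    (memLp_norm₂_lieTensor mB ma hB3 ha3)
  have hsB := HBB.sobolevNorm_ne_top hB2.2.ne hΘB.2.ne
  have hsa := HBa.sobolevNorm_ne_top ha2.2.ne hΘa.2.ne
  have hcB := isSobolevConst_toReal hc sB hsB
  have hca := isSobolevConst_toReal hc sAB hsa
  have hlB := ENNReal.toReal_mono hsB
    (HBB.eLpNorm_le_sobolevNorm three_halves_ne_zero three_halves_ne_top).2
  have hla := ENNReal.toReal_mono hsa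
    (HBa.eLpNorm_le_sobolevNorm three_halves_ne_zero three_halves_ne_top).2
  have hN := fun x : M => norm₁_nonneg (x := x) g (A - B)
  have hNB := fun x : M => norm₁_nonneg (x := x) g B
  set ΘB := Φ + lieTensor B B with hΘBdef
  set Θa := Ψ - Φ + lieTensor B (A - B) with hΘadef
  obtain ⟨J1, b1⟩ := integral_mul_le hΘB ha3 (fun x => norm₂_nonneg g _) hN
  obtain ⟨m2, c2⟩ := memLp_mul_three hB3 hB3
  obtain ⟨J2, b2⟩ := integral_mul_le m2 ha3 (fun x => mul_nonneg (hNB x) (hNB x)) hN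
  obtain ⟨J3, b3⟩ := integral_mul_le hΘa ha3 (fun x => norm₂_nonneg g _) hN
  obtain ⟨m4, c4⟩ := memLp_mul_three ha3 ha3
  obtain ⟨J4, b4⟩ := integral_mul_le m4 ha3 (fun x => mul_nonneg (hN x) (hN x)) hN
  have hint : |∫ x, csDensity g o A x ∂(riemVolume g) - ∫ x, csDensity g o B x ∂(riemVolume g)| ≤
      ∫ x, (4 * (norm₂ g ΘB x * norm₁ g (A - B) x) +
        4 * (norm₁ g B x * norm₁ g B x * norm₁ g (A - B) x) +
        2 * (norm₂ g Θa x * norm₁ g (A - B) x) +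
        4 / 3 * (norm₁ g (A - B) x * norm₁ g (A - B) x * norm₁ g (A - B) x)) ∂(riemVolume g) := by
    rw [integral_csDensity_sub o HA HB hA2 hB2 hΨ hΦ, ← Real.norm_eq_abs]
    refine norm_integral_le_of_norm_le ((((J1.const_mul 4).add (J2.const_mul 4)).add
      (J3.const_mul 2)).add (J4.const_mul (4 / 3))) (ae_of_all _ fun x => ?_)
    rw [formDensity_curvature_add, ← hΘBdef, ← hΘadef, Real.norm_eq_abs]
    have z1 := (abs_formDensity_trWedge_le g o (isAltAt_altTensor (x := x) ΘB) (A - B)).trans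
      (mul_le_mul_of_nonneg_right (normForm₂_altTensor_le g ΘB) (hN x))
    have z2 := (abs_formDensity_trWedge_le g o (isAltAt_wedgeSelf (x := x) B) (A - B)).trans
      (mul_le_mul_of_nonneg_right (normForm₂_wedgeSelf_le g B) (hN x))
    have z3 := (abs_formDensity_trWedge_le g o (isAltAt_altTensor (x := x) Θa) (A - B)).trans
      (mul_le_mul_of_nonneg_right (normForm₂_altTensor_le g Θa) (hN x))
    have z4 := (abs_formDensity_trWedge_le g o (isAltAt_wedgeSelf (x := x) (A - B)) (A - B)).trans
      (mul_le_mul_of_nonneg_right (normForm₂_wedgeSelf_le g (A - B)) (hN x))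
    rw [sq] at z2 z4
    have y1 := abs_le.1 z1
    have y2 := abs_le.1 z2
    have y3 := abs_le.1 z3
    have y4 := abs_le.1 z4
    exact abs_le.2 ⟨by linarith [y1.1, y2.2, y3.1, y4.1], by linarith [y1.2, y2.1, y3.2, y4.2]⟩
  have e1 := integral_add (((J1.const_mul 4).add (J2.const_mul 4)).add (J3.const_mul 2))
    (J4.const_mul (4 / 3))
  have e2 := integral_add ((J1.const_mul 4).add (J2.const_mul 4)) (J3.const_mul 2)
  have e3 := integral_add (J1.const_mul 4) (J2.const_mul 4)
  simp only [Pi.add_apply] at e1 e2 e3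
  rw [e1, e2, e3, integral_const_mul, integral_const_mul, integral_const_mul,
    integral_const_mul] at hint
  rw [abs_chernSimons_sub]
  rw [← hβ] at hcB hlB
  exact real_bound_three_halves ENNReal.toReal_nonneg (hβ ▸ ENNReal.toReal_nonneg)
    ENNReal.toReal_nonneg ENNReal.toReal_nonneg c.2 one_div_eight_pi_sq_le hcB hlB hca hla b1 c2 b2 b3
    c4 b4 hint

end Difference

end CSBound

end

open CSBound in
theorem lemma3p1 {M : Type*} [TopologicalSpace M] [ChartedSpace E3 M]
    [IsManifold 𝓘(ℝ, E3) ∞ M] [T2Space M] [CompactSpace M] [MeasurableSpace M] [BorelSpace M]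
    (g : RMetric M) (o : MfdOrientation M) :
    -- (i)
    (∀ B : OneForm M, MemSobolev g 2 B →
      (∃ c₁ : ℝ≥0, 0 < c₁ ∧ IsSobolevConst g B 2 c₁) ∧
      ∀ A : OneForm M, MemSobolev g 2 A →
        (∃ η : TwoTensor M, IsWeakExtDeriv A η) ∧ (∃ η : TwoTensor M, IsWeakExtDeriv B η) ∧
        Integrable (csDensity g o A) (riemVolume g) ∧
        Integrable (csDensity g o B) (riemVolume g) ∧
        MemLp (normForm₂ g (curvature A)) 2 (riemVolume g) ∧
        MemLp (normForm₂ g (curvature B)) 2 (riemVolume g) ∧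
        sobolevNorm g B 2 (A - B) ≠ ⊤ ∧
        ∀ c₁ : ℝ≥0, IsSobolevConst g B 2 c₁ →
          |chernSimons g o A - chernSimons g o B| ≤
            ((eLpNorm (normForm₂ g (curvature A)) 2 (riemVolume g)).toReal +
              (eLpNorm (normForm₂ g (curvature B)) 2 (riemVolume g)).toReal) *
                (sobolevNorm g B 2 (A - B)).toReal +
            (c₁ : ℝ) ^ 3 * (sobolevNorm g B 2 (A - B)).toReal ^ 3) ∧
    -- (ii)
    (∀ B : OneForm M, MemSobolev g (3 / 2) B →
      (∃ c₄ : ℝ≥0, 0 < c₄ ∧ IsSobolevConst g B (3 / 2) c₄) ∧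
      ∀ A : OneForm M, MemSobolev g (3 / 2) A →
        (∃ η : TwoTensor M, IsWeakExtDeriv A η) ∧ (∃ η : TwoTensor M, IsWeakExtDeriv B η) ∧
        Integrable (csDensity g o A) (riemVolume g) ∧
        Integrable (csDensity g o B) (riemVolume g) ∧
        sobolevNorm g B (3 / 2) B ≠ ⊤ ∧
        sobolevNorm g B (3 / 2) (A - B) ≠ ⊤ ∧
        ∀ c₄ : ℝ≥0, IsSobolevConst g B (3 / 2) c₄ →
          ∀ c₂ c₃ β : ℝ, β = (sobolevNorm g B (3 / 2) B).toReal →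
            c₂ = c₄ + (c₄ + c₄ ^ 3) * β + c₄ ^ 3 * β ^ 2 →
            c₃ = c₄ + c₄ ^ 3 + c₄ ^ 3 * β →
            |chernSimons g o A - chernSimons g o B| ≤
              c₂ * (sobolevNorm g B (3 / 2) (A - B)).toReal +
              c₃ * (sobolevNorm g B (3 / 2) (A - B)).toReal ^ 3) := by
  refine ⟨fun B hB => ⟨exists_isSobolevConst_two hB, fun A hA => ?_⟩,
    fun B hB => ⟨exists_isSobolevConst_three_halves hB, fun A hA => ?_⟩⟩
  · have hA32 := hA.mono_exponent three_halves_le_two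
    have hB32 := hB.mono_exponent three_halves_le_two
    have sAB := hA.sub hB
    obtain ⟨Ψ, HA, hA2, hΨ⟩ := id hA
    obtain ⟨Φ, HB, hB2, hΦ⟩ := id hB
    obtain ⟨Θ, HΘ, -, hΘ⟩ := sAB.exists_covDeriv (q := 4) sAB.memLp_four HB.measComp₁ hB.memLp_four
    exact ⟨⟨_, HA.isWeakExtDeriv⟩, ⟨_, HB.isWeakExtDeriv⟩, hA32.integrable_csDensity o,
      hB32.integrable_csDensity o, HA.memLp_curvature hA.memLp_four hΨ,
      HB.memLp_curvature hB.memLp_four hΦ,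
      HΘ.sobolevNorm_ne_top (memLp_norm₁_sub HA.measComp₁ HB.measComp₁ hA2 hB2).2.ne hΘ.2.ne,
      fun c₁ hc => abs_chernSimons_sub_le_of_two o hA hB hc⟩
  · have sAB := hA.sub hB
    obtain ⟨Ψ, HA, hA2, hΨ⟩ := id hA
    obtain ⟨Φ, HB, hB2, hΦ⟩ := id hB
    obtain ⟨Θ, HΘ, -, hΘ⟩ := sAB.exists_covDeriv (q := 3) sAB.memLp_three HB.measComp₁ hB.memLp_three
    obtain ⟨Θ', HΘ', -, hΘ'⟩ := hB.exists_covDeriv (q := 3) hB.memLp_three HB.measComp₁ hB.memLp_three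
    refine ⟨⟨_, HA.isWeakExtDeriv⟩, ⟨_, HB.isWeakExtDeriv⟩, hA.integrable_csDensity o,
      hB.integrable_csDensity o, HΘ'.sobolevNorm_ne_top hB2.2.ne hΘ'.2.ne,
      HΘ.sobolevNorm_ne_top (memLp_norm₁_sub HA.measComp₁ HB.measComp₁ hA2 hB2).2.ne hΘ.2.ne, ?_⟩
    rintro c₄ hc _ _ β hβ rfl rfl
    exact abs_chernSimons_sub_le_of_three_halves o hA hB hc hβ
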